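/- Let $V$ be a Euclidean space of dimension $n$, $\Phi\subset V$ a finite reduced root system spanning $V$ (not necessarily irreducible or crystallographic), $W$ its finite reflection group, $\Delta=\{\alpha_1,\dots,\alpha_n\}$ a basis of simple roots. Let $\mathcal C_\Phi$ be the set of subspaces spanned by nonempty sets of roots. Let $\mathcal G\subset\mathcal C_\Phi$ be a $W$-invariant building set with $V\in\mathcal G$: it contains all lines $\langle\beta\rangle$, $\beta\in\Phi$, and every $C\in\mathcal C_\Phi$ is the direct sum of the maximal elements of $\mathcal G$ contained in $C$. Let $\mathcal C_{fund}$ and $\mathcal G_{fund}$ consist of the elements of $\mathcal C_\Phi$, resp. $\mathcal G$, spanned by simple roots. For $A\in\mathcal G_{fund}$ let $W_A$ be generated by the reflections $s_\beta$, $\beta\in\Phi\cap A$. A set $\mathcal S\subset\mathcal G_{fund}$ is nested if no sum of two or more pairwise non-comparable elements of $\mathcal S$ is in $\mathcal G_{fund}$. Let $\delta$ be half the sum of the positive roots and $\pi_A$ the orthogonal projection of $\delta$ to $A$. For $B\subsetneq A$ in $\mathcal G_{fund}$ let $R^A_B$ be the maximal coefficient of $\pi_A$ divided by the minimal coefficient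 of $\pi_B$, written in the simple roots in $A$, resp. $B$; let $R^i_j$ be the maximum of the $R^A_B$ with $\dim A=i$, $\dim B=j$ ($R^i_j=1$ if there is no such pair). Fix a suitable list: $0<\epsilon_1<\dots<\epsilon_n=a$ with $\epsilon_i>2R^i_{i-1}\epsilon_{i-1}$ for $2\le i\le n$. Put $H_V=\{x:(x,\delta)=a\}$, and for $C\in\mathcal C_{fund}$, $C\ne V$, with $A_1,\dots,A_k$ the maximal elements of $\mathcal G_{fund}$ contained in $C$, put $$H_C=\Big\{x:\big(x,\ \delta-\textstyle\sum_i\pi_{A_i}\big)=a-\sum_i\epsilon_{\dim A_i}\Big\};$$ let $HS_C$ be the closed half-space bounded by $H_C$ that contains $0$. The permutonestohedron is $P=P_{\mathcal G}(\Phi)=\bigcap_{\sigma\in W,\,C\in\mathcal C_{fund}}\sigma HS_C$. The nestohedron is $P_{fund}=H_V\cap\bigcap_{A\in\mathcal G_{fund}\setminus\{V\}}HS_A$, and its face associated with a nested set $\mathcal S\ni V$ is $F_{\mathcal S}=P_{fund}\cap\bigcap_{A\in\mathcal S}H_A$. A labelled nested set is a nested set $\mathcal S\ni V$ of $\mathcal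 G_{fund}$ in which every minimal element $A$ has a label, either $W_A$ (nontrivial) or $\{e\}$ (trivial). Let $H=H(\mathcal S)\subset W$ be the subgroup generated by the labels. For $\sigma\in W$ put $$F(\sigma,\mathcal S)=\sigma\,\mathrm{conv}\Big(\bigcup_{h\in H}hF_{\mathcal S}\Big).$$ Then: 1. $H$ is the internal direct product of the nontrivial labels. 2. $(\sigma H,\mathcal S)\mapsto F(\sigma,\mathcal S)$ is a well defined bijection from the pairs ($\mathcal S$ a labelled nested set, $\sigma H$ a coset in $W$ of $H=H(\mathcal S)$) onto the nonempty faces of $P$ (including $P$ itself). 3. $\dim F(\sigma,\mathcal S)=n-|\mathcal S|+l$, where $l$ is the number of nontrivial labels of $\mathcal S$. 4. Let $A_1,\dots,A_k$ be the minimal elements of $\mathcal S$ with nontrivial label and $D=A_1\oplus\dots\oplus A_k$. If $k\ge1$ and $V$ is not among the $A_i$, then $F(e,\mathcal S)$ is the intersection of $P$ with the hyperplanes $H_D$ and $H_{B+D}$, $B\in\mathcal S\setminus\{V,A_1,\dots,A_k\}$. If $V$ has a nontrivial label (so $\mathcal S=\{V\}$, $H=W$), then $F(e,\mathcal S)=P$.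 5. $F(\sigma',\mathcal S')\subsetneq F(\sigma,\mathcal S)$ if and only if $\sigma'H'\subseteq\sigma H$, where $H'=H(\mathcal S')$, and $\mathcal S'$ is obtained from $\mathcal S$ by a composition of one or more of the following moves between labelled nested sets (here $\mathcal S$ and $\mathcal S'$ denote the sets before and after the move): - adding a subspace that contains some of the subspaces in $\mathcal S$; - adding a subspace $A$, minimal in $\mathcal S'$, with trivial label, which is either not included in any minimal subspace of $\mathcal S$, or included in a minimal subspace $B$ of $\mathcal S$ labelled by $\{e\}$ (then $B$ loses its label); - adding one or more subspaces, minimal in $\mathcal S'$, all with nontrivial label and all included in a minimal subspace $B$ of $\mathcal S$ that was labelled by $W_B$ and loses its label; - changing the nontrivial label of a minimal subspace into the trivial label. -/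

import Mathlib

open scoped InnerProductSpace

noncomputable section

namespace Permutonesto

variable {V : Type*} [NormedAddCommGroup V] [InnerProductSpace ℝ V]

/-! ## Root systems, reflection groups, simple roots -/

/-- The orthogonal reflection in the hyperplane `β^⊥`. -/
def refl (β : V) : V ≃ₗᵢ[ℝ] V := (ℝ ∙ β)ᗮ.reflection

/-- `Φ` is a (finite, reduced, not necessarily crystallographic or irreducible) root system
spanning the Euclidean space `V`. -/
structure IsRootSystem (Φ : Finset V) : Prop where
  zero_notMem : (0 : V) ∉ Φ
  span_eq_top : Submodule.span ℝ (Φ : Set V) = ⊤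
  refl_mem : ∀ α ∈ Φ, ∀ β ∈ Φ, refl α β ∈ Φ
  reduced : ∀ α ∈ Φ, ∀ c : ℝ, c • α ∈ Φ → c = 1 ∨ c = -1

/-- The basis `Δ` of `V` is a basis of simple roots for `Φ`. -/
structure IsSimpleSystem {n : ℕ} (Φ : Finset V) (Δ : Module.Basis (Fin n) ℝ V) : Prop where
  mem : ∀ i, Δ i ∈ Φ
  sign : ∀ β ∈ Φ, (∀ i, 0 ≤ Δ.repr β i) ∨ (∀ i, Δ.repr β i ≤ 0)

/-- The group `W` generated by all the reflections `s_β`, `β ∈ Φ`. -/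
def coxeterGroup (Φ : Finset V) : Subgroup (V ≃ₗᵢ[ℝ] V) :=
  Subgroup.closure {g | ∃ β ∈ Φ, g = refl β}

/-- The subgroup `W_A` generated by the reflections `s_β`, `β ∈ Φ ∩ A`. -/
def parabolic (Φ : Finset V) (A : Submodule ℝ V) : Subgroup (V ≃ₗᵢ[ℝ] V) :=
  Subgroup.closure {g | ∃ β ∈ Φ, β ∈ A ∧ g = refl β}

/-! ## Building sets and nested sets -/

/-- `C_Φ`: the subspaces spanned by some (at least one) of the roots. -/
def rootSpaces (Φ : Finset V) : Set (Submodule ℝ V) :=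
  {C | ∃ T : Set V, T ⊆ Φ ∧ T.Nonempty ∧ C = Submodule.span ℝ T}

/-- The maximal elements of `G` contained in `C`. -/
def maxIn (G : Set (Submodule ℝ V)) (C : Submodule ℝ V) : Set (Submodule ℝ V) :=
  {A | Maximal (fun A => A ∈ G ∧ A ≤ C) A}

/-- `G` is a building set associated to the lines spanned by the roots: it consists of spans of
roots, it contains all the root lines, and every span of roots is the direct sum of the maximal
elements of `G` that it contains. -/
structure IsBuildingSet (Φ : Finset V) (G : Set (Submodule ℝ V)) : Prop where
  subset : G ⊆ rootSpaces Φ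
  line_mem : ∀ β ∈ Φ, (ℝ ∙ β) ∈ G
  sSup_maxIn : ∀ C ∈ rootSpaces Φ, sSup (maxIn G C) = C
  indep_maxIn : ∀ C ∈ rootSpaces Φ, sSupIndep (maxIn G C)

/-- `G_fund`: the elements of `G` that are spanned by some of the simple roots. -/
def fund {n : ℕ} (Δ : Module.Basis (Fin n) ℝ V) (G : Set (Submodule ℝ V)) :
    Set (Submodule ℝ V) :=
  {A | A ∈ G ∧ ∃ I : Set (Fin n), A = Submodule.span ℝ (Δ '' I)}

/-- `S` is nested in `G`: the sum of two or more pairwise non comparable elements of `S` is never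
in `G`. -/
def IsNested (G S : Set (Submodule ℝ V)) : Prop :=
  S ⊆ G ∧ ∀ T ⊆ S, T.Nontrivial → IsAntichain (· ≤ ·) T → sSup T ∉ G

/-- An element of `G` is its own decomposition into maximal elements of `G`. -/
theorem maxIn_eq_singleton {G : Set (Submodule ℝ V)} {A : Submodule ℝ V} (hA : A ∈ G) :
    maxIn G A = {A} := by
  ext B
  constructor
  · intro hB
    have h : Maximal (fun B => B ∈ G ∧ B ≤ A) B := hB
    exact le_antisymm h.prop.2 (h.2 ⟨hA, le_rfl⟩ h.prop.2)
  · rintro rfl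
    exact ⟨⟨hA, le_rfl⟩, fun _ h _ => h.2⟩

/-! ## The vectors `δ`, `π_A`, and suitable lists -/

open Classical in
/-- `δ`: half the sum of the positive roots. -/
def delta {n : ℕ} (Φ : Finset V) (Δ : Module.Basis (Fin n) ℝ V) : V :=
  (1 / 2 : ℝ) • ∑ β ∈ Φ with ∀ i, 0 ≤ Δ.repr β i, β

variable [FiniteDimensional ℝ V]

/-- `π_A`: the orthogonal projection of `δ` to `A`, so that `δ - π_A` is the orthogonal projection
of `δ` to `A^⊥`. -/
def piVec {n : ℕ} (Φ : Finset V) (Δ : Module.Basis (Fin n) ℝ V) (A : Submodule ℝ V) : V :=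
  A.starProjection (delta Φ Δ)

/-- `R^A_B`: the largest coefficient of `π_A` divided by the smallest coefficient of `π_B`, where
`π_A` and `π_B` are written in terms of the simple roots in `A`, respectively in `B`. -/
def ratio {n : ℕ} (Φ : Finset V) (Δ : Module.Basis (Fin n) ℝ V) (A B : Submodule ℝ V) : ℝ :=
  (⨆ i : {i : Fin n // Δ i ∈ A}, Δ.repr (piVec Φ Δ A) i) /
    (⨅ i : {i : Fin n // Δ i ∈ B}, Δ.repr (piVec Φ Δ B) i)

/-- `R^i_j`: the maximum of the `R^A_B` over all `B ⊂ A` in `G_fund` of dimensions `j < i`.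
Every `R^A_B` is at least `1`, so the inserted `1` matters only when there is no such pair; then
`R^i_j = 1`. -/
def maxRatio {n : ℕ} (Φ : Finset V) (Δ : Module.Basis (Fin n) ℝ V) (G : Set (Submodule ℝ V))
    (i j : ℕ) : ℝ :=
  sSup (insert 1 {r | ∃ A ∈ fund Δ G, ∃ B ∈ fund Δ G, B < A ∧
    Module.finrank ℝ A = i ∧ Module.finrank ℝ B = j ∧ r = ratio Φ Δ A B})

/-- The list `ε 1 < ε 2 < ⋯ < ε n` of positive numbers is suitable (the other values of `ε` play
no role). -/
structure IsSuitable {n : ℕ} (Φ : Finset V) (Δ : Module.Basis (Fin n) ℝ V)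
    (G : Set (Submodule ℝ V)) (ε : ℕ → ℝ) : Prop where
  pos : 0 < ε 1
  lt : ∀ i, 1 ≤ i → i < n → ε i < ε (i + 1)
  suitable : ∀ i, 1 ≤ i → i < n → 2 * maxRatio Φ Δ G (i + 1) i * ε i < ε (i + 1)

/-! ## Defining hyperplanes, the permutonestohedron and the nestohedron -/

open Classical in
/-- The normal vector of the defining hyperplane of `C`: it is `δ` for `C = V`, and otherwise
`δ - ∑ π_A` over the `G_fund`-decomposition of `C`; so it is `δ - π_C` if `C ∈ G_fund`. -/
def wallNormal {n : ℕ} (Φ : Finset V) (Δ : Module.Basis (Fin n) ℝ V) (G : Set (Submodule ℝ V))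
    (C : Submodule ℝ V) : V :=
  if C = ⊤ then delta Φ Δ else delta Φ Δ - ∑ᶠ A ∈ maxIn (fund Δ G) C, piVec Φ Δ A

open Classical in
/-- The constant in the equation of the defining hyperplane of `C`: with `a = ε n`, it is `a` for
`C = V`, and otherwise `a - ∑ ε (dim A)` over the `G_fund`-decomposition of `C`. -/
def wallLevel {n : ℕ} (Δ : Module.Basis (Fin n) ℝ V) (G : Set (Submodule ℝ V)) (ε : ℕ → ℝ)
    (C : Submodule ℝ V) : ℝ :=
  if C = ⊤ then ε n else ε n - ∑ᶠ A ∈ maxIn (fund Δ G) C, ε (Module.finrank ℝ A)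

/-- The defining hyperplane of `C`. -/
def wall {n : ℕ} (Φ : Finset V) (Δ : Module.Basis (Fin n) ℝ V) (G : Set (Submodule ℝ V))
    (ε : ℕ → ℝ) (C : Submodule ℝ V) : Set V :=
  {x | ⟪x, wallNormal Φ Δ G C⟫_ℝ = wallLevel Δ G ε C}

/-- The closed half-space bounded by the defining hyperplane of `C` that contains the origin. -/
def halfSpace {n : ℕ} (Φ : Finset V) (Δ : Module.Basis (Fin n) ℝ V) (G : Set (Submodule ℝ V))
    (ε : ℕ → ℝ) (C : Submodule ℝ V) : Set V :=
  {x | ⟪x, wallNormal Φ Δ G C⟫_ℝ ≤ wallLevel Δ G ε C}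

/-- The permutonestohedron: the intersection of all the images `σ HS_C`, for `σ ∈ W` and `C` a
subspace spanned by some of the simple roots (whether or not `C` belongs to `G_fund`). -/
def permutonestohedron {n : ℕ} (Φ : Finset V) (Δ : Module.Basis (Fin n) ℝ V)
    (G : Set (Submodule ℝ V)) (ε : ℕ → ℝ) : Set V :=
  ⋂ σ ∈ coxeterGroup Φ, ⋂ C ∈ fund Δ (rootSpaces Φ), (fun x : V => σ x) '' halfSpace Φ Δ G ε C

/-- The nestohedron in the fundamental chamber: the intersection of `H_V` with the half-spaces
`HS_A`, `A ∈ G_fund`, `A ≠ V`. -/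
def nestohedron {n : ℕ} (Φ : Finset V) (Δ : Module.Basis (Fin n) ℝ V)
    (G : Set (Submodule ℝ V)) (ε : ℕ → ℝ) : Set V :=
  wall Φ Δ G ε ⊤ ∩ ⋂ A ∈ fund Δ G \ {⊤}, halfSpace Φ Δ G ε A

/-- The face of the nestohedron associated with a nested set `S`. -/
def nestFace {n : ℕ} (Φ : Finset V) (Δ : Module.Basis (Fin n) ℝ V)
    (G : Set (Submodule ℝ V)) (ε : ℕ → ℝ) (S : Set (Submodule ℝ V)) : Set V :=
  nestohedron Φ Δ G ε ∩ ⋂ A ∈ S, wall Φ Δ G ε A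

/-! ## Labelled nested sets and the faces they index -/

/-- A nested set of `G_fund` that contains `V`, with labels attached to its minimal elements. The
label of a minimal element `A` is `W_A` if `A ∈ labelled`, and the trivial group otherwise. -/
structure LabelledNestedSet {n : ℕ} (Δ : Module.Basis (Fin n) ℝ V)
    (G : Set (Submodule ℝ V)) where
  carrier : Set (Submodule ℝ V)
  isNested : IsNested (fund Δ G) carrier
  top_mem : ⊤ ∈ carrier
  labelled : Set (Submodule ℝ V)
  minimal_of_labelled : ∀ A ∈ labelled, Minimal (fun A => A ∈ carrier) A

/-- `H`: the subgroup of `W` generated by the labels (it is their direct product). -/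
def labelGroup {n : ℕ} (Φ : Finset V) {Δ : Module.Basis (Fin n) ℝ V}
    {G : Set (Submodule ℝ V)} (S : LabelledNestedSet Δ G) : Subgroup (V ≃ₗᵢ[ℝ] V) :=
  ⨆ A ∈ S.labelled, parabolic Φ A

/-- The coset `σ H`. -/
def coset {n : ℕ} (Φ : Finset V) {Δ : Module.Basis (Fin n) ℝ V}
    {G : Set (Submodule ℝ V)} (σ : V ≃ₗᵢ[ℝ] V) (S : LabelledNestedSet Δ G) :
    Set (V ≃ₗᵢ[ℝ] V) :=
  (fun h => σ * h) '' (labelGroup Φ S : Set (V ≃ₗᵢ[ℝ] V))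

/-- The pairs `(σ H, S)`, where `S` is a labelled nested set, `H` is the product of its labels and
`σ ∈ W`. -/
structure FaceIndex {n : ℕ} (Φ : Finset V) (Δ : Module.Basis (Fin n) ℝ V)
    (G : Set (Submodule ℝ V)) where
  nestedSet : LabelledNestedSet Δ G
  cosetSet : Set (V ≃ₗᵢ[ℝ] V)
  isCoset : ∃ σ ∈ coxeterGroup Φ, cosetSet = coset Φ σ nestedSet

/-- `σ F'`, where `F'` is the convex hull of the images `h F`, `h ∈ H`, of the face `F` of the
nestohedron associated with `S`. -/
def cosetFace {n : ℕ} (Φ : Finset V) {Δ : Module.Basis (Fin n) ℝ V}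
    {G : Set (Submodule ℝ V)} (ε : ℕ → ℝ) (σ : V ≃ₗᵢ[ℝ] V) (S : LabelledNestedSet Δ G) : Set V :=
  (fun x : V => σ x) '' convexHull ℝ
    (⋃ h ∈ labelGroup Φ S, (fun x : V => h x) '' nestFace Φ Δ G ε S.carrier)

/-- The nonempty faces of a polytope `P` (including `P` itself): the sets where some linear
functional attains its maximum over `P`. They are ordered by inclusion. -/
abbrev PolytopeFace (P : Set V) : Type _ :=
  {F : Set V // F.Nonempty ∧ IsExposed ℝ P F}

/-- `Move S S'`: the labelled nested set `S'` is obtained from `S` by one elementary move. -/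
inductive Move {n : ℕ} {Δ : Module.Basis (Fin n) ℝ V} {G : Set (Submodule ℝ V)} :
    LabelledNestedSet Δ G → LabelledNestedSet Δ G → Prop
  /-- Adding a subspace that contains some of the subspaces in `S`. -/
  | addNonMinimal (S S' : LabelledNestedSet Δ G) (C : Submodule ℝ V)
      (new : C ∉ S.carrier) (above : ∃ D ∈ S.carrier, D ≤ C)
      (carrier_eq : S'.carrier = insert C S.carrier)
      (labelled_eq : S'.labelled = S.labelled) : Move S S'
  /-- Adding a subspace `A`, minimal in `S'`, with trivial label, that either is not included in
  any minimal subspace of `S`, or is included in a trivially labelled minimal subspace of `S`. -/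
  | addTrivial (S S' : LabelledNestedSet Δ G) (A : Submodule ℝ V)
      (new : A ∉ S.carrier)
      (minimal : Minimal (fun A => A ∈ S'.carrier) A)
      (below : (∀ B, Minimal (fun B => B ∈ S.carrier) B → ¬ A ≤ B) ∨
        ∃ B, Minimal (fun B => B ∈ S.carrier) B ∧ B ∉ S.labelled ∧ A ≤ B)
      (carrier_eq : S'.carrier = insert A S.carrier)
      (labelled_eq : S'.labelled = S.labelled) : Move S S'
  /-- Adding one or more subspaces, minimal in `S'`, all with nontrivial label and all included in
  a minimal subspace `B` of `S` that was labelled by `W_B` and loses its label. -/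
  | addLabelled (S S' : LabelledNestedSet Δ G) (B : Submodule ℝ V)
      (T : Set (Submodule ℝ V)) (nonempty : T.Nonempty)
      (new : ∀ A ∈ T, A ∉ S.carrier)
      (minimal : ∀ A ∈ T, Minimal (fun A => A ∈ S'.carrier) A)
      (labelled : B ∈ S.labelled) (below : ∀ A ∈ T, A ≤ B)
      (carrier_eq : S'.carrier = S.carrier ∪ T)
      (labelled_eq : S'.labelled = (S.labelled \ {B}) ∪ T) : Move S S'
  /-- Changing the nontrivial label of a minimal subspace into the trivial label. -/
  | dropLabel (S S' : LabelledNestedSet Δ G) (A : Submodule ℝ V)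
      (labelled : A ∈ S.labelled)
      (carrier_eq : S'.carrier = S.carrier)
      (labelled_eq : S'.labelled = S.labelled \ {A}) : Move S S'

end Permutonesto

end

noncomputable section

namespace Permutonesto

set_option linter.unusedSectionVars false

/-! ### Building families on a finite set, components, and functions additive on separated sets -/

section Combinatorics

open Finset
open scoped Classical

variable {ι : Type*} [DecidableEq ι]

/-! Everything is read off from the numbers ⟪x, Δ i⟫. For a set I of simple roots whose components
(maximal members of the building family inside I) are the A, let the excess of I at x be the sum of
⟪x, π_A⟫ - ε(#A). Separated sets of simple roots are orthogonal, so π_I is the sum of the π_A, and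
the half-space of the span of I says that the excess of the full set is at most that of I; I = ∅
encodes H_V. The wall normals δ - π_I are dominant, and ω - wω is a nonnegative combination of
simple roots for dominant ω; hence for dominant x the inequalities with σ ≠ e follow from those with
σ = e. So a dominant x lies in P exactly when the full set minimizes the excess. Call the minimizers
tight.

The heart is the structure of the tight sets. Write ε(k) = κ(k) 2^k. Suitability then says κ(k+1) >
R κ(k), which makes every coefficient of π_A divided by κ(#A) strictly decrease as A grows. The
powers of 2 weigh sets: disjoint nonempty parts of A weigh at most 2^#A together, and so do two
proper subsets of A. Played against minimality, these estimates give two facts. By `mem_of_tight`, a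
simple root orthogonal to x lies in every tight set; so σH_I contains a dominant point of P only if
H_I does and σ ∈ W_I, and the point can be pushed into the open chamber inside the relative interior
of its face (`exists_regular`). By `mem_comps_or_of_tight_union`, a component of a union of two
tight sets is a component of one of them; this forces modularity, so tight sets are closed under
union and intersection.

Consequently the tight sets of a point of P in the open chamber are described by a pair (S, D): S is
the nested set of all components of tight sets, D is the smallest tight set, its components are the
elements with nontrivial label, and I is tight iff its components lie in S and D ⊆ I
(`exists_labelledNested`). Conversely every pair occurs (`IsWeight.exists_point`): one solves excess
= 0 on S by equal shares and then perturbs so that the excess of A drops in proportion to the number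
of labels in A.

The rest is polyhedral geometry. Every face is a translate of the face of such a generic point, and
inclusion of faces is reverse inclusion of tight inequalities, which amounts to S ⊆ S', D' ⊆ D and σ
∈ W_D (`faceOf_subset_iff_of_isGeneric`). As W_D is generated by the labels, this gives the
bijection and the order; the moves generate the strict refinement order of labelled nested sets
(`transGen_move_iff`). The convex hull description comes from locating the vertices
(`stdFace_eq_convexHull`), the dimension from the independence of one equation for each unlabelled
element of S (`finrank_direction`). -/

/-- A building set on the finite ground set `ι`. -/
structure IsBuildingFamily (𝓑 : Set (Finset ι)) : Prop where
  nonempty : ∀ A ∈ 𝓑, A.Nonempty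
  singleton_mem : ∀ i, {i} ∈ 𝓑
  union_mem : ∀ A ∈ 𝓑, ∀ B ∈ 𝓑, (A ∩ B).Nonempty → A ∪ B ∈ 𝓑

/-- The maximal members of `𝓑` contained in `I`. -/
def comps (𝓑 : Set (Finset ι)) (I : Finset ι) : Finset (Finset ι) :=
  I.powerset.filter fun A => Maximal (fun B => B ∈ 𝓑 ∧ B ⊆ I) A

variable {𝓑 : Set (Finset ι)} {I J K A B : Finset ι}

theorem mem_comps : A ∈ comps 𝓑 I ↔ Maximal (fun B => B ∈ 𝓑 ∧ B ⊆ I) A := by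
  simp only [comps, mem_filter, mem_powerset, and_iff_right_iff_imp]
  exact fun h => h.prop.2

theorem mem_of_mem_comps (h : A ∈ comps 𝓑 I) : A ∈ 𝓑 := (mem_comps.1 h).prop.1

theorem subset_of_mem_comps (h : A ∈ comps 𝓑 I) : A ⊆ I := (mem_comps.1 h).prop.2

theorem eq_of_mem_comps_of_subset (h : A ∈ comps 𝓑 I) (hB : B ∈ 𝓑) (hBI : B ⊆ I) (hAB : A ⊆ B) :
    A = B :=
  le_antisymm hAB ((mem_comps.1 h).2 ⟨hB, hBI⟩ hAB)

theorem exists_subset_mem_comps (hB : B ∈ 𝓑) (hBI : B ⊆ I) : ∃ A ∈ comps 𝓑 I, B ⊆ A := by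
  have hfin : {C : Finset ι | C ∈ 𝓑 ∧ C ⊆ I}.Finite :=
    (Finset.finite_toSet I.powerset).subset fun C hC => by simpa using hC.2
  obtain ⟨A, hBA, hA⟩ := hfin.exists_le_maximal (a := B) ⟨hB, hBI⟩
  exact ⟨A, mem_comps.2 hA, hBA⟩

theorem comps_of_mem (hA : A ∈ 𝓑) : comps 𝓑 A = {A} := by
  ext B
  rw [mem_singleton]
  constructor
  · intro h
    exact eq_of_mem_comps_of_subset h hA subset_rfl (subset_of_mem_comps h)
  · rintro rfl
    exact mem_comps.2 ⟨⟨hA, subset_rfl⟩, fun _ h _ => h.2⟩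

theorem mem_comps_of_subset (hA : A ∈ comps 𝓑 J) (hAI : A ⊆ I) (hIJ : I ⊆ J) :
    A ∈ comps 𝓑 I :=
  mem_comps.2 ⟨⟨mem_of_mem_comps hA, hAI⟩, fun _ hB hAB =>
    (eq_of_mem_comps_of_subset hA hB.1 (hB.2.trans hIJ) hAB).ge⟩

namespace IsBuildingFamily

variable (h𝓑 : IsBuildingFamily 𝓑)
include h𝓑

theorem nonempty_of_mem_comps (h : A ∈ comps 𝓑 I) : A.Nonempty :=
  h𝓑.nonempty A (mem_of_mem_comps h)

theorem subset_of_mem_comps_of_inter (hA : A ∈ comps 𝓑 I) (hB : B ∈ 𝓑) (hBI : B ⊆ I)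
    (hAB : (A ∩ B).Nonempty) : B ⊆ A := by
  have h := eq_of_mem_comps_of_subset hA (h𝓑.union_mem A (mem_of_mem_comps hA) B hB hAB)
    (union_subset (subset_of_mem_comps hA) hBI) subset_union_left
  rw [h]
  exact subset_union_right

theorem disjoint_of_mem_comps (hA : A ∈ comps 𝓑 I) (hB : B ∈ comps 𝓑 I) (hAB : A ≠ B) :
    Disjoint A B := by
  by_contra h
  rw [disjoint_iff_inter_eq_empty, ← ne_eq, ← nonempty_iff_ne_empty] at h
  refine hAB (subset_antisymm ?_ ?_)
  · exact h𝓑.subset_of_mem_comps_of_inter hB (mem_of_mem_comps hA) (subset_of_mem_comps hA)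
      (by rwa [inter_comm])
  · exact h𝓑.subset_of_mem_comps_of_inter hA (mem_of_mem_comps hB) (subset_of_mem_comps hB) h

theorem exists_mem_comps {i : ι} (hi : i ∈ I) : ∃ A ∈ comps 𝓑 I, i ∈ A := by
  obtain ⟨A, hA, hiA⟩ := exists_subset_mem_comps (h𝓑.singleton_mem i) (singleton_subset_iff.2 hi)
  exact ⟨A, hA, singleton_subset_iff.1 hiA⟩

theorem biUnion_comps (I : Finset ι) : (comps 𝓑 I).biUnion id = I := by
  ext i
  simp only [mem_biUnion, id]
  exact ⟨fun ⟨A, hA, hi⟩ => subset_of_mem_comps hA hi, fun hi => h𝓑.exists_mem_comps hi⟩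

theorem pairwiseDisjoint_comps (I : Finset ι) :
    ((comps 𝓑 I : Finset (Finset ι)) : Set (Finset ι)).PairwiseDisjoint id :=
  fun _ hA _ hB hAB => h𝓑.disjoint_of_mem_comps hA hB hAB

theorem sum_card_comps (I : Finset ι) : ∑ A ∈ comps 𝓑 I, #A = #I := by
  conv_rhs => rw [← h𝓑.biUnion_comps I]
  exact (card_biUnion fun A hA B hB hAB => h𝓑.disjoint_of_mem_comps hA hB hAB).symm

theorem comps_empty : comps 𝓑 ∅ = ∅ := by
  rw [eq_empty_iff_forall_notMem]
  intro A hA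
  obtain ⟨i, hi⟩ := h𝓑.nonempty_of_mem_comps hA
  simpa using subset_of_mem_comps hA hi

theorem eq_of_comps_eq (h : comps 𝓑 I = comps 𝓑 J) : I = J := by
  rw [← h𝓑.biUnion_comps I, h, h𝓑.biUnion_comps]

end IsBuildingFamily

/-- `J` and `K` are disjoint, and no member of `𝓑` inside `J ∪ K` meets both. -/
def Separated (𝓑 : Set (Finset ι)) (J K : Finset ι) : Prop :=
  Disjoint J K ∧ ∀ B ∈ 𝓑, B ⊆ J ∪ K → B ⊆ J ∨ B ⊆ K

namespace Separated

theorem symm (h : Separated 𝓑 J K) : Separated 𝓑 K J :=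
  ⟨h.1.symm, fun B hB hBJ => (h.2 B hB (by rwa [union_comm])).symm⟩

theorem mono {J' K' : Finset ι} (h : Separated 𝓑 J K) (hJ : J' ⊆ J) (hK : K' ⊆ K) :
    Separated 𝓑 J' K' := by
  refine ⟨h.1.mono hJ hK, fun B hB hBJ => ?_⟩
  rcases h.2 B hB (hBJ.trans (union_subset_union hJ hK)) with h1 | h1
  · refine Or.inl fun i hi => (mem_union.1 (hBJ hi)).resolve_right fun hiK => ?_
    exact disjoint_left.1 h.1 (h1 hi) (hK hiK)
  · refine Or.inr fun i hi => (mem_union.1 (hBJ hi)).resolve_left fun hiJ => ?_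
    exact disjoint_left.1 h.1 (hJ hiJ) (h1 hi)

/-- A member of the family that met both A and its complement in I would have a union with A that
enlarges the component A. -/
theorem of_mem_comps (h𝓑 : IsBuildingFamily 𝓑) (hA : A ∈ comps 𝓑 I) :
    Separated 𝓑 A (I \ A) := by
  refine ⟨disjoint_sdiff, fun B hB hBI => ?_⟩
  rw [union_sdiff_of_subset (subset_of_mem_comps hA)] at hBI
  by_cases h : (A ∩ B).Nonempty
  · exact Or.inl (h𝓑.subset_of_mem_comps_of_inter hA hB hBI h)
  · rw [not_nonempty_iff_eq_empty, ← disjoint_iff_inter_eq_empty] at h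
    exact Or.inr (subset_sdiff.2 ⟨hBI, h.symm⟩)

theorem comps_union (h𝓑 : IsBuildingFamily 𝓑) (h : Separated 𝓑 J K) :
    comps 𝓑 (J ∪ K) = comps 𝓑 J ∪ comps 𝓑 K := by
  have key : ∀ {J K : Finset ι}, Separated 𝓑 J K → comps 𝓑 J ⊆ comps 𝓑 (J ∪ K) := by
    intro J K h A hA
    refine mem_comps.2 ⟨⟨mem_of_mem_comps hA, (subset_of_mem_comps hA).trans subset_union_left⟩,
      fun B hB hAB => ?_⟩
    rcases h.2 B hB.1 hB.2 with h1 | h1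
    · exact (eq_of_mem_comps_of_subset hA hB.1 h1 hAB).ge
    · obtain ⟨i, hi⟩ := h𝓑.nonempty_of_mem_comps hA
      exact absurd (h1 (hAB hi)) (disjoint_left.1 h.1 (subset_of_mem_comps hA hi))
  refine subset_antisymm (fun A hA => ?_) (union_subset (key h) ?_)
  · rcases h.2 A (mem_of_mem_comps hA) (subset_of_mem_comps hA) with h1 | h1
    · exact mem_union_left _ (mem_comps_of_subset hA h1 subset_union_left)
    · exact mem_union_right _ (mem_comps_of_subset hA h1 subset_union_right)
  · rw [union_comm]
    exact key h.symm

theorem disjoint_comps (h𝓑 : IsBuildingFamily 𝓑) (h : Separated 𝓑 J K) :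
    Disjoint (comps 𝓑 J) (comps 𝓑 K) := by
  rw [disjoint_left]
  intro A hA hA'
  obtain ⟨i, hi⟩ := h𝓑.nonempty_of_mem_comps hA
  exact disjoint_left.1 h.1 (subset_of_mem_comps hA hi) (subset_of_mem_comps hA' hi)

end Separated

/-- A set function that is additive on separated sets. -/
def SepAdditive (𝓑 : Set (Finset ι)) (g : Finset ι → ℝ) : Prop :=
  ∀ J K, Separated 𝓑 J K → g (J ∪ K) = g J + g K

namespace SepAdditive

variable {g : Finset ι → ℝ}

theorem empty (hg : SepAdditive 𝓑 g) : g ∅ = 0 := by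
  have h := hg ∅ ∅ ⟨disjoint_empty_left _, fun B _ hB => Or.inl (by simpa using hB)⟩
  simpa using h

/-- The components of I are peeled off one at a time; each is separated from the union of the
others, and separation passes to subsets of both sides. -/
theorem sum_inter (h𝓑 : IsBuildingFamily 𝓑) (hg : SepAdditive 𝓑 g) (hJI : J ⊆ I) :
    g J = ∑ C ∈ comps 𝓑 I, g (J ∩ C) := by
  have key : ∀ F ⊆ comps 𝓑 I, g (J ∩ F.biUnion id) = ∑ C ∈ F, g (J ∩ C) := by
    intro F
    induction F using Finset.induction_on with
    | empty => intro _; simp [hg.empty]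
    | insert C F hC ih =>
      intro hF
      rw [sum_insert hC, ← ih ((subset_insert _ _).trans hF), biUnion_insert, inter_union_distrib_left]
      have hCI := hF (mem_insert_self C F)
      refine hg _ _ ((Separated.of_mem_comps h𝓑 hCI).mono inter_subset_right ?_)
      intro i hi
      simp only [mem_inter, mem_biUnion, id] at hi
      obtain ⟨hiJ, B, hB, hiB⟩ := hi
      refine mem_sdiff.2 ⟨hJI hiJ, fun hiC => ?_⟩
      have hBC : C ≠ B := fun h => hC (h ▸ hB)
      exact disjoint_left.1
        (h𝓑.disjoint_of_mem_comps hCI (hF (mem_insert_of_mem hB)) hBC) hiC hiB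
  have h := key _ subset_rfl
  rwa [h𝓑.biUnion_comps, inter_eq_left.2 hJI] at h

theorem sum_comps (h𝓑 : IsBuildingFamily 𝓑) (hg : SepAdditive 𝓑 g) (I : Finset ι) :
    g I = ∑ C ∈ comps 𝓑 I, g C := by
  rw [hg.sum_inter h𝓑 (subset_rfl (a := I))]
  exact sum_congr rfl fun C hC => by rw [inter_eq_right.2 (subset_of_mem_comps hC)]

/-- Replacing the part of `J` inside a component of a larger set. -/
theorem union_comp (h𝓑 : IsBuildingFamily 𝓑) (hg : SepAdditive 𝓑 g) (hA : A ∈ comps 𝓑 I)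
    (hJI : J ⊆ I) : g (J ∪ A) - g J = g A - g (J ∩ A) := by
  have hs := (Separated.of_mem_comps h𝓑 hA)
  have h1 := hg _ _ (hs.mono (subset_rfl) (sdiff_subset_sdiff hJI subset_rfl))
  have h2 := hg _ _ (hs.mono (J' := J ∩ A) inter_subset_right
    (sdiff_subset_sdiff hJI subset_rfl))
  have e1 : A ∪ J \ A = J ∪ A := by rw [union_sdiff_self_eq_union, union_comm]
  have e2 : J ∩ A ∪ J \ A = J := by rw [union_comm, sdiff_union_inter]
  rw [e1] at h1
  rw [e2] at h2
  linarith

end SepAdditive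

end Combinatorics

/-! ### The excess function and the structure of its minimizers -/

section Weights

open Finset
open scoped Classical

variable {ι : Type*} [DecidableEq ι]

/-- `ε k / 2 ^ k`. -/
def kap (ε : ℕ → ℝ) (k : ℕ) : ℝ := ε k / 2 ^ k

theorem kap_mul (ε : ℕ → ℝ) (k : ℕ) : kap ε k * 2 ^ k = ε k := by
  rw [kap, div_mul_cancel₀ _ (by positivity)]

/-- The conditions on the coefficients `c I i` and the list `ε` that govern the combinatorics. -/
structure IsWeight [Fintype ι] (𝓑 : Set (Finset ι)) (c : Finset ι → ι → ℝ) (ε : ℕ → ℝ) :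
    Prop where
  building : IsBuildingFamily 𝓑
  univ_mem : univ ∈ 𝓑
  coef_pos : ∀ A ∈ 𝓑, ∀ i ∈ A, 0 < c A i
  coef_sep : ∀ J K, Separated 𝓑 J K → ∀ i ∈ J, c (J ∪ K) i = c J i
  coef_lt : ∀ A ∈ 𝓑, ∀ B ∈ 𝓑, B ⊂ A → ∀ i ∈ B, c A i * kap ε #B < c B i * kap ε #A
  kap_pos : ∀ A ∈ 𝓑, 0 < kap ε #A
  kap_mono : ∀ A ∈ 𝓑, ∀ B ∈ 𝓑, B ⊆ A → kap ε #B ≤ kap ε #A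

/-- The value at `y` of the linear form with coefficients `c I`. -/
def wsum (c : Finset ι → ι → ℝ) (y : ι → ℝ) (I : Finset ι) : ℝ := ∑ i ∈ I, c I i * y i

/-- The sum of the `ε #A` over the components `A` of `I`. -/
def epsSum (𝓑 : Set (Finset ι)) (ε : ℕ → ℝ) (I : Finset ι) : ℝ := ∑ A ∈ comps 𝓑 I, ε #A

/-- The difference of `wsum` and `epsSum`. -/
def excess (𝓑 : Set (Finset ι)) (c : Finset ι → ι → ℝ) (ε : ℕ → ℝ) (y : ι → ℝ) (I : Finset ι) :
    ℝ :=
  wsum c y I - epsSum 𝓑 ε I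

/-- For exponents at least 1, 2^a + 2^b ≤ 2^(a+b). This is why powers of 2 can serve as weights of
disjoint nonempty sets. -/
theorem sum_two_pow_le {α : Type*} (F : Finset α) (f : α → ℕ) (hf : ∀ a ∈ F, 1 ≤ f a) :
    ∑ a ∈ F, (2 : ℝ) ^ f a ≤ 2 ^ ∑ a ∈ F, f a := by
  induction F using Finset.induction_on with
  | empty => simp
  | insert a F ha ih =>
    rw [sum_insert ha, sum_insert ha, pow_add]
    have h1 : (2 : ℝ) ≤ 2 ^ f a := by
      simpa using pow_le_pow_right₀ (one_le_two (α := ℝ)) (hf a (mem_insert_self a F))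
    have ih' := ih fun b hb => hf b (mem_insert_of_mem hb)
    rcases F.eq_empty_or_nonempty with rfl | ⟨b, hb⟩
    · simp
    · have hs : 1 ≤ ∑ a ∈ F, f a :=
        (hf b (mem_insert_of_mem hb)).trans (single_le_sum (f := f) (fun _ _ => Nat.zero_le _) hb)
      have h2 : (2 : ℝ) ≤ 2 ^ ∑ a ∈ F, f a := by
        simpa using pow_le_pow_right₀ (one_le_two (α := ℝ)) hs
      nlinarith

variable [Fintype ι] {𝓑 : Set (Finset ι)} {c : Finset ι → ι → ℝ} {ε : ℕ → ℝ}
  {I J K A B : Finset ι} {y : ι → ℝ}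

theorem IsBuildingFamily.sum_comps_two_pow_le (h𝓑 : IsBuildingFamily 𝓑) (I : Finset ι) :
    ∑ A ∈ comps 𝓑 I, (2 : ℝ) ^ #A ≤ 2 ^ #I := by
  rw [← h𝓑.sum_card_comps I]
  exact sum_two_pow_le _ _ fun A hA => card_pos.2 (h𝓑.nonempty_of_mem_comps hA)

namespace IsWeight

variable (hw : IsWeight 𝓑 c ε)
include hw

theorem sepAdditive_wsum (y : ι → ℝ) : SepAdditive 𝓑 (wsum c y) := by
  intro J K h
  rw [wsum, sum_union h.1, wsum, wsum]
  congr 1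
  · exact sum_congr rfl fun i hi => by rw [hw.coef_sep J K h i hi]
  · exact sum_congr rfl fun i hi => by rw [union_comm, hw.coef_sep K J h.symm i hi]

theorem sepAdditive_epsSum : SepAdditive 𝓑 (epsSum 𝓑 ε) := by
  intro J K h
  rw [epsSum, h.comps_union hw.building, sum_union (h.disjoint_comps hw.building)]
  rfl

theorem sepAdditive_excess (y : ι → ℝ) : SepAdditive 𝓑 (excess 𝓑 c ε y) := by
  intro J K h
  simp only [excess, hw.sepAdditive_wsum y J K h, hw.sepAdditive_epsSum J K h]
  ring

theorem excess_of_mem (hA : A ∈ 𝓑) : excess 𝓑 c ε y A = wsum c y A - kap ε #A * 2 ^ #A := by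
  rw [excess, epsSum, comps_of_mem hA, sum_singleton, kap_mul]

theorem coef_mul_le (hA : A ∈ 𝓑) (hB : B ∈ 𝓑) (hBA : B ⊆ A) {i : ι} (hi : i ∈ B) :
    c A i * kap ε #B ≤ c B i * kap ε #A := by
  rcases hBA.eq_or_ssubset with rfl | h
  · exact le_rfl
  · exact (hw.coef_lt A hA B hB h i hi).le

theorem wsum_mul_le (hA : A ∈ 𝓑) (hB : B ∈ 𝓑) (hBA : B ⊆ A) (hy : ∀ i ∈ B, 0 ≤ y i) :
    (∑ i ∈ B, c A i * y i) * kap ε #B ≤ wsum c y B * kap ε #A := by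
  rw [wsum, sum_mul, sum_mul]
  refine sum_le_sum fun i hi => ?_
  have := mul_le_mul_of_nonneg_right (hw.coef_mul_le hA hB hBA hi) (hy i hi)
  linarith

theorem wsum_mul_lt (hA : A ∈ 𝓑) (hB : B ∈ 𝓑) (hBA : B ⊂ A) (hy : ∀ i, 0 < y i) :
    (∑ i ∈ B, c A i * y i) * kap ε #B < wsum c y B * kap ε #A := by
  rw [wsum, sum_mul, sum_mul]
  refine sum_lt_sum_of_nonempty (hw.building.nonempty B hB) fun i hi => ?_
  have := mul_lt_mul_of_pos_right (hw.coef_lt A hA B hB hBA i hi) (hy i)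
  linarith

/-- Passing from the coefficients of B to those of A costs at most the factor κ(A)/κ(B). Since the
form of B has value excess(B) + κ(B) 2^#B, the bound becomes κ(A) 2^#B + (κ(A)/κ(B)) excess(B); the
factor is at least 1 and the excess is nonpositive, so it may be dropped. -/
theorem sum_coef_le (hA : A ∈ 𝓑) (hB : B ∈ 𝓑) (hBA : B ⊆ A) (hy : ∀ i ∈ B, 0 ≤ y i)
    (hu : excess 𝓑 c ε y B ≤ 0) :
    ∑ i ∈ B, c A i * y i ≤ kap ε #A * 2 ^ #B + excess 𝓑 c ε y B := by
  have h1 := hw.wsum_mul_le hA hB hBA hy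
  have h2 := hw.kap_pos B hB
  have h3 := hw.kap_mono A hA B hB hBA
  have h4 := hw.excess_of_mem (y := y) hB
  refine le_of_mul_le_mul_right (h1.trans ?_) h2
  have : wsum c y B = excess 𝓑 c ε y B + kap ε #B * 2 ^ #B := by linarith
  rw [this]
  nlinarith [mul_nonneg (neg_nonneg.2 hu) (sub_nonneg.2 h3)]

theorem sum_coef_lt (hA : A ∈ 𝓑) (hB : B ∈ 𝓑) (hBA : B ⊂ A) (hy : ∀ i, 0 < y i)
    (hu : excess 𝓑 c ε y B ≤ 0) :
    ∑ i ∈ B, c A i * y i < kap ε #A * 2 ^ #B + excess 𝓑 c ε y B := by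
  have h1 := hw.wsum_mul_lt hA hB hBA hy
  have h2 := hw.kap_pos B hB
  have h3 := hw.kap_mono A hA B hB hBA.1
  have h4 := hw.excess_of_mem (y := y) hB
  refine lt_of_mul_lt_mul_right (h1.trans_le ?_) h2.le
  have : wsum c y B = excess 𝓑 c ε y B + kap ε #B * 2 ^ #B := by linarith
  rw [this]
  nlinarith [mul_nonneg (neg_nonneg.2 hu) (sub_nonneg.2 h3)]

theorem wsum_le_of_cover (hA : A ∈ 𝓑) {F : Finset (Finset ι)} (hF : ∀ B ∈ F, B ⊆ A)
    (hy : ∀ i, 0 ≤ y i) (hcov : ∀ i ∈ A, y i ≠ 0 → ∃ B ∈ F, i ∈ B) :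
    wsum c y A ≤ ∑ B ∈ F, ∑ i ∈ B, c A i * y i := by
  have hpos : ∀ i ∈ A, 0 ≤ c A i * y i := fun i hi =>
    mul_nonneg (hw.coef_pos A hA i hi).le (hy i)
  have h1 : ∀ B ∈ F, ∑ i ∈ B, c A i * y i = ∑ i ∈ A, if i ∈ B then c A i * y i else 0 := by
    intro B hB
    rw [← sum_filter, filter_mem_eq_inter, inter_eq_right.2 (hF B hB)]
  rw [sum_congr rfl h1, sum_comm, wsum]
  refine sum_le_sum fun i hi => ?_
  by_cases h0 : y i = 0
  · simp [h0]
  · obtain ⟨B, hB, hiB⟩ := hcov i hi h0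
    refine le_trans ?_ (single_le_sum (f := fun B => if i ∈ B then c A i * y i else 0)
      (fun B _ => ?_) hB)
    · simp [hiB]
    · show 0 ≤ if i ∈ B then c A i * y i else 0
      split_ifs
      exacts [hpos i hi, le_rfl]

/-- The bound of `sum_coef_le` is summed over the cover. Overlaps do no harm because all terms are
nonnegative, and only nonzero coordinates need covering. The bracket compares the weight of the
cover with that of A. -/
theorem excess_le_of_cover (hA : A ∈ 𝓑) {F : Finset (Finset ι)}
    (hF : ∀ B ∈ F, B ∈ 𝓑 ∧ B ⊆ A ∧ excess 𝓑 c ε y B ≤ 0)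
    (hy : ∀ i, 0 ≤ y i) (hcov : ∀ i ∈ A, y i ≠ 0 → ∃ B ∈ F, i ∈ B) :
    excess 𝓑 c ε y A ≤
      kap ε #A * (∑ B ∈ F, 2 ^ #B - 2 ^ #A) + ∑ B ∈ F, excess 𝓑 c ε y B := by
  have h1 := hw.wsum_le_of_cover hA (fun B hB => (hF B hB).2.1) hy hcov
  have h2 := sum_le_sum fun B hB =>
    hw.sum_coef_le hA (hF B hB).1 (hF B hB).2.1 (fun i _ => hy i) (hF B hB).2.2
  rw [sum_add_distrib, ← mul_sum] at h2
  rw [hw.excess_of_mem hA]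
  linarith

theorem excess_lt_of_cover (hA : A ∈ 𝓑) {F : Finset (Finset ι)}
    (hF : ∀ B ∈ F, B ∈ 𝓑 ∧ B ⊂ A ∧ excess 𝓑 c ε y B ≤ 0)
    (hy : ∀ i, 0 < y i) (hcov : ∀ i ∈ A, ∃ B ∈ F, i ∈ B)
    (hcard : ∑ B ∈ F, (2 : ℝ) ^ #B ≤ 2 ^ #A) :
    excess 𝓑 c ε y A < ∑ B ∈ F, excess 𝓑 c ε y B := by
  have hne : F.Nonempty := by
    obtain ⟨i, hi⟩ := hw.building.nonempty A hA
    obtain ⟨B, hB, _⟩ := hcov i hi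
    exact ⟨B, hB⟩
  have h1 := hw.wsum_le_of_cover hA (fun B hB => (hF B hB).2.1.1) (fun i => (hy i).le)
    fun i hi _ => hcov i hi
  have h2 := sum_lt_sum_of_nonempty hne fun B hB =>
    hw.sum_coef_lt hA (hF B hB).1 (hF B hB).2.1 hy (hF B hB).2.2
  rw [sum_add_distrib, ← mul_sum] at h2
  rw [hw.excess_of_mem hA]
  have := mul_le_mul_of_nonneg_left hcard (hw.kap_pos A hA).le
  linarith

end IsWeight

/-- `I` minimizes `g`, and so does the whole ground set. -/
def IsTight (g : Finset ι → ℝ) (I : Finset ι) : Prop := g I = g univ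

namespace SepAdditive

variable {g : Finset ι → ℝ}

/-- Removing the component B from a tight set changes `g` by -`g B`, and this cannot go below the
minimum. -/
theorem le_zero_of_mem_comps (h𝓑 : IsBuildingFamily 𝓑) (hg : SepAdditive 𝓑 g)
    (hmin : ∀ I, g univ ≤ g I) (hI : IsTight g I) (hB : B ∈ comps 𝓑 I) : g B ≤ 0 := by
  have h := hg _ _ (Separated.of_mem_comps h𝓑 hB)
  rw [union_sdiff_of_subset (subset_of_mem_comps hB), hI] at h
  linarith [hmin (I \ B)]

/-- Adding all of A to the tight set I changes `g` by `g A - g (I ∩ A)`, which cannot be negative.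
-/
theorem inter_le (h𝓑 : IsBuildingFamily 𝓑) (hg : SepAdditive 𝓑 g)
    (hmin : ∀ I, g univ ≤ g I) (hI : IsTight g I) (hA : A ∈ comps 𝓑 J) (hIJ : I ⊆ J) :
    g (I ∩ A) ≤ g A := by
  have h := hg.union_comp h𝓑 hA hIJ
  rw [hI] at h
  linarith [hmin (I ∪ A)]

theorem le_sum_comps_inter (h𝓑 : IsBuildingFamily 𝓑) (hg : SepAdditive 𝓑 g)
    (hmin : ∀ I, g univ ≤ g I) (hI : IsTight g I) (hA : A ∈ comps 𝓑 J) (hIJ : I ⊆ J) :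
    ∑ B ∈ comps 𝓑 (I ∩ A), g B ≤ g A := by
  rw [← hg.sum_comps h𝓑]
  exact hg.inter_le h𝓑 hmin hI hA hIJ

end SepAdditive

theorem IsBuildingFamily.comps_inter_subset (h𝓑 : IsBuildingFamily 𝓑) (hA : A ∈ comps 𝓑 J)
    (hIJ : I ⊆ J) : comps 𝓑 (I ∩ A) ⊆ comps 𝓑 I := by
  have h := ((Separated.of_mem_comps h𝓑 hA).mono (J' := I ∩ A) (K' := I \ A) inter_subset_right
    (sdiff_subset_sdiff hIJ subset_rfl)).comps_union h𝓑
  rw [union_comm, sdiff_union_inter] at h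
  rw [h]
  exact subset_union_left

namespace IsWeight

variable (hw : IsWeight 𝓑 c ε)
include hw

/-- The coordinates that vanish at a point lie in every tight set. -/
theorem mem_of_tight (hy : ∀ i, 0 ≤ y i)
    (hmin : ∀ I, excess 𝓑 c ε y univ ≤ excess 𝓑 c ε y I)
    (hI : IsTight (excess 𝓑 c ε y) I) {i : ι} (hi : y i = 0) : i ∈ I := by
  by_contra hiI
  have h𝓑 := hw.building
  -- Only the component A of `insert i I` through i matters. The components of I ∩ A cover all
  -- nonzero coordinates of A but weigh strictly less than A, so the excess of A is strictly below
  -- their total; tightness of I gives the opposite inequality.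
  obtain ⟨A, hA, hiA⟩ := h𝓑.exists_mem_comps (mem_insert_self i I)
  have hA𝓑 := mem_of_mem_comps hA
  have hsub : I ⊆ insert i I := subset_insert _ _
  have h1 := (hw.sepAdditive_excess y).le_sum_comps_inter h𝓑 hmin hI hA hsub
  have h2 := hw.excess_le_of_cover (F := comps 𝓑 (I ∩ A)) (y := y) hA𝓑 (fun B hB =>
    ⟨mem_of_mem_comps hB, (subset_of_mem_comps hB).trans inter_subset_right,
      (hw.sepAdditive_excess y).le_zero_of_mem_comps h𝓑 hmin hI
        (h𝓑.comps_inter_subset hA hsub hB)⟩) hy (fun j hj hj0 => by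
      have hji : j ≠ i := fun h => hj0 (h ▸ hi)
      exact h𝓑.exists_mem_comps (mem_inter.2
        ⟨(mem_insert.1 (subset_of_mem_comps hA hj)).resolve_left hji, hj⟩))
  have h3 := h𝓑.sum_comps_two_pow_le (I ∩ A)
  have h4 : (2 : ℝ) ^ #(I ∩ A) < 2 ^ #A := by
    refine pow_lt_pow_right₀ one_lt_two (card_lt_card ⟨inter_subset_right, fun h => hiI ?_⟩)
    exact (mem_inter.1 (h hiA)).1
  have := hw.kap_pos A hA𝓑
  nlinarith

/-- If A were a component of neither, the components of I ∩ A and J ∩ A would be proper parts of A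
with nonpositive excess that together cover A and weigh at most 2^#A. Then the excess of A is
strictly less than the total over the parts from I alone, against tightness of I. -/
theorem mem_comps_or_of_tight_union (hy : ∀ i, 0 < y i)
    (hmin : ∀ I, excess 𝓑 c ε y univ ≤ excess 𝓑 c ε y I)
    (hI : IsTight (excess 𝓑 c ε y) I) (hJ : IsTight (excess 𝓑 c ε y) J)
    (hA : A ∈ comps 𝓑 (I ∪ J)) : A ∈ comps 𝓑 I ∨ A ∈ comps 𝓑 J := by
  by_contra hcon
  push Not at hcon
  have h𝓑 := hw.building
  have hA𝓑 := mem_of_mem_comps hA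
  have hg := hw.sepAdditive_excess y
  have part : ∀ {K : Finset ι}, K ⊆ I ∪ J → IsTight (excess 𝓑 c ε y) K → A ∉ comps 𝓑 K →
      ∀ B ∈ comps 𝓑 (K ∩ A), B ∈ 𝓑 ∧ B ⊂ A ∧ excess 𝓑 c ε y B ≤ 0 := by
    intro K hK hKt hAK B hB
    have hBK := h𝓑.comps_inter_subset hA hK hB
    refine ⟨mem_of_mem_comps hB, lt_of_le_of_ne
      ((subset_of_mem_comps hB).trans inter_subset_right) ?_,
      hg.le_zero_of_mem_comps h𝓑 hmin hKt hBK⟩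
    rintro rfl
    exact hAK hBK
  have whole : ∀ {K : Finset ι}, K ⊆ I ∪ J → IsTight (excess 𝓑 c ε y) K → A ∉ comps 𝓑 K →
      ¬ A ⊆ K := by
    intro K hK hKt hAK hAsub
    have h1 := hg.le_sum_comps_inter h𝓑 hmin hKt hA hK
    have h2 := hw.excess_lt_of_cover hA𝓑 (part hK hKt hAK) hy
      (fun i hi => h𝓑.exists_mem_comps (mem_inter.2 ⟨hAsub hi, hi⟩)) (by
        have := h𝓑.sum_comps_two_pow_le (K ∩ A)
        rwa [inter_eq_right.2 hAsub] at this ⊢)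
    linarith
  -- A proper subset of A has at most half the weight 2^#A, which leaves room for two of them.
  have hlt : ∀ {K : Finset ι}, ¬ A ⊆ K → (2 : ℝ) * 2 ^ #(K ∩ A) ≤ 2 ^ #A := by
    intro K hK
    rw [mul_comm, ← pow_succ]
    refine pow_le_pow_right₀ one_le_two (card_lt_card ⟨inter_subset_right, fun h => hK ?_⟩)
    exact h.trans inter_subset_left
  have hIs : I ⊆ I ∪ J := subset_union_left
  have hJs : J ⊆ I ∪ J := subset_union_right
  have pI := part hIs hI hcon.1
  have pJ := part hJs hJ hcon.2
  have h1 := hg.le_sum_comps_inter h𝓑 hmin hI hA hIs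
  have hle : ∑ B ∈ comps 𝓑 (I ∩ A) ∪ comps 𝓑 (J ∩ A), (2 : ℝ) ^ #B ≤ 2 ^ #A := by
    have h5 := sum_union_inter (s₁ := comps 𝓑 (I ∩ A)) (s₂ := comps 𝓑 (J ∩ A))
      (f := fun B => (2 : ℝ) ^ #B)
    have h6 : (0 : ℝ) ≤ ∑ B ∈ comps 𝓑 (I ∩ A) ∩ comps 𝓑 (J ∩ A), (2 : ℝ) ^ #B :=
      sum_nonneg fun _ _ => by positivity
    have h7 := h𝓑.sum_comps_two_pow_le (I ∩ A)
    have h8 := h𝓑.sum_comps_two_pow_le (J ∩ A)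
    have h9 := hlt (whole hIs hI hcon.1)
    have h10 := hlt (whole hJs hJ hcon.2)
    linarith
  have h2 := hw.excess_lt_of_cover (F := comps 𝓑 (I ∩ A) ∪ comps 𝓑 (J ∩ A)) hA𝓑
    (fun B hB => (mem_union.1 hB).elim (pI B) (pJ B)) hy (fun i hi => by
      rcases mem_union.1 (subset_of_mem_comps hA hi) with h | h
      · obtain ⟨B, hB, hiB⟩ := h𝓑.exists_mem_comps (mem_inter.2 ⟨h, hi⟩)
        exact ⟨B, mem_union_left _ hB, hiB⟩
      · obtain ⟨B, hB, hiB⟩ := h𝓑.exists_mem_comps (mem_inter.2 ⟨h, hi⟩)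
        exact ⟨B, mem_union_right _ hB, hiB⟩) hle
  have h3 : ∑ B ∈ comps 𝓑 (I ∩ A) ∪ comps 𝓑 (J ∩ A), excess 𝓑 c ε y B ≤
      ∑ B ∈ comps 𝓑 (I ∩ A), excess 𝓑 c ε y B := by
    rw [← union_sdiff_self_eq_union, sum_union disjoint_sdiff]
    have : ∑ B ∈ comps 𝓑 (J ∩ A) \ comps 𝓑 (I ∩ A), excess 𝓑 c ε y B ≤ 0 :=
      sum_nonpos fun B hB => (pJ B (mem_sdiff.1 hB).1).2.2
    linarith
  linarith

/-- Each component of I ∪ J lies inside I or inside J, so the excess is modular on each component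
and hence on I and J. Two values that are at least the minimum and sum to twice the minimum are both
minimal. -/
theorem tight_union_and_inter (hy : ∀ i, 0 < y i)
    (hmin : ∀ I, excess 𝓑 c ε y univ ≤ excess 𝓑 c ε y I)
    (hI : IsTight (excess 𝓑 c ε y) I) (hJ : IsTight (excess 𝓑 c ε y) J) :
    IsTight (excess 𝓑 c ε y) (I ∪ J) ∧ IsTight (excess 𝓑 c ε y) (I ∩ J) := by
  have h𝓑 := hw.building
  have hg := hw.sepAdditive_excess y
  have h1 := hg.sum_inter h𝓑 (J := I) (I := I ∪ J) subset_union_left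
  have h2 := hg.sum_inter h𝓑 (J := J) (I := I ∪ J) subset_union_right
  have h3 := hg.sum_comps h𝓑 (I ∪ J)
  have h4 := hg.sum_inter h𝓑 (J := I ∩ J) (I := I ∪ J) (inter_subset_left.trans subset_union_left)
  have key : excess 𝓑 c ε y (I ∪ J) + excess 𝓑 c ε y (I ∩ J) =
      excess 𝓑 c ε y I + excess 𝓑 c ε y J := by
    rw [h1, h2, h3, h4, ← sum_add_distrib, ← sum_add_distrib]
    refine sum_congr rfl fun C hC => ?_
    rcases hw.mem_comps_or_of_tight_union hy hmin hI hJ hC with h | h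
    · have hCI := subset_of_mem_comps h
      rw [inter_eq_right.2 hCI]
      congr 2
      rw [inter_comm I J, inter_assoc, inter_eq_right.2 hCI]
    · have hCJ := subset_of_mem_comps h
      rw [inter_eq_right.2 hCJ, inter_assoc, inter_eq_right.2 hCJ]
      ring
  have h5 := hmin (I ∪ J)
  have h6 := hmin (I ∩ J)
  unfold IsTight at *
  constructor <;> linarith

end IsWeight

end Weights

/-! ### Labelled nested sets and the tight sets that they encode -/

section Nested

open Finset
open scoped Classical

variable {ι : Type*} [DecidableEq ι] [Fintype ι] {𝓑 : Set (Finset ι)} {c : Finset ι → ι → ℝ}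
  {ε : ℕ → ℝ} {I J K A B D : Finset ι} {y : ι → ℝ} {S : Finset (Finset ι)}

/-- `S` is a nested set containing the whole ground set, and the components of `D` (the elements
with nontrivial label) are minimal elements of `S`. -/
structure IsLabelledNested (𝓑 : Set (Finset ι)) (S : Finset (Finset ι)) (D : Finset ι) :
    Prop where
  subset : ∀ A ∈ S, A ∈ 𝓑
  nested : ∀ T ⊆ S, T.Nontrivial → IsAntichain (· ⊆ ·) (T : Set (Finset ι)) →
    T.biUnion id ∉ 𝓑
  univ_mem : univ ∈ S
  comps_subset : comps 𝓑 D ⊆ S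
  minimal : ∀ A ∈ comps 𝓑 D, ∀ B ∈ S, B ⊆ A → B = A

/-- The sets that index the walls containing the face of `(S, D)`, and the whole ground set. -/
def IsFaceSet (𝓑 : Set (Finset ι)) (S : Finset (Finset ι)) (D I : Finset ι) : Prop :=
  comps 𝓑 I ⊆ S ∧ D ⊆ I

namespace IsLabelledNested

variable (h𝓑 : IsBuildingFamily 𝓑) (hS : IsLabelledNested 𝓑 S D)
include hS

theorem subset_or_subset (h𝓑 : IsBuildingFamily 𝓑) (hA : A ∈ S) (hB : B ∈ S)
    (hAB : (A ∩ B).Nonempty) : A ⊆ B ∨ B ⊆ A := by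
  by_contra h
  push Not at h
  have hne : A ≠ B := fun e => h.1 e.subset
  refine hS.nested {A, B} (by simp [insert_subset_iff, hA, hB]) ?_ ?_ ?_
  · exact ⟨A, by simp, B, by simp, hne⟩
  · rw [coe_pair]
    intro X hX Y hY hXY
    rcases hX with rfl | rfl <;> rcases hY with rfl | rfl
    exacts [absurd rfl hXY, h.1, h.2, absurd rfl hXY]
  · simpa using h𝓑.union_mem A (hS.subset A hA) B (hS.subset B hB) hAB

/-- A component C of the union is itself the union of the maximal elements of `S₁` inside C. These
form an antichain with union in the family, so nestedness leaves only one of them, and it equals C.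
-/
theorem comps_biUnion_subset (h𝓑 : IsBuildingFamily 𝓑) {S₁ : Finset (Finset ι)} (h : S₁ ⊆ S) :
    comps 𝓑 (S₁.biUnion id) ⊆ S₁ := by
  intro C hC
  have hC𝓑 := mem_of_mem_comps hC
  set T : Finset (Finset ι) := S₁.filter fun B => Maximal (fun B => B ∈ S₁ ∧ B ⊆ C) B with hT
  have hTS : T ⊆ S := (filter_subset _ _).trans h
  have hfin : {B : Finset ι | B ∈ S₁ ∧ B ⊆ C}.Finite := S₁.finite_toSet.subset fun B hB => hB.1
  have hunion : T.biUnion id = C := by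
    ext i
    simp only [mem_biUnion, id]
    constructor
    · rintro ⟨B, hB, hi⟩
      exact (mem_filter.1 hB).2.prop.2 hi
    · intro hi
      obtain ⟨B, hB, hiB⟩ := mem_biUnion.1 (subset_of_mem_comps hC hi)
      have hBC : B ⊆ C := h𝓑.subset_of_mem_comps_of_inter hC (hS.subset B (h hB))
        (subset_biUnion_of_mem id hB) ⟨i, mem_inter.2 ⟨hi, hiB⟩⟩
      obtain ⟨B', hBB', hB'⟩ := hfin.exists_le_maximal (a := B) ⟨hB, hBC⟩
      exact ⟨B', mem_filter.2 ⟨hB'.prop.1, hB'⟩, hBB' hiB⟩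
  by_cases hnt : T.Nontrivial
  · refine absurd (hunion ▸ hC𝓑) (hS.nested T hTS hnt ?_)
    intro X hX Y hY hXY hle
    exact hXY (((mem_filter.1 hX).2).eq_of_le ((mem_filter.1 hY).2).prop hle)
  · obtain ⟨i, hi⟩ := h𝓑.nonempty C hC𝓑
    rw [← hunion] at hi
    obtain ⟨B, hB, hiB⟩ := mem_biUnion.1 hi
    have hTB : T = {B} := by
      rw [eq_singleton_iff_unique_mem]
      refine ⟨hB, fun X hX => ?_⟩
      by_contra hne
      exact hnt ⟨X, hX, B, hB, hne⟩
    rw [hTB, singleton_biUnion, id] at hunion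
    rw [← hunion]
    exact (mem_filter.1 hB).1

theorem isFaceSet_biUnion (h𝓑 : IsBuildingFamily 𝓑) {S₁ : Finset (Finset ι)} (h : S₁ ⊆ S) :
    IsFaceSet 𝓑 S D (D ∪ S₁.biUnion id) := by
  refine ⟨?_, subset_union_left⟩
  have h1 : D ∪ S₁.biUnion id = (comps 𝓑 D ∪ S₁).biUnion id := by
    rw [union_biUnion, h𝓑.biUnion_comps]
  have h2 : comps 𝓑 D ∪ S₁ ⊆ S := union_subset hS.comps_subset h
  rw [h1]
  exact (hS.comps_biUnion_subset h𝓑 h2).trans h2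

theorem isFaceSet_label : IsFaceSet 𝓑 S D D := ⟨hS.comps_subset, subset_rfl⟩

theorem isFaceSet_univ : IsFaceSet 𝓑 S D univ := by
  refine ⟨?_, subset_univ _⟩
  rw [comps_of_mem (hS.subset _ hS.univ_mem)]
  exact singleton_subset_iff.2 hS.univ_mem

theorem isFaceSet_union_mem (h𝓑 : IsBuildingFamily 𝓑) (hB : B ∈ S) :
    IsFaceSet 𝓑 S D (D ∪ B) := by
  simpa using hS.isFaceSet_biUnion h𝓑 (S₁ := {B}) (singleton_subset_iff.2 hB)

/-- The component of D ∪ B containing B is either B or a component of D; in the latter case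
minimality of the labelled elements makes it equal to B. -/
theorem mem_comps_union (h𝓑 : IsBuildingFamily 𝓑) (hB : B ∈ S) : B ∈ comps 𝓑 (D ∪ B) := by
  obtain ⟨C, hC, hBC⟩ := exists_subset_mem_comps (hS.subset B hB) (subset_union_right (s₁ := D))
  have h1 : D ∪ B = (insert B (comps 𝓑 D)).biUnion id := by
    rw [biUnion_insert, h𝓑.biUnion_comps, union_comm, id]
  have hC' := hC
  rw [h1] at hC'
  have h2 := hS.comps_biUnion_subset h𝓑 (insert_subset hB hS.comps_subset) hC'
  rcases mem_insert.1 h2 with rfl | h2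
  · exact hC
  · have e := hS.minimal C h2 B hB hBC
    rwa [← e] at hC

theorem mem_iff_exists_isFaceSet (h𝓑 : IsBuildingFamily 𝓑) :
    A ∈ S ↔ ∃ I, IsFaceSet 𝓑 S D I ∧ A ∈ comps 𝓑 I :=
  ⟨fun hA => ⟨D ∪ A, hS.isFaceSet_union_mem h𝓑 hA, hS.mem_comps_union h𝓑 hA⟩,
    fun ⟨_, hI, hA⟩ => hI.1 hA⟩

/-- The face sets determine the pair: D is the smallest of them and S consists of all their
components. This turns inclusion of tight inequalities into a condition on the pairs. -/
theorem forall_isFaceSet_imp_iff (h𝓑 : IsBuildingFamily 𝓑) {S' : Finset (Finset ι)}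
    {D' : Finset ι} :
    (∀ I, IsFaceSet 𝓑 S D I → IsFaceSet 𝓑 S' D' I) ↔ S ⊆ S' ∧ D' ⊆ D := by
  constructor
  · intro h
    refine ⟨fun A hA => ?_, (h D hS.isFaceSet_label).2⟩
    obtain ⟨I, hI, hAI⟩ := (hS.mem_iff_exists_isFaceSet h𝓑).1 hA
    exact (h I hI).1 hAI
  · rintro ⟨h1, h2⟩ I ⟨h3, h4⟩
    exact ⟨h3.trans h1, h2.trans h4⟩

/-- For a face set I, `g I - g D` is the sum of `g C - g (D ∩ C)` over the components C of I, and
these terms vanish automatically for labels. The right side has exactly as many equations as the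
codimension of the face. -/
theorem eq_inter_iff_of_tight (h𝓑 : IsBuildingFamily 𝓑) {g : Finset ι → ℝ}
    (hg : SepAdditive 𝓑 g) :
    (∀ I, IsFaceSet 𝓑 S D I → g I = g univ) ↔ ∀ B ∈ S \ comps 𝓑 D, g B = g (D ∩ B) := by
  constructor
  · intro h B hB
    have hBS := (mem_sdiff.1 hB).1
    have h1 := hg.union_comp h𝓑 (hS.mem_comps_union h𝓑 hBS) subset_union_left
    rw [h _ (hS.isFaceSet_union_mem h𝓑 hBS), h _ hS.isFaceSet_label] at h1
    linarith
  · intro h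
    have h' : ∀ B ∈ S, g B = g (D ∩ B) := by
      intro B hB
      by_cases hBD : B ∈ comps 𝓑 D
      · rw [inter_eq_right.2 (subset_of_mem_comps hBD)]
      · exact h B (mem_sdiff.2 ⟨hB, hBD⟩)
    have key : ∀ I, IsFaceSet 𝓑 S D I → g I = g D := by
      intro I hI
      rw [hg.sum_comps h𝓑 I, hg.sum_inter h𝓑 hI.2]
      exact sum_congr rfl fun C hC => h' C (hI.1 hC)
    intro I hI
    rw [key I hI, key _ hS.isFaceSet_univ]

/-- Given that D is tight, tightness of D ∪ B is the equation `g B = g (D ∩ B)`, and for B = univ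
that equation is tightness of D. Geometrically these are the walls H_D and H_{B+D}. -/
theorem tight_iff_generators (h𝓑 : IsBuildingFamily 𝓑) {g : Finset ι → ℝ}
    (hg : SepAdditive 𝓑 g) :
    (∀ I, IsFaceSet 𝓑 S D I → g I = g univ) ↔
      g D = g univ ∧ ∀ B ∈ S \ insert univ (comps 𝓑 D), g (B ∪ D) = g univ := by
  constructor
  · intro h
    refine ⟨h D hS.isFaceSet_label, fun B hB => ?_⟩
    rw [union_comm]
    exact h _ (hS.isFaceSet_union_mem h𝓑 (mem_sdiff.1 hB).1)
  · rintro ⟨h1, h2⟩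
    refine (hS.eq_inter_iff_of_tight h𝓑 hg).2 fun B hB => ?_
    by_cases hBu : B = univ
    · rw [hBu, inter_univ, h1]
    · have h3 := h2 B (mem_sdiff.2 ⟨(mem_sdiff.1 hB).1, by
        simpa [hBu] using (mem_sdiff.1 hB).2⟩)
      have h4 := hg.union_comp h𝓑 (hS.mem_comps_union h𝓑 (mem_sdiff.1 hB).1) subset_union_left
      rw [union_comm, h3, h1] at h4
      linarith

theorem exists_min_superset (h𝓑 : IsBuildingFamily 𝓑) (hI : I.Nonempty) :
    ∃ A ∈ S, I ⊆ A ∧ ∀ B ∈ S, I ⊆ B → A ⊆ B := by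
  obtain ⟨A, hA, hmin⟩ := exists_min_image (S.filter (I ⊆ ·)) card
    ⟨univ, mem_filter.2 ⟨hS.univ_mem, subset_univ _⟩⟩
  rw [mem_filter] at hA
  refine ⟨A, hA.1, hA.2, fun B hB hIB => ?_⟩
  obtain ⟨i, hi⟩ := hI
  rcases hS.subset_or_subset h𝓑 hA.1 hB ⟨i, mem_inter.2 ⟨hA.2 hi, hIB hi⟩⟩ with h | h
  · exact h
  · exact (eq_of_subset_of_card_le h (hmin B (mem_filter.2 ⟨hB, hIB⟩))).ge

end IsLabelledNested

namespace IsWeight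

variable (hw : IsWeight 𝓑 c ε)
include hw

theorem tight_biUnion (hy : ∀ i, 0 < y i)
    (hmin : ∀ I, excess 𝓑 c ε y univ ≤ excess 𝓑 c ε y I) {F : Finset (Finset ι)}
    (hF : F.Nonempty) (h : ∀ I ∈ F, IsTight (excess 𝓑 c ε y) I) :
    IsTight (excess 𝓑 c ε y) (F.biUnion id) ∧
      ∀ C ∈ comps 𝓑 (F.biUnion id), ∃ I ∈ F, C ∈ comps 𝓑 I := by
  induction hF using Finset.Nonempty.cons_induction with
  | singleton I =>
    rw [singleton_biUnion, id]
    exact ⟨h I (mem_singleton_self I), fun C hC => ⟨I, mem_singleton_self I, hC⟩⟩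
  | cons I F hI hF ih =>
    obtain ⟨h1, h2⟩ := ih fun J hJ => h J (mem_cons_of_mem hJ)
    have h3 := h I (mem_cons_self I F)
    rw [cons_eq_insert, biUnion_insert, id]
    refine ⟨(hw.tight_union_and_inter hy hmin h3 h1).1, fun C hC => ?_⟩
    rcases hw.mem_comps_or_of_tight_union hy hmin h3 h1 hC with h4 | h4
    · exact ⟨I, mem_insert_self _ _, h4⟩
    · obtain ⟨J, hJ, hCJ⟩ := h2 C h4
      exact ⟨J, mem_insert_of_mem hJ, hCJ⟩

/-- The tight sets of a point in the open chamber come from a labelled nested set. -/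
theorem exists_labelledNested (hy : ∀ i, 0 < y i)
    (hmin : ∀ I, excess 𝓑 c ε y univ ≤ excess 𝓑 c ε y I) :
    ∃ S D, IsLabelledNested 𝓑 S D ∧ ∀ I, excess 𝓑 c ε y I = excess 𝓑 c ε y univ ↔
      IsFaceSet 𝓑 S D I := by
  have h𝓑 := hw.building
  have hg := hw.sepAdditive_excess y
  set g := excess 𝓑 c ε y with hgdef
  -- The smallest tight set; it is itself tight because tight sets are closed under intersection.
  set D : Finset ι := (univ.filter (IsTight g)).inf id with hD
  have hDt : IsTight g D := by
    refine inf_induction (p := IsTight g) rfl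
      (fun I hI J hJ => (hw.tight_union_and_inter hy hmin hI hJ).2) fun I hI => ?_
    exact (mem_filter.1 hI).2
  have hDle : ∀ I, IsTight g I → D ⊆ I := fun I hI =>
    inf_le (f := id) (mem_filter.2 ⟨mem_univ _, hI⟩)
  set S : Finset (Finset ι) := univ.filter fun A => ∃ I, IsTight g I ∧ A ∈ comps 𝓑 I with hSdef
  have hS : ∀ {A}, A ∈ S ↔ ∃ I, IsTight g I ∧ A ∈ comps 𝓑 I := fun {A} => by simp [hSdef]
  refine ⟨S, D, ⟨?_, ?_, ?_, ?_, ?_⟩, fun I => ⟨fun hI => ?_, fun hI => ?_⟩⟩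
  · intro A hA
    obtain ⟨I, -, hAI⟩ := hS.1 hA
    exact mem_of_mem_comps hAI
  · intro T hTS hT hanti hmem
    choose! f hft hfA using fun A (hA : A ∈ T) => hS.1 (hTS hA)
    obtain ⟨A₀, hA₀⟩ := hT.nonempty
    -- Each A ∈ T is a component of a tight set `f A`. A component of the union of the `f A`
    -- containing all of T is a component of one single `f A`; it then equals A, so A contains the
    -- other members of the antichain.
    obtain ⟨-, h2⟩ := hw.tight_biUnion (F := T.image f) hy hmin ⟨f A₀, mem_image_of_mem f hA₀⟩
      (by simpa using hft)
    have hsub : T.biUnion id ⊆ (T.image f).biUnion id := by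
      refine biUnion_subset.2 fun A hA => (subset_of_mem_comps (hfA A hA)).trans ?_
      exact subset_biUnion_of_mem id (mem_image_of_mem f hA)
    obtain ⟨C, hC, hTC⟩ := exists_subset_mem_comps hmem hsub
    obtain ⟨I, hI, hCI⟩ := h2 C hC
    obtain ⟨A, hA, rfl⟩ := mem_image.1 hI
    have hle : ∀ B ∈ T, B ⊆ C := fun B hB => (subset_biUnion_of_mem id hB).trans hTC
    have hAC := eq_of_mem_comps_of_subset (hfA A hA) (mem_of_mem_comps hCI)
      (subset_of_mem_comps hCI) (hle A hA)
    obtain ⟨B, hB, hBA⟩ := hT.exists_ne A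
    exact hanti hB hA hBA (hAC ▸ hle B hB)
  · refine hS.2 ⟨univ, rfl, ?_⟩
    rw [comps_of_mem hw.univ_mem]
    exact mem_singleton_self _
  · exact fun A hA => hS.2 ⟨D, hDt, hA⟩
  · intro A hA B hB hBA
    obtain ⟨I, hI, hBI⟩ := hS.1 hB
    exact eq_of_mem_comps_of_subset hBI (mem_of_mem_comps hA)
      ((subset_of_mem_comps hA).trans (hDle I hI)) hBA
  · exact ⟨fun A hA => hS.2 ⟨I, hI, hA⟩, hDle I hI⟩
  -- C is a component of some tight I' ⊇ D. Adding C to D, and replacing C by D ∩ C inside I',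
  -- change `g` by opposite amounts; both changes are nonnegative, hence zero. Then I is the union
  -- of D and the sets D ∪ C.
  · have key : ∀ C ∈ comps 𝓑 I, IsTight g (D ∪ C) := by
      intro C hC
      obtain ⟨I', hI', hCI'⟩ := hS.1 (hI.1 hC)
      have hDI' := hDle I' hI'
      have h1 := hg.union_comp h𝓑 hCI' hDI'
      have h2 := hg.inter_le h𝓑 hmin hDt hCI' hDI'
      have hs := Separated.of_mem_comps h𝓑 hCI'
      have h3 := hg _ _ hs
      have h4 := hg _ _ (hs.mono (J' := D ∩ C) inter_subset_right subset_rfl)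
      rw [union_sdiff_of_subset (subset_of_mem_comps hCI'), hI'] at h3
      have h5 := hmin (D ∩ C ∪ I' \ C)
      rw [IsTight] at hDt ⊢
      linarith
    have h1 := (hw.tight_biUnion (F := insert D ((comps 𝓑 I).image (D ∪ ·))) hy hmin
      ⟨D, mem_insert_self _ _⟩ (by
        intro J hJ
        rcases mem_insert.1 hJ with rfl | hJ
        · exact hDt
        · obtain ⟨C, hC, rfl⟩ := mem_image.1 hJ
          exact key C hC)).1
    have h2 : (insert D ((comps 𝓑 I).image (D ∪ ·))).biUnion id = I := by
      rw [biUnion_insert, id]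
      refine subset_antisymm (union_subset hI.2 (biUnion_subset.2 fun J hJ => ?_)) fun i hi => ?_
      · obtain ⟨C, hC, rfl⟩ := mem_image.1 hJ
        exact union_subset hI.2 (subset_of_mem_comps hC)
      · obtain ⟨C, hC, hiC⟩ := h𝓑.exists_mem_comps hi
        exact mem_union_right _ (mem_biUnion.2
          ⟨D ∪ C, mem_image_of_mem _ hC, mem_union_right _ hiC⟩)
    rwa [h2] at h1

end IsWeight

end Nested

/-! ### Realizing every labelled nested set by a point of the open chamber -/

section Realization

open Finset
open scoped Classical

variable {ι : Type*} [DecidableEq ι] [Fintype ι] {𝓑 : Set (Finset ι)} {c : Finset ι → ι → ℝ}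
  {ε : ℕ → ℝ} {I J K A B D : Finset ι} {y : ι → ℝ} {S : Finset (Finset ι)}

/-- `cell` assigns to every point the smallest element of `S` that contains it. -/
structure IsCell (S : Finset (Finset ι)) (cell : ι → Finset ι) : Prop where
  mem : ∀ i, cell i ∈ S
  mem_self : ∀ i, i ∈ cell i
  subset : ∀ i, ∀ B ∈ S, i ∈ B → cell i ⊆ B

theorem IsLabelledNested.exists_isCell (hS : IsLabelledNested 𝓑 S D)
    (h𝓑 : IsBuildingFamily 𝓑) : ∃ cell, IsCell S cell := by
  choose cell h1 h2 h3 using fun i => hS.exists_min_superset h𝓑 (singleton_nonempty i)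
  exact ⟨cell, h1, fun i => singleton_subset_iff.1 (h2 i),
    fun i B hB hi => h3 i B hB (singleton_subset_iff.2 hi)⟩

namespace IsCell

variable {cell : ι → Finset ι} (hc : IsCell S cell) (hS : IsLabelledNested 𝓑 S D)
  (h𝓑 : IsBuildingFamily 𝓑)
include hc

theorem eq_or_ssubset (hA : A ∈ S) {i : ι} (hi : i ∈ A) : cell i = A ∨ cell i ⊂ A :=
  (hc.subset i A hA hi).eq_or_ssubset

include hS h𝓑

/-- The part of `A` covered by smaller elements of `S` splits into elements of `S`. -/
theorem comps_lower (hA : A ∈ S) :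
    ∀ B ∈ comps 𝓑 (A.filter fun i => cell i ≠ A), B ∈ S ∧ B ⊂ A := by
  have h1 : A.filter (fun i => cell i ≠ A) =
      ((A.filter fun i => cell i ≠ A).image cell).biUnion id := by
    ext j
    simp only [mem_biUnion, mem_image, id]
    constructor
    · exact fun hj => ⟨cell j, ⟨j, hj, rfl⟩, hc.mem_self j⟩
    · rintro ⟨_, ⟨i, hi, rfl⟩, hj⟩
      rw [mem_filter] at hi ⊢
      have hlt := (hc.eq_or_ssubset hA hi.1).resolve_left hi.2
      refine ⟨hlt.1 hj, fun e => hlt.2 ?_⟩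
      rw [← e]
      exact hc.subset j _ (hc.mem i) hj
  intro B hB
  rw [h1] at hB
  have h2 := hS.comps_biUnion_subset h𝓑 (S₁ := (A.filter fun i => cell i ≠ A).image cell)
    (by
      intro X hX
      obtain ⟨i, -, rfl⟩ := mem_image.1 hX
      exact hc.mem i) hB
  obtain ⟨i, hi, rfl⟩ := mem_image.1 h2
  rw [mem_filter] at hi
  exact ⟨hc.mem i, (hc.eq_or_ssubset hA hi.1).resolve_left hi.2⟩

/-- Otherwise the smaller elements of S would cover A, and A, its own unique component, would be
strictly smaller than itself. -/
theorem core_nonempty (hA : A ∈ S) : (A.filter fun i => cell i = A).Nonempty := by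
  by_contra h
  rw [not_nonempty_iff_eq_empty, filter_eq_empty_iff] at h
  have h1 : A.filter (fun i => cell i ≠ A) = A := filter_true_of_mem h
  have h2 := hc.comps_lower hS h𝓑 hA A (by
    rw [h1, comps_of_mem (hS.subset A hA)]
    exact mem_singleton_self A)
  exact h2.2.2 subset_rfl

/-- The linear forms of a nested set take arbitrary values at a point of equal shares. -/
theorem exists_wsum_eq (hw : IsWeight 𝓑 c ε) (b : Finset ι → ℝ) :
    ∃ y : ι → ℝ, ∀ A ∈ S, (∃ r, ∀ i ∈ A, cell i = A → c A i * y i = r) ∧ wsum c y A = b A := by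
  let f : ι → ℕ := fun i => #(cell i)
  -- Recursion on the size of the cell A of i. What is left of the prescribed value on A after
  -- subtracting the already determined smaller cells is divided equally among the indices whose
  -- cell is A; the last division removes the coefficient. An index of A whose cell is not smaller
  -- has cell A.
  let step : (i : ι) → ((j : ι) → f j < f i → ℝ) → ℝ := fun i rec =>
    (b (cell i) - ∑ j ∈ cell i, if h : f j < f i then c (cell i) j * rec j h else 0) /
      #((cell i).filter fun j => cell j = cell i) / c (cell i) i
  let y : ι → ℝ := (measure f).wf.fix step
  have hy : ∀ i, y i = (b (cell i) - ∑ j ∈ cell i, if f j < f i then c (cell i) j * y j else 0) /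
      #((cell i).filter fun j => cell j = cell i) / c (cell i) i := by
    intro i
    have := (measure f).wf.fix_eq step i
    refine this.trans ?_
    simp only [step, dite_eq_ite]
    rfl
  have hr : ∀ A ∈ S, ∀ i ∈ A, cell i = A → c A i * y i =
      (b A - ∑ j ∈ A, if #(cell j) < #A then c A j * y j else 0) /
        #(A.filter fun j => cell j = A) := by
    rintro A hA i hi rfl
    rw [hy i, mul_div_cancel₀]
    exact (hw.coef_pos _ (hS.subset _ hA) i hi).ne'
  refine ⟨y, fun A hA => ⟨⟨_, hr A hA⟩, ?_⟩⟩
  have hcore := (hc.core_nonempty hS h𝓑 hA).card_pos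
  have h1 : wsum c y A = ∑ i ∈ A.filter (fun i => cell i = A), c A i * y i +
      ∑ j ∈ A, if #(cell j) < #A then c A j * y j else 0 := by
    rw [wsum, ← sum_filter, ← sum_filter_add_sum_filter_not A (fun i => cell i = A)]
    congr 2
    refine filter_congr fun i hi => ⟨fun h => ?_, fun h e => ?_⟩
    · exact card_lt_card ((hc.eq_or_ssubset hA hi).resolve_left h)
    · rw [e] at h
      exact h.false
  rw [h1, sum_congr rfl fun i hi => hr A hA i (mem_filter.1 hi).1 (mem_filter.1 hi).2, sum_const,
    nsmul_eq_mul, mul_div_cancel₀, sub_add_cancel]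
  exact_mod_cast hcore.ne'

end IsCell

/-- With m = p + q this is q + 1 ≤ 2^q: the function k ↦ 2^k / k does not decrease on k ≥ 1. -/
theorem mul_two_pow_le {p m : ℕ} (hp : 1 ≤ p) (hpm : p ≤ m) :
    (m : ℝ) * 2 ^ p ≤ p * 2 ^ m := by
  obtain ⟨q, rfl⟩ := Nat.exists_eq_add_of_le hpm
  have h1 : q + 1 ≤ 2 ^ q := Nat.lt_two_pow_self
  have h2 : p + q ≤ p * 2 ^ q := by nlinarith
  have h3 : ((p + q : ℕ) : ℝ) ≤ p * 2 ^ q := by exact_mod_cast h2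
  rw [pow_add]
  nlinarith [mul_le_mul_of_nonneg_right h3 (pow_nonneg (zero_le_two (α := ℝ)) p)]

/-- The counting estimate behind the strictness of the realization. -/
theorem card_estimate {α : Type*} {F : Finset α} {m p k : ℕ} {w v : α → ℕ} (hp : 1 ≤ p)
    (hpm : p ≤ m) (P : α → Prop) [DecidablePred P] (hw : ∀ a ∈ F, 1 ≤ w a) (hle : ∀ a ∈ F, v a ≤ w a)
    (hlt : ∀ a ∈ F, ¬ P a → v a < w a) (hk : k ≤ p + ∑ a ∈ F, v a) :
    (m : ℝ) * 2 ^ k ≤ p * (2 ^ (m + ∑ a ∈ F, w a) - ∑ a ∈ F with ¬ P a, 2 ^ w a) := by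
  have hsplit := sum_filter_add_sum_filter_not F (fun a => ¬ P a) w
  have hpos : (0 : ℝ) ≤ p := Nat.cast_nonneg p
  have base := mul_two_pow_le hp hpm
  rcases (F.filter fun a => ¬ P a).eq_empty_or_nonempty with h | ⟨a, ha⟩
  · rw [h, sum_empty, sub_zero]
    have h1 : k ≤ p + ∑ a ∈ F, w a := hk.trans (by gcongr with a ha; exact hle a ha)
    calc (m : ℝ) * 2 ^ k ≤ m * 2 ^ (p + ∑ a ∈ F, w a) := by
          gcongr
          exact one_le_two
      _ = m * 2 ^ p * 2 ^ (∑ a ∈ F, w a) := by rw [pow_add]; ring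
      _ ≤ p * 2 ^ m * 2 ^ (∑ a ∈ F, w a) := by gcongr
      _ = p * 2 ^ (m + ∑ a ∈ F, w a) := by rw [pow_add]; ring
  -- Some block is only partly used, so the exponent k drops by at least one. The factor 2 gained
  -- pays for the subtracted powers, whose sum is at most half of the leading power.
  · have haF := (mem_filter.1 ha).1
    have h1 : ∑ a ∈ F, v a < ∑ a ∈ F, w a :=
      sum_lt_sum hle ⟨a, haF, hlt a haF (mem_filter.1 ha).2⟩
    have h2 : k + 1 ≤ p + ∑ a ∈ F, w a := by omega
    have h3 : ∑ a ∈ F with ¬ P a, (2 : ℝ) ^ w a ≤ 2 ^ (∑ a ∈ F, w a) :=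
      (sum_two_pow_le _ w fun a ha => hw a (mem_filter.1 ha).1).trans
        (pow_le_pow_right₀ one_le_two (by omega))
    have h4 : (2 : ℝ) * 2 ^ (∑ a ∈ F, w a) ≤ 2 ^ (m + ∑ a ∈ F, w a) := by
      rw [← pow_succ']
      exact pow_le_pow_right₀ one_le_two (by omega)
    have h5 : (m : ℝ) * 2 ^ (k + 1) ≤ p * 2 ^ (m + ∑ a ∈ F, w a) := by
      calc (m : ℝ) * 2 ^ (k + 1) ≤ m * 2 ^ (p + ∑ a ∈ F, w a) := by
            gcongr
            exact one_le_two
        _ = m * 2 ^ p * 2 ^ (∑ a ∈ F, w a) := by rw [pow_add]; ring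
        _ ≤ p * 2 ^ m * 2 ^ (∑ a ∈ F, w a) := by gcongr
        _ = p * 2 ^ (m + ∑ a ∈ F, w a) := by rw [pow_add]; ring
    rw [pow_succ] at h5
    have h6 : (2 : ℝ) ^ (m + ∑ a ∈ F, w a) ≤
        2 * (2 ^ (m + ∑ a ∈ F, w a) - ∑ a ∈ F with ¬ P a, 2 ^ w a) := by linarith
    have h7 := mul_le_mul_of_nonneg_left h6 hpos
    linarith

namespace IsWeight

variable (hw : IsWeight 𝓑 c ε) (hS : IsLabelledNested 𝓑 S D) {cell : ι → Finset ι}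
  (hc : IsCell S cell)
include hw hS hc

/-- Induction on the size of the cell. The smaller elements of S inside A contribute at most κ(A)
times the weight of their union, which is strictly less than κ(A) 2^#A = ε(#A); so a positive amount
remains to be shared. -/
theorem pos_of_equal_shares
    (hy : ∀ A ∈ S, (∃ r, ∀ i ∈ A, cell i = A → c A i * y i = r) ∧ wsum c y A = ε #A) (i : ι) :
    0 < y i := by
  have h𝓑 := hw.building
  have key : ∀ k, ∀ i, #(cell i) = k → 0 < y i := by
    intro k
    induction k using Nat.strong_induction_on with
    | _ k ih =>
      intro i hik
      have hA := hc.mem i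
      have hA𝓑 := hS.subset _ hA
      have hiA := hc.mem_self i
      set A := cell i with hAdef
      obtain ⟨⟨r, hr⟩, hsum⟩ := hy A hA
      have hlow : ∑ j ∈ A.filter (fun j => cell j ≠ A), c A j * y j ≤
          kap ε #A * 2 ^ #(A.filter fun j => cell j ≠ A) := by
        conv_lhs => rw [← h𝓑.biUnion_comps (A.filter fun j => cell j ≠ A)]
        rw [sum_biUnion (h𝓑.pairwiseDisjoint_comps _)]
        have h1 : ∀ B ∈ comps 𝓑 (A.filter fun j => cell j ≠ A),
            ∑ j ∈ id B, c A j * y j ≤ kap ε #A * 2 ^ #B := by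
          intro B hB
          obtain ⟨hBS, hBA⟩ := hc.comps_lower hS h𝓑 hA B hB
          have h0 : excess 𝓑 c ε y B = 0 := by
            rw [hw.excess_of_mem (hS.subset B hBS), kap_mul, (hy B hBS).2, sub_self]
          have := hw.sum_coef_le hA𝓑 (hS.subset B hBS) hBA.1 (y := y) (fun j hj =>
            (ih _ (hik ▸ (card_le_card (hc.subset j B hBS hj)).trans_lt (card_lt_card hBA))
              j rfl).le) h0.le
          rwa [h0, add_zero] at this
        refine (sum_le_sum h1).trans ?_
        rw [← mul_sum]
        exact mul_le_mul_of_nonneg_left (h𝓑.sum_comps_two_pow_le _) (hw.kap_pos A hA𝓑).le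
      have hlt : (2 : ℝ) ^ #(A.filter fun j => cell j ≠ A) < 2 ^ #A := by
        refine pow_lt_pow_right₀ one_lt_two (card_lt_card ⟨filter_subset _ _, fun h => ?_⟩)
        exact (mem_filter.1 (h hiA)).2 hAdef.symm
      rw [wsum, ← sum_filter_add_sum_filter_not A (fun j => cell j = A),
        sum_congr rfl fun j hj => hr j (mem_filter.1 hj).1 (mem_filter.1 hj).2, sum_const,
        nsmul_eq_mul, ← kap_mul ε #A] at hsum
      have h2 := mul_lt_mul_of_pos_left hlt (hw.kap_pos A hA𝓑)
      have h3 : 0 < (#(A.filter fun j => cell j = A) : ℝ) * r := by linarith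
      have h4 : 0 < r := pos_of_mul_pos_right h3 (Nat.cast_nonneg _)
      rw [← hr i hiA hAdef.symm] at h4
      exact pos_of_mul_pos_right h4 (hw.coef_pos A hA𝓑 i hiA).le
  exact key _ i rfl

/-- Let A be the smallest element of S containing I. Of the m indices with cell A, the set I
contains p ≥ 1, and these have equal shares; the other indices of A lie in blocks of S of bounded
mass. `card_estimate` turns this into Σ over I of c_A y ≥ κ(A) 2^#I, and replacing the coefficients
of A by those of I gains strictly. -/
theorem excess_pos_of_equal_shares
    (hy : ∀ A ∈ S, (∃ r, ∀ i ∈ A, cell i = A → c A i * y i = r) ∧ wsum c y A = ε #A)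
    (hI : I ∈ 𝓑) (hIS : I ∉ S) : 0 < excess 𝓑 c ε y I := by
  have h𝓑 := hw.building
  have hypos := hw.pos_of_equal_shares hS hc hy
  obtain ⟨A, hA, hIA, hAmin⟩ := hS.exists_min_superset h𝓑 (h𝓑.nonempty I hI)
  have hA𝓑 := hS.subset A hA
  have hIA' : I ⊂ A := lt_of_le_of_ne hIA fun e => hIS (e ▸ hA)
  obtain ⟨⟨r, hr⟩, hsum⟩ := hy A hA
  set s : ι → ℝ := fun i => c A i * y i with hs
  have hspos : ∀ i ∈ A, 0 < s i := fun i hi => mul_pos (hw.coef_pos A hA𝓑 i hi) (hypos i)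
  set U := A.filter fun j => cell j ≠ A with hU
  set C₀ := A.filter fun j => cell j = A with hC₀
  set F := comps 𝓑 U with hF
  have hFA : ∀ B ∈ F, B ∈ S ∧ B ⊂ A := hc.comps_lower hS h𝓑 hA
  have hsB : ∀ B ∈ F, ∑ i ∈ B, s i ≤ kap ε #A * 2 ^ #B := by
    intro B hB
    have hBS := (hFA B hB).1
    have h0 : excess 𝓑 c ε y B = 0 := by
      rw [hw.excess_of_mem (hS.subset B hBS), kap_mul, (hy B hBS).2, sub_self]
    have := hw.sum_coef_le hA𝓑 (hS.subset B hBS) (hFA B hB).2.1 (fun j _ => (hypos j).le) h0.le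
    rwa [h0, add_zero] at this
  have hdisj : Disjoint C₀ U := disjoint_filter_filter_not _ _ _
  have hAU : C₀ ∪ U = A := filter_union_filter_not_eq _ _
  have hpart : ∀ X ⊆ A, ∀ t : ι → ℝ, ∑ i ∈ X, t i =
      ∑ i ∈ X ∩ C₀, t i + ∑ B ∈ F, ∑ i ∈ X ∩ B, t i := by
    intro X hX t
    have h1 : X = X ∩ C₀ ∪ F.biUnion fun B => X ∩ B := by
      rw [← inter_biUnion, ← inter_union_distrib_left]
      have : F.biUnion (fun B => B) = U := h𝓑.biUnion_comps U
      rw [this, hAU, inter_eq_left.2 hX]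
    conv_lhs => rw [h1]
    rw [sum_union, sum_biUnion]
    · intro B hB B' hB' hne
      exact (h𝓑.disjoint_of_mem_comps hB hB' hne).mono inter_subset_right inter_subset_right
    · refine hdisj.mono inter_subset_right (biUnion_subset.2 fun B hB => ?_)
      exact inter_subset_right.trans (subset_of_mem_comps hB)
  -- If I avoided the indices with cell A, it would lie in a single block, which is an element of S
  -- smaller than A.
  have hcoreI : (I ∩ C₀).Nonempty := by
    by_contra h
    rw [not_nonempty_iff_eq_empty, ← disjoint_iff_inter_eq_empty] at h
    have hIU : I ⊆ U := by
      intro i hi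
      have := hIA hi
      rw [← hAU] at this
      exact (mem_union.1 this).resolve_left (disjoint_left.1 h hi)
    obtain ⟨B, hB, hIB⟩ := exists_subset_mem_comps hI hIU
    exact (hFA B hB).2.2 (hAmin B (hFA B hB).1 hIB)
  have hcoresum : ∀ X ⊆ C₀, ∑ i ∈ X, s i = #X * r := by
    intro X hX
    rw [sum_congr rfl fun i hi => hr i (mem_filter.1 (hX hi)).1 (mem_filter.1 (hX hi)).2,
      sum_const, nsmul_eq_mul]
  have hrpos : 0 < r := by
    obtain ⟨i, hi⟩ := hcoreI
    have hi' := mem_filter.1 (mem_inter.1 hi).2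
    rw [← hr i hi'.1 hi'.2]
    exact hspos i hi'.1
  set m := #C₀
  set p := #(I ∩ C₀)
  have hpm : p ≤ m := card_le_card inter_subset_right
  have hcardA : #A = m + ∑ B ∈ F, #B := by
    rw [← hAU, card_union_of_disjoint hdisj, h𝓑.sum_card_comps]
  have hcardI : #I ≤ p + ∑ B ∈ F, #(I ∩ B) := by
    have h1 := hpart I hIA fun _ => 1
    simp only [sum_const, mul_one, nsmul_eq_mul] at h1
    exact_mod_cast h1.le
  have hest := card_estimate (F := F) (m := m) (p := p) (k := #I) (w := card)
    (v := fun B => #(I ∩ B)) hcoreI.card_pos hpm (fun B => B ⊆ I)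
    (fun B hB => (h𝓑.nonempty_of_mem_comps hB).card_pos)
    (fun B _ => card_le_card inter_subset_right)
    (fun B _ hBI => card_lt_card ⟨inter_subset_right, fun h => hBI (h.trans inter_subset_left)⟩)
    hcardI
  rw [← hcardA] at hest
  have htotal : (m : ℝ) * r + ∑ B ∈ F, ∑ i ∈ B, s i = kap ε #A * 2 ^ #A := by
    rw [kap_mul, ← hsum, wsum, hpart A subset_rfl,
      inter_eq_right.2 (filter_subset _ _ : C₀ ⊆ A), ← hcoresum C₀ subset_rfl]
    congr 1
    exact sum_congr rfl fun B hB => by rw [inter_eq_right.2 (hFA B hB).2.1]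
  have hsplit := sum_filter_add_sum_filter_not F (fun B => ¬ B ⊆ I) fun B => ∑ i ∈ B, s i
  simp only [not_not] at hsplit
  have hout : ∑ B ∈ F with ¬ B ⊆ I, ∑ i ∈ B, s i ≤
      kap ε #A * ∑ B ∈ F with ¬ B ⊆ I, 2 ^ #B := by
    rw [mul_sum]
    exact sum_le_sum fun B hB => hsB B (mem_filter.1 hB).1
  have hin : 0 ≤ ∑ B ∈ F with B ⊆ I, ∑ i ∈ B, s i :=
    sum_nonneg fun B hB => sum_nonneg fun i hi =>
      (hspos i ((hFA B (mem_filter.1 hB).1).2.1 hi)).le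
  have hlow : (p : ℝ) * r + ∑ B ∈ F with B ⊆ I, ∑ i ∈ B, s i ≤ ∑ i ∈ I, s i := by
    rw [hpart I hIA, hcoresum _ inter_subset_right]
    gcongr
    rw [sum_filter]
    refine sum_le_sum fun B hB => ?_
    split_ifs with h
    · rw [inter_eq_right.2 h]
    · exact sum_nonneg fun i hi => (hspos i (hIA (mem_inter.1 hi).1)).le
  have hmpos : (0 : ℝ) < m := by exact_mod_cast hcoreI.card_pos.trans_le hpm
  have hppos : (0 : ℝ) < p := by exact_mod_cast hcoreI.card_pos
  have hpm' : (p : ℝ) ≤ m := by exact_mod_cast hpm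
  have hκA := hw.kap_pos A hA𝓑
  have hκI := hw.kap_pos I hI
  have hmain : kap ε #A * 2 ^ #I ≤ ∑ i ∈ I, s i := by
    refine le_of_mul_le_mul_left ?_ hmpos
    have e1 : (m : ℝ) * (kap ε #A * 2 ^ #I) ≤
        kap ε #A * (p * (2 ^ #A - ∑ B ∈ F with ¬ B ⊆ I, 2 ^ #B)) := by
      nlinarith [mul_le_mul_of_nonneg_left hest hκA.le]
    have e2 : kap ε #A * (p * (2 ^ #A - ∑ B ∈ F with ¬ B ⊆ I, 2 ^ #B)) ≤
        p * (m * r + ∑ B ∈ F with B ⊆ I, ∑ i ∈ B, s i) := by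
      have : kap ε #A * (2 ^ #A - ∑ B ∈ F with ¬ B ⊆ I, 2 ^ #B) ≤
          m * r + ∑ B ∈ F with B ⊆ I, ∑ i ∈ B, s i := by
        rw [mul_sub]
        linarith
      nlinarith [mul_le_mul_of_nonneg_left this hppos.le]
    have e3 : (p : ℝ) * (m * r + ∑ B ∈ F with B ⊆ I, ∑ i ∈ B, s i) ≤
        m * (p * r + ∑ B ∈ F with B ⊆ I, ∑ i ∈ B, s i) := by
      nlinarith [mul_le_mul_of_nonneg_right hpm' hin]
    exact (e1.trans (e2.trans e3)).trans (mul_le_mul_of_nonneg_left hlow hmpos.le)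
  have h1 := hw.wsum_mul_lt hA𝓑 hI hIA' hypos
  have h2 := mul_le_mul_of_nonneg_right hmain hκI.le
  have h3 : kap ε #I * 2 ^ #I * kap ε #A < wsum c y I * kap ε #A := by
    refine lt_of_le_of_lt ?_ h1
    linarith
  rw [hw.excess_of_mem hI, sub_pos]
  exact lt_of_mul_lt_mul_right h3 hκA.le

end IsWeight

/-- A label contained in a union of separated sets lies on one side. Additivity lets the label count
be added to the excess and still be evaluated on components. -/
theorem sepAdditive_card_labels (h𝓑 : IsBuildingFamily 𝓑) (D : Finset ι) :
    SepAdditive 𝓑 fun I => (#((comps 𝓑 D).filter (· ⊆ I)) : ℝ) := by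
  intro J K h
  have h1 : (comps 𝓑 D).filter (· ⊆ J ∪ K) =
      (comps 𝓑 D).filter (· ⊆ J) ∪ (comps 𝓑 D).filter (· ⊆ K) := by
    ext L
    simp only [mem_filter, mem_union]
    constructor
    · rintro ⟨hL, hLJK⟩
      rcases h.2 L (mem_of_mem_comps hL) hLJK with h' | h'
      exacts [Or.inl ⟨hL, h'⟩, Or.inr ⟨hL, h'⟩]
    · rintro (⟨hL, h'⟩ | ⟨hL, h'⟩)
      exacts [⟨hL, h'.trans subset_union_left⟩, ⟨hL, h'.trans subset_union_right⟩]
  have h2 : Disjoint ((comps 𝓑 D).filter (· ⊆ J)) ((comps 𝓑 D).filter (· ⊆ K)) := by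
    rw [disjoint_left]
    intro L hL hL'
    rw [mem_filter] at hL hL'
    obtain ⟨i, hi⟩ := h𝓑.nonempty_of_mem_comps hL.1
    exact disjoint_left.1 h.1 (hL.2 hi) (hL'.2 hi)
  dsimp only
  rw [h1, card_union_of_disjoint h2, Nat.cast_add]

/-- Every labelled nested set is realized by a point of the open chamber. -/
theorem IsWeight.exists_point (hw : IsWeight 𝓑 c ε) (hS : IsLabelledNested 𝓑 S D) :
    ∃ y : ι → ℝ, (∀ i, 0 < y i) ∧ (∀ I, excess 𝓑 c ε y univ ≤ excess 𝓑 c ε y I) ∧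
      ∀ I, excess 𝓑 c ε y I = excess 𝓑 c ε y univ ↔ IsFaceSet 𝓑 S D I := by
  have h𝓑 := hw.building
  obtain ⟨cell, hc⟩ := hS.exists_isCell h𝓑
  obtain ⟨y, hy⟩ := hc.exists_wsum_eq hS h𝓑 hw fun A => ε #A
  set lam : Finset ι → ℝ := fun I => (#((comps 𝓑 D).filter (· ⊆ I)) : ℝ) with hlam
  -- The perturbation lowers the excess of each element of S in proportion to the number of labels
  -- it contains, which favours sets containing D.
  obtain ⟨v, hv⟩ := hc.exists_wsum_eq hS h𝓑 hw fun A => - lam A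
  have hypos := hw.pos_of_equal_shares hS hc hy
  have hexc : ∀ t : ℝ, ∀ I, excess 𝓑 c ε (fun i => y i + t * v i) I =
      excess 𝓑 c ε y I + t * wsum c v I := by
    intro t I
    simp only [excess, wsum, mul_add, sum_add_distrib, mul_sum]
    have : ∀ i, c I i * (t * v i) = t * (c I i * v i) := fun i => by ring
    simp only [this]
    ring
  have hev : ∀ a b : ℝ, 0 < a → ∀ᶠ t : ℝ in nhdsWithin 0 (Set.Ioi 0), 0 < a + t * b := by
    intro a b ha
    have hcont : Continuous fun t : ℝ => a + t * b := by fun_prop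
    have h1 : Filter.Tendsto (fun t : ℝ => a + t * b) (nhds 0) (nhds a) := by
      simpa using hcont.tendsto 0
    exact (h1.mono_left nhdsWithin_le_nhds).eventually (lt_mem_nhds ha)
  have h1 : ∀ᶠ t : ℝ in nhdsWithin 0 (Set.Ioi 0), ∀ i, 0 < y i + t * v i :=
    Filter.eventually_all.2 fun i => hev _ _ (hypos i)
  have h2 : ∀ᶠ t : ℝ in nhdsWithin 0 (Set.Ioi 0), ∀ I : {I : Finset ι // I ∈ 𝓑 ∧ I ∉ S},
      0 < excess 𝓑 c ε y I + t * wsum c v I :=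
    Filter.eventually_all.2 fun I =>
      hev _ _ (hw.excess_pos_of_equal_shares hS hc hy I.2.1 I.2.2)
  obtain ⟨t, ⟨ht1, ht2⟩, ht⟩ := ((h1.and h2).and self_mem_nhdsWithin).exists
  have ht : 0 < t := ht
  set z : ι → ℝ := fun i => y i + t * v i with hz
  -- Adding back the label count makes `g` vanish on S and stay positive on the other members of the
  -- family; hence `g I` is nonnegative and is zero exactly when all components of I lie in S.
  set g : Finset ι → ℝ := fun I => excess 𝓑 c ε z I + t * lam I with hgdef
  have hg : SepAdditive 𝓑 g := by
    intro J K h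
    have e1 := hw.sepAdditive_excess z J K h
    have e2 : lam (J ∪ K) = lam J + lam K := sepAdditive_card_labels h𝓑 D J K h
    simp only [hgdef, e1, e2]
    ring
  have hlam0 : ∀ I, 0 ≤ lam I := fun I => Nat.cast_nonneg _
  have hgS : ∀ C ∈ S, g C = 0 := by
    intro C hC
    have h0 : excess 𝓑 c ε y C = 0 := by
      rw [hw.excess_of_mem (hS.subset C hC), kap_mul, (hy C hC).2, sub_self]
    have h3 := hexc t C
    rw [(hv C hC).2, h0] at h3
    simp only [hgdef]
    linarith
  have hgpos : ∀ C ∈ 𝓑, C ∉ S → 0 < g C := by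
    intro C hC hCS
    have h3 := ht2 ⟨C, hC, hCS⟩
    have h4 := hexc t C
    have h5 := mul_nonneg ht.le (hlam0 C)
    simp only [hgdef]
    dsimp only at h3
    linarith
  have hgnn : ∀ C ∈ 𝓑, 0 ≤ g C := fun C hC => by
    by_cases h : C ∈ S
    exacts [(hgS C h).ge, (hgpos C hC h).le]
  have hgI : ∀ I, 0 ≤ g I := fun I => by
    rw [hg.sum_comps h𝓑]
    exact sum_nonneg fun C hC => hgnn C (mem_of_mem_comps hC)
  have hgI0 : ∀ I, g I = 0 ↔ comps 𝓑 I ⊆ S := by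
    intro I
    rw [hg.sum_comps h𝓑, sum_eq_zero_iff_of_nonneg fun C hC => hgnn C (mem_of_mem_comps hC)]
    refine ⟨fun h C hC => ?_, fun h C hC => hgS C (h hC)⟩
    by_contra hCS
    exact (hgpos C (mem_of_mem_comps hC) hCS).ne' (h C hC)
  have hlamle : ∀ I, lam I ≤ lam univ := fun I =>
    Nat.cast_le.2 (card_le_card fun L hL =>
      mem_filter.2 ⟨(mem_filter.1 hL).1, subset_univ _⟩)
  have hlameq : ∀ I, lam I = lam univ ↔ D ⊆ I := by
    intro I
    have hu : (comps 𝓑 D).filter (· ⊆ univ) = comps 𝓑 D := filter_true_of_mem fun L _ => subset_univ _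
    simp only [hlam, hu, Nat.cast_inj, card_filter_eq_iff]
    constructor
    · intro h
      rw [← h𝓑.biUnion_comps D]
      exact biUnion_subset.2 h
    · exact fun h L hL => (subset_of_mem_comps hL).trans h
  have hgu : g univ = 0 := hgS _ hS.univ_mem
  -- Two nonnegative terms: the first vanishes iff the components of I lie in S, the second iff I
  -- contains every label.
  have hrel : ∀ I, excess 𝓑 c ε z I - excess 𝓑 c ε z univ = g I + t * (lam univ - lam I) := by
    intro I
    have : excess 𝓑 c ε z univ + t * lam univ = 0 := hgu
    simp only [hgdef]
    linarith
  have hnn : ∀ I, 0 ≤ t * (lam univ - lam I) := fun I =>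
    mul_nonneg ht.le (sub_nonneg.2 (hlamle I))
  refine ⟨z, ht1, fun I => ?_, fun I => ?_⟩
  · linarith [hrel I, hgI I, hnn I]
  · rw [← sub_eq_zero, hrel, IsFaceSet, ← hgI0, ← hlameq]
    constructor
    · intro h
      have e1 : g I = 0 := by linarith [hgI I, hnn I]
      have e2 : t * (lam univ - lam I) = 0 := by linarith [hgI I, hnn I]
      refine ⟨e1, ?_⟩
      linarith [(mul_eq_zero.1 e2).resolve_left ht.ne']
    · rintro ⟨e1, e2⟩
      rw [e1, e2, sub_self, mul_zero, add_zero]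

end Realization

/-! ### Faces of a polyhedron through the tight inequalities at a point -/

section Polyhedron

open scoped Classical

variable {V : Type*} [NormedAddCommGroup V] [InnerProductSpace ℝ V] {J : Type*}
  {m : J → V} {b : J → ℝ} {x y z v : V}

/-- The polyhedron cut out by the inequalities `⟪x, m j⟫ ≤ b j`. -/
def polyhedron (m : J → V) (b : J → ℝ) : Set V := {x | ∀ j, ⟪x, m j⟫_ℝ ≤ b j}

/-- The inequalities that are equalities at `x`. -/
def tightAt (m : J → V) (b : J → ℝ) (x : V) : Set J := {j | ⟪x, m j⟫_ℝ = b j}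

/-- The smallest face that contains `x`. -/
def faceOf (m : J → V) (b : J → ℝ) (x : V) : Set V :=
  {z | z ∈ polyhedron m b ∧ tightAt m b x ⊆ tightAt m b z}

theorem self_mem_faceOf (hx : x ∈ polyhedron m b) : x ∈ faceOf m b x := ⟨hx, subset_rfl⟩

theorem faceOf_subset_iff (hx : x ∈ polyhedron m b) :
    faceOf m b x ⊆ faceOf m b y ↔ tightAt m b y ⊆ tightAt m b x :=
  ⟨fun h => (h (self_mem_faceOf hx)).2, fun h _ hz => ⟨hz.1, h.trans hz.2⟩⟩

theorem faceOf_congr (h : tightAt m b x = tightAt m b y) : faceOf m b x = faceOf m b y := by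
  simp only [faceOf, h]

theorem convex_polyhedron (m : J → V) (b : J → ℝ) : Convex ℝ (polyhedron m b) := by
  intro x hx y hy s t hs ht hst j
  rw [inner_add_left, real_inner_smul_left, real_inner_smul_left]
  calc s * ⟪x, m j⟫_ℝ + t * ⟪y, m j⟫_ℝ ≤ s * b j + t * b j := by
        gcongr
        exacts [hx j, hy j]
    _ = b j := by rw [← add_mul, hst, one_mul]

theorem convex_faceOf (m : J → V) (b : J → ℝ) (x : V) : Convex ℝ (faceOf m b x) := by
  intro y hy z hz s t hs ht hst
  refine ⟨convex_polyhedron m b hy.1 hz.1 hs ht hst, fun j hj => ?_⟩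
  have h1 : ⟪y, m j⟫_ℝ = b j := hy.2 hj
  have h2 : ⟪z, m j⟫_ℝ = b j := hz.2 hj
  show ⟪s • y + t • z, m j⟫_ℝ = b j
  rw [inner_add_left, real_inner_smul_left, real_inner_smul_left, h1, h2, ← add_mul, hst, one_mul]

theorem isClosed_faceOf (m : J → V) (b : J → ℝ) (x : V) : IsClosed (faceOf m b x) := by
  have : faceOf m b x =
      (⋂ j, {z | ⟪z, m j⟫_ℝ ≤ b j}) ∩ ⋂ j ∈ tightAt m b x, {z | ⟪z, m j⟫_ℝ = b j} := by
    ext z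
    simp [faceOf, polyhedron, tightAt, Set.subset_def]
  rw [this]
  refine (isClosed_iInter fun j => ?_).inter (isClosed_biInter fun j _ => ?_)
  · exact isClosed_le (by fun_prop) continuous_const
  · exact isClosed_eq (by fun_prop) continuous_const

variable [Finite J]

theorem eventually_slack (hx : x ∈ polyhedron m b) (v : V) :
    ∀ᶠ t : ℝ in nhdsWithin 0 (Set.Ioi 0), ∀ j, j ∉ tightAt m b x →
      ⟪x + t • v, m j⟫_ℝ < b j := by
  refine Filter.eventually_all.2 fun j => ?_
  by_cases hj : j ∈ tightAt m b x
  · exact Filter.Eventually.of_forall fun t h => absurd hj h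
  · have hlt : ⟪x, m j⟫_ℝ < b j := lt_of_le_of_ne (hx j) hj
    have hcont : Continuous fun t : ℝ => ⟪x + t • v, m j⟫_ℝ := by fun_prop
    have h1 : Filter.Tendsto (fun t : ℝ => ⟪x + t • v, m j⟫_ℝ) (nhds 0) (nhds ⟪x, m j⟫_ℝ) := by
      simpa using hcont.tendsto 0
    filter_upwards [(h1.mono_left nhdsWithin_le_nhds).eventually (gt_mem_nhds hlt)] with t ht _
    exact ht

/-- Moving orthogonally to the tight normals preserves the equalities, and finitely many strict
inequalities survive a small move. Hence `faceOf` has the expected direction space and its base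
point can be overshot. -/
theorem eventually_step (hx : x ∈ polyhedron m b)
    (hv : ∀ j ∈ tightAt m b x, ⟪v, m j⟫_ℝ = 0) :
    ∀ᶠ t : ℝ in nhdsWithin 0 (Set.Ioi 0), x + t • v ∈ polyhedron m b ∧
      tightAt m b (x + t • v) = tightAt m b x := by
  filter_upwards [eventually_slack hx v] with t ht
  have h1 : ∀ j ∈ tightAt m b x, ⟪x + t • v, m j⟫_ℝ = b j := fun j hj => by
    rw [inner_add_left, real_inner_smul_left, hv j hj, mul_zero, add_zero]
    exact hj
  refine ⟨fun j => ?_, Set.Subset.antisymm (fun j hj => ?_) h1⟩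
  · by_cases hj : j ∈ tightAt m b x
    exacts [(h1 j hj).le, (ht j hj).le]
  · by_contra hj'
    exact (ht j hj').ne hj

theorem exists_step (hx : x ∈ polyhedron m b) (hv : ∀ j ∈ tightAt m b x, ⟪v, m j⟫_ℝ = 0) :
    ∃ t : ℝ, 0 < t ∧ x + t • v ∈ polyhedron m b ∧
      tightAt m b (x + t • v) = tightAt m b x := by
  obtain ⟨t, h1, h2⟩ := ((eventually_step hx hv).and self_mem_nhdsWithin).exists
  exact ⟨t, h2, h1⟩

/-- The exposing functional is the sum of the tight normals: its maximum forces equality in every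
tight inequality. -/
theorem isExposed_faceOf (hx : x ∈ polyhedron m b) :
    IsExposed ℝ (polyhedron m b) (faceOf m b x) := by
  intro _
  have := Fintype.ofFinite J
  set T : Finset J := Finset.univ.filter (· ∈ tightAt m b x) with hT
  have hval : ∀ y, innerSL ℝ (∑ j ∈ T, m j) y = ∑ j ∈ T, ⟪y, m j⟫_ℝ := fun y => by
    rw [innerSL_apply_apply, real_inner_comm, inner_sum]
  have hle : ∀ y ∈ polyhedron m b, ∑ j ∈ T, ⟪y, m j⟫_ℝ ≤ ∑ j ∈ T, b j := fun y hy =>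
    Finset.sum_le_sum fun j _ => hy j
  have hmem : ∀ {j}, j ∈ T ↔ j ∈ tightAt m b x := by simp [hT]
  refine ⟨innerSL ℝ (∑ j ∈ T, m j), Set.ext fun z => ⟨fun hz => ⟨hz.1, fun y hy => ?_⟩,
    fun hz => ⟨hz.1, fun j hj => ?_⟩⟩⟩
  · rw [hval, hval, Finset.sum_congr rfl fun j hj => hz.2 (hmem.1 hj)]
    exact hle y hy
  · have h1 := hz.2 x hx
    rw [hval, hval, Finset.sum_congr rfl fun j hj => hmem.1 hj] at h1
    have h2 := (Finset.sum_eq_sum_iff_of_le fun j (_ : j ∈ T) => hz.1 j).1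
      (le_antisymm (hle z hz.1) h1)
    exact h2 j (hmem.2 hj)

/-- A point x of B with the fewest tight inequalities is taken. Midpoints with other points of B
show that its tight inequalities hold with equality on all of B. Conversely, from y in its face one
can continue slightly beyond x inside the polyhedron, so the exposing functional cannot be smaller
at y than at x. -/
theorem exists_eq_faceOf {B : Set V} (hB : IsExposed ℝ (polyhedron m b) B) (hne : B.Nonempty) :
    ∃ x ∈ B, x ∈ polyhedron m b ∧ B = faceOf m b x := by
  have hconv := hB.convex (convex_polyhedron m b)
  obtain ⟨x, hxB, hmin⟩ : ∃ x ∈ B, ∀ y ∈ B, (tightAt m b x).ncard ≤ (tightAt m b y).ncard := by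
    have hne' : ((fun y => (tightAt m b y).ncard) '' B).Nonempty := hne.image _
    obtain ⟨x, hx, hx'⟩ := Nat.sInf_mem hne'
    exact ⟨x, hx, fun y hy => hx'.le.trans (Nat.sInf_le ⟨y, hy, rfl⟩)⟩
  have hxP := hB.subset hxB
  have hsub : ∀ y ∈ B, tightAt m b x ⊆ tightAt m b y := by
    intro y hy
    have hmid : (1 / 2 : ℝ) • x + (1 / 2 : ℝ) • y ∈ B :=
      hconv hxB hy (by norm_num) (by norm_num) (by norm_num)
    have hle : tightAt m b ((1 / 2 : ℝ) • x + (1 / 2 : ℝ) • y) ⊆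
        tightAt m b x ∩ tightAt m b y := by
      intro j hj
      have h1 := hxP j
      have h2 := hB.subset hy j
      have h3 : ⟪(1 / 2 : ℝ) • x + (1 / 2 : ℝ) • y, m j⟫_ℝ = b j := hj
      rw [inner_add_left, real_inner_smul_left, real_inner_smul_left] at h3
      refine ⟨?_, ?_⟩
      · show ⟪x, m j⟫_ℝ = b j
        linarith
      · show ⟪y, m j⟫_ℝ = b j
        linarith
    have h1 := Set.eq_of_subset_of_ncard_le (hle.trans Set.inter_subset_left) (hmin _ hmid)
      (Set.toFinite _)
    rw [← h1]
    exact hle.trans Set.inter_subset_right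
  refine ⟨x, hxB, hxP, Set.Subset.antisymm (fun y hy => ⟨hB.subset hy, hsub y hy⟩) ?_⟩
  intro y hy
  obtain ⟨l, hl⟩ := hB hne
  have hxB' := hxB
  rw [hl] at hxB' ⊢
  refine ⟨hy.1, fun z hz => (hxB'.2 z hz).trans ?_⟩
  obtain ⟨t, ht, hstep, -⟩ := exists_step (v := x - y) hxP fun j hj => by
    have h2 : ⟪x, m j⟫_ℝ = b j := hj
    have h3 : ⟪y, m j⟫_ℝ = b j := hy.2 hj
    rw [inner_sub_left, h2, h3, sub_self]
  have h1 := hxB'.2 _ hstep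
  rw [map_add, map_smul, map_sub, smul_eq_mul] at h1
  by_contra hlt
  push Not at hlt
  have := mul_pos ht (sub_pos.2 hlt)
  linarith

theorem mem_direction_faceOf (hx : x ∈ polyhedron m b) :
    v ∈ (affineSpan ℝ (faceOf m b x)).direction ↔ ∀ j ∈ tightAt m b x, ⟪v, m j⟫_ℝ = 0 := by
  rw [direction_affineSpan]
  constructor
  · intro hv j hj
    have hle : vectorSpan ℝ (faceOf m b x) ≤ LinearMap.ker (innerSL ℝ (m j)).toLinearMap := by
      rw [vectorSpan_def, Submodule.span_le]
      rintro _ ⟨y, hy, z, hz, rfl⟩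
      have h1 : ⟪y, m j⟫_ℝ = b j := hy.2 hj
      have h2 : ⟪z, m j⟫_ℝ = b j := hz.2 hj
      rw [SetLike.mem_coe, LinearMap.mem_ker]
      show ⟪m j, y - z⟫_ℝ = 0
      rw [real_inner_comm, inner_sub_left, h1, h2, sub_self]
    have h3 : ⟪m j, v⟫_ℝ = 0 := LinearMap.mem_ker.1 (hle hv)
    rwa [real_inner_comm]
  · intro hv
    obtain ⟨t, ht, hstep, htight⟩ := exists_step hx hv
    have h1 : (x + t • v) -ᵥ x ∈ vectorSpan ℝ (faceOf m b x) :=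
      vsub_mem_vectorSpan ℝ ⟨hstep, htight.ge⟩ (self_mem_faceOf hx)
    rw [vsub_eq_sub, add_sub_cancel_left] at h1
    exact (Submodule.smul_mem_iff _ ht.ne').1 h1

/-- Another point y of the face would put z strictly inside the segment from y to a point slightly
beyond z. -/
theorem faceOf_extreme (hz : z ∈ (polyhedron m b).extremePoints ℝ) : faceOf m b z = {z} := by
  refine Set.eq_singleton_iff_unique_mem.2 ⟨self_mem_faceOf hz.1, fun y hy => ?_⟩
  obtain ⟨t, ht, hstep, -⟩ := exists_step (v := z - y) hz.1 fun j hj => by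
    have h2 : ⟪z, m j⟫_ℝ = b j := hj
    have h3 : ⟪y, m j⟫_ℝ = b j := hy.2 hj
    rw [inner_sub_left, h2, h3, sub_self]
  refine hz.2 hy.1 hstep ?_
  have h1 : 0 < 1 + t := by linarith
  -- The weights solve z = a y + b (z + t(z - y)): a + b = 1 and a = b t.
  refine ⟨t / (1 + t), 1 / (1 + t), by positivity, by positivity, by field_simp; ring, ?_⟩
  have h2 : z = (t / (1 + t) + 1 / (1 + t)) • z := by
    rw [← add_div, add_comm t 1, div_self h1.ne', one_smul]
  have h3 : (1 / (1 + t)) * t = t / (1 + t) := by ring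
  conv_rhs => rw [h2]
  rw [smul_add, smul_smul, h3, smul_sub, add_smul]
  abel

end Polyhedron

/-! ### Reflection groups: exchange condition, dominant vectors and their stabilizers -/

section Reflections

variable {V : Type*} [NormedAddCommGroup V] [InnerProductSpace ℝ V] {Φ : Finset V}

theorem refl_apply (β x : V) : refl β x = x - (2 * ⟪β, x⟫_ℝ / ‖β‖ ^ 2) • β := by
  rw [refl, Submodule.reflection_orthogonal_apply, Submodule.reflection_singleton_apply]
  simp only [RCLike.ofReal_real_eq_id, id_eq]
  rw [neg_sub, two_smul, ← add_smul]
  congr 2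
  ring

theorem refl_mul_self (β : V) : refl β * refl β = 1 := by
  ext x
  exact (ℝ ∙ β)ᗮ.reflection_reflection x

theorem refl_conj (w : V ≃ₗᵢ[ℝ] V) (β : V) : w * refl β * w⁻¹ = refl (w β) := by
  ext x
  have h1 : w (w⁻¹ x) = x := w.apply_symm_apply x
  have h2 : ⟪β, w⁻¹ x⟫_ℝ = ⟪w β, x⟫_ℝ := by
    rw [← w.inner_map_map, h1]
  show w (refl β (w⁻¹ x)) = _
  rw [refl_apply, refl_apply, map_sub, map_smul, h1, h2, w.norm_map]

theorem refl_neg (β : V) : refl (-β) = refl β := by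
  ext x
  rw [refl_apply, refl_apply, inner_neg_left, norm_neg, smul_neg, ← neg_smul]
  congr 2
  ring

theorem refl_self {β : V} (hβ : β ≠ 0) : refl β β = -β := by
  rw [refl_apply, real_inner_self_eq_norm_sq]
  have : ‖β‖ ^ 2 ≠ 0 := by simpa using hβ
  rw [mul_div_assoc, div_self this, mul_one, two_smul]
  abel

theorem refl_of_inner_eq_zero {β x : V} (h : ⟪β, x⟫_ℝ = 0) : refl β x = x := by
  rw [refl_apply, h]
  simp

theorem inner_apply_inv (w : V ≃ₗᵢ[ℝ] V) (x y : V) : ⟪w x, y⟫_ℝ = ⟪x, w⁻¹ y⟫_ℝ := by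
  rw [← w.inner_map_map x]
  congr 1
  exact (w.apply_symm_apply y).symm

theorem inv_apply_self' (w : V ≃ₗᵢ[ℝ] V) (x : V) : w⁻¹ (w x) = x := w.symm_apply_apply x

theorem apply_inv_self' (w : V ≃ₗᵢ[ℝ] V) (x : V) : w (w⁻¹ x) = x := w.apply_symm_apply x

theorem parabolic_le (Φ : Finset V) (A : Submodule ℝ V) : parabolic Φ A ≤ coxeterGroup Φ :=
  Subgroup.closure_mono fun _ ⟨β, hβ, _, h⟩ => ⟨β, hβ, h⟩

theorem parabolic_mono (Φ : Finset V) {A B : Submodule ℝ V} (h : A ≤ B) :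
    parabolic Φ A ≤ parabolic Φ B :=
  Subgroup.closure_mono fun _ ⟨β, hβ, hβA, e⟩ => ⟨β, hβ, h hβA, e⟩

theorem refl_mem_parabolic {A : Submodule ℝ V} {β : V} (hβ : β ∈ Φ) (hβA : β ∈ A) :
    refl β ∈ parabolic Φ A :=
  Subgroup.subset_closure ⟨β, hβ, hβA, rfl⟩

theorem parabolic_top (Φ : Finset V) : parabolic Φ ⊤ = coxeterGroup Φ :=
  le_antisymm (parabolic_le Φ ⊤)
    (Subgroup.closure_mono fun _ ⟨β, hβ, e⟩ => ⟨β, hβ, Submodule.mem_top, e⟩)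

/-- `W_A` fixes the vectors orthogonal to `A`. -/
theorem apply_eq_self_of_mem_parabolic {A : Submodule ℝ V} {w : V ≃ₗᵢ[ℝ] V}
    (hw : w ∈ parabolic Φ A) {x : V} (hx : ∀ β ∈ A, ⟪β, x⟫_ℝ = 0) : w x = x := by
  induction hw using Subgroup.closure_induction with
  | mem g hg =>
    obtain ⟨β, -, hβ, rfl⟩ := hg
    exact refl_of_inner_eq_zero (hx β hβ)
  | one => rfl
  | mul g h _ _ h1 h2 =>
    show g (h x) = x
    rw [h2, h1]
  | inv g _ h1 =>
    conv_lhs => rw [← h1]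
    exact inv_apply_self' g x

/-- `W_A` moves vectors along `A`. -/
theorem apply_sub_self_mem_of_mem_parabolic {A : Submodule ℝ V} {w : V ≃ₗᵢ[ℝ] V}
    (hw : w ∈ parabolic Φ A) (x : V) : w x - x ∈ A := by
  induction hw using Subgroup.closure_induction generalizing x with
  | mem g hg =>
    obtain ⟨β, -, hβ, rfl⟩ := hg
    rw [refl_apply, sub_sub_cancel_left]
    exact A.neg_mem (A.smul_mem _ hβ)
  | one => simp
  | mul g h _ _ h1 h2 =>
    have := A.add_mem (h1 (h x)) (h2 x)
    rwa [sub_add_sub_cancel] at this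
  | inv g _ h1 =>
    have := A.neg_mem (h1 (g⁻¹ x))
    rwa [apply_inv_self', neg_sub] at this

namespace IsRootSystem

variable (hΦ : IsRootSystem Φ)
include hΦ

theorem ne_zero {β : V} (hβ : β ∈ Φ) : β ≠ 0 := fun h => hΦ.zero_notMem (h ▸ hβ)

theorem neg_mem {β : V} (hβ : β ∈ Φ) : -β ∈ Φ := by
  rw [← refl_self (hΦ.ne_zero hβ)]
  exact hΦ.refl_mem β hβ β hβ

theorem apply_mem {w : V ≃ₗᵢ[ℝ] V} (hw : w ∈ coxeterGroup Φ) {β : V} (hβ : β ∈ Φ) :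
    w β ∈ Φ := by
  induction hw using Subgroup.closure_induction generalizing β with
  | mem g hg =>
    obtain ⟨α, hα, rfl⟩ := hg
    exact hΦ.refl_mem α hα β hβ
  | one => exact hβ
  | mul g h _ _ h1 h2 => exact h1 (h2 hβ)
  | inv g _ h1 =>
    have hinj : Set.InjOn g Φ := g.injective.injOn
    have hmaps : Set.MapsTo g (Φ : Set V) Φ := fun γ hγ => h1 hγ
    -- An injective map of the finite set Φ into itself is onto, so the inverse also preserves Φ.
    obtain ⟨γ, hγ, hγβ⟩ := Finset.surj_on_of_inj_on_of_card_le (fun γ _ => g γ)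
      (fun γ hγ => h1 hγ) (fun _ _ _ _ h => g.injective h) le_rfl β hβ
    have : g⁻¹ β = γ := by rw [hγβ, inv_apply_self']
    rwa [this]

theorem finite_coxeterGroup : Finite (coxeterGroup Φ) := by
  let f : coxeterGroup Φ → (Φ → Φ) := fun w β => ⟨w.1 β, hΦ.apply_mem w.2 β.2⟩
  refine Finite.of_injective f fun w w' h => ?_
  apply Subtype.ext
  have h1 : (w.1.toLinearEquiv : V →ₗ[ℝ] V) = (w'.1.toLinearEquiv : V →ₗ[ℝ] V) := by
    refine LinearMap.ext_on hΦ.span_eq_top fun β hβ => ?_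
    exact congrArg Subtype.val (congrFun h ⟨β, hβ⟩)
  ext x
  exact LinearMap.congr_fun h1 x

end IsRootSystem

variable {n : ℕ} {Δ : Module.Basis (Fin n) ℝ V}

/-- `v` has nonnegative coordinates in the basis `Δ`. -/
def IsNonneg (Δ : Module.Basis (Fin n) ℝ V) (v : V) : Prop := ∀ i, 0 ≤ Δ.repr v i

/-- `x` lies in the closed fundamental chamber. -/
def IsDominant (Δ : Module.Basis (Fin n) ℝ V) (x : V) : Prop := ∀ i, 0 ≤ ⟪x, Δ i⟫_ℝ

theorem inner_eq_sum_repr (Δ : Module.Basis (Fin n) ℝ V) (x v : V) :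
    ⟪x, v⟫_ℝ = ∑ i, Δ.repr v i * ⟪x, Δ i⟫_ℝ := by
  conv_lhs => rw [← Δ.sum_repr v]
  rw [inner_sum]
  simp only [real_inner_smul_right]

theorem IsDominant.inner_nonneg {x v : V} (hx : IsDominant Δ x) (hv : IsNonneg Δ v) :
    0 ≤ ⟪x, v⟫_ℝ := by
  rw [inner_eq_sum_repr Δ]
  exact Finset.sum_nonneg fun i _ => mul_nonneg (hv i) (hx i)

theorem IsNonneg.eq_zero_of_neg {v : V} (h : IsNonneg Δ v) (h' : IsNonneg Δ (-v)) : v = 0 := by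
  refine Δ.ext_elem fun i => ?_
  have h1 := h i
  have h2 := h' i
  simp only [map_neg, Finsupp.coe_neg, Pi.neg_apply, map_zero, Finsupp.coe_zero,
    Pi.zero_apply] at h2 ⊢
  linarith

/-- The product of the simple reflections in a word. -/
def wordProd (Δ : Module.Basis (Fin n) ℝ V) (L : List (Fin n)) : V ≃ₗᵢ[ℝ] V :=
  (L.map fun i => refl (Δ i)).prod

theorem wordProd_nil : wordProd Δ [] = 1 := rfl

theorem wordProd_cons (i : Fin n) (L : List (Fin n)) :
    wordProd Δ (i :: L) = refl (Δ i) * wordProd Δ L := by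
  simp [wordProd]

theorem wordProd_append (L L' : List (Fin n)) :
    wordProd Δ (L ++ L') = wordProd Δ L * wordProd Δ L' := by
  simp [wordProd]

theorem wordProd_singleton (i : Fin n) : wordProd Δ [i] = refl (Δ i) := by
  simp [wordProd]

theorem wordProd_reverse (L : List (Fin n)) : wordProd Δ L.reverse = (wordProd Δ L)⁻¹ := by
  induction L with
  | nil => simp [wordProd_nil]
  | cons i L ih =>
    rw [List.reverse_cons, wordProd_append, wordProd_singleton, ih, wordProd_cons, mul_inv_rev]
    congr 1

section Simple

variable (hΦ : IsRootSystem Φ) (hΔ : IsSimpleSystem Φ Δ)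
include hΦ hΔ

theorem wordProd_mem (L : List (Fin n)) : wordProd Δ L ∈ coxeterGroup Φ := by
  refine Subgroup.list_prod_mem _ fun g hg => ?_
  obtain ⟨i, -, rfl⟩ := List.mem_map.1 hg
  exact Subgroup.subset_closure ⟨Δ i, hΔ.mem i, rfl⟩

theorem isNonneg_or_neg {β : V} (hβ : β ∈ Φ) : IsNonneg Δ β ∨ IsNonneg Δ (-β) := by
  rcases hΔ.sign β hβ with h | h
  · exact Or.inl h
  · refine Or.inr fun i => ?_
    simpa using h i

theorem norm_simple_sq_pos (i : Fin n) : 0 < ‖Δ i‖ ^ 2 := by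
  have := hΦ.ne_zero (hΔ.mem i)
  positivity

theorem repr_refl (i : Fin n) (v : V) (k : Fin n) (hk : k ≠ i) :
    Δ.repr (refl (Δ i) v) k = Δ.repr v k := by
  rw [refl_apply]
  simp [hk.symm]

/-- With a positive inner product, the root s_i(Δ j) would have coefficient 1 at j and a negative
one at i. -/
theorem inner_simple_nonpos {i j : Fin n} (hij : i ≠ j) : ⟪Δ i, Δ j⟫_ℝ ≤ 0 := by
  by_contra hpos
  push Not at hpos
  have h1 := hΦ.refl_mem _ (hΔ.mem i) _ (hΔ.mem j)
  have h2 := norm_simple_sq_pos hΦ hΔ i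
  have hj : Δ.repr (refl (Δ i) (Δ j)) j = 1 := by
    rw [repr_refl hΦ hΔ i _ j hij.symm]
    simp
  have hi : Δ.repr (refl (Δ i) (Δ j)) i < 0 := by
    rw [refl_apply]
    simp only [map_sub, map_smul, Module.Basis.repr_self, Finsupp.coe_sub, Finsupp.coe_smul,
      Pi.sub_apply, Pi.smul_apply, Finsupp.single_eq_same, smul_eq_mul, mul_one]
    rw [Finsupp.single_eq_of_ne hij, zero_sub, neg_lt_zero]
    positivity
  rcases hΔ.sign _ h1 with h | h
  · linarith [h i]
  · linarith [h j]

/-- A simple reflection permutes the positive roots other than its own. -/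
theorem isNonneg_refl {β : V} (hβ : β ∈ Φ) (hpos : IsNonneg Δ β) {i : Fin n} (hne : β ≠ Δ i) :
    IsNonneg Δ (refl (Δ i) β) := by
  -- By reducedness a positive root other than Δ i has a positive coordinate elsewhere. The
  -- reflection leaves that coordinate alone, and it decides the sign of the image.
  obtain ⟨k, hk, hkpos⟩ : ∃ k, k ≠ i ∧ 0 < Δ.repr β k := by
    by_contra hcon
    push Not at hcon
    have h0 : ∀ k, k ≠ i → Δ.repr β k = 0 := fun k hk => le_antisymm (hcon k hk) (hpos k)
    have h1 : β = Δ.repr β i • Δ i := by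
      conv_lhs => rw [← Δ.sum_repr β]
      refine Finset.sum_eq_single i (fun k _ hk => ?_) (fun h => absurd (Finset.mem_univ i) h)
      rw [h0 k hk, zero_smul]
    rcases hΦ.reduced _ (hΔ.mem i) (Δ.repr β i) (h1 ▸ hβ) with h | h
    · rw [h, one_smul] at h1
      exact hne h1
    · have := hpos i
      rw [h] at this
      linarith
  rcases hΔ.sign _ (hΦ.refl_mem _ (hΔ.mem i) β hβ) with h | h
  · exact h
  · have h1 := h k
    rw [repr_refl hΦ hΔ i β k hk] at h1
    linarith

theorem isNonneg_simple (i : Fin n) : IsNonneg Δ (Δ i) := fun k => by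
  rw [Module.Basis.repr_self]
  by_cases h : k = i
  · subst h; simp
  · rw [Finsupp.single_eq_of_ne h]

theorem not_isNonneg_neg_simple (i : Fin n) : ¬ IsNonneg Δ (-Δ i) := fun h =>
  hΦ.ne_zero (hΔ.mem i) (IsNonneg.eq_zero_of_neg (isNonneg_simple hΦ hΔ i) h)

/-- The exchange condition. -/
theorem exchange (L : List (Fin n)) (i : Fin n) (h : ¬ IsNonneg Δ (wordProd Δ L (Δ i))) :
    ∃ L' : List (Fin n), L'.length + 1 = L.length ∧
      wordProd Δ L' = wordProd Δ L * refl (Δ i) := by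
  induction L with
  | nil => exact absurd (isNonneg_simple hΦ hΔ i) h
  | cons j L ih =>
    by_cases hL : IsNonneg Δ (wordProd Δ L (Δ i))
    · have hmem := hΦ.apply_mem (wordProd_mem hΦ hΔ L) (hΔ.mem i)
      -- At the letter j where the root turns negative it must equal Δ j; conjugation then shows
      -- that deleting this letter has the effect of multiplying by s_i on the right.
      have heq : wordProd Δ L (Δ i) = Δ j := by
        by_contra hne
        refine h ?_
        rw [wordProd_cons]
        exact isNonneg_refl hΦ hΔ hmem hL hne
      refine ⟨L, rfl, ?_⟩
      rw [wordProd_cons, ← heq, ← refl_conj, mul_assoc, mul_assoc, mul_assoc,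
        inv_mul_cancel_left, refl_mul_self, mul_one]
    · obtain ⟨L', h1, h2⟩ := ih hL
      refine ⟨j :: L', by simp [h1], ?_⟩
      rw [wordProd_cons, h2, wordProd_cons, mul_assoc]

/-- A positive root of least height among those reached from β has a positive inner product with
some Δ i; unless it is Δ i, the reflection s_i keeps it positive and lowers its height. -/
theorem exists_wordProd_simple {β : V} (hβ : β ∈ Φ) (hpos : IsNonneg Δ β) :
    ∃ L i, β = wordProd Δ L (Δ i) := by
  classical
  obtain ⟨γ, hγ, hmin⟩ := Finset.exists_min_image
    (Φ.filter fun γ => IsNonneg Δ γ ∧ ∃ L, γ = wordProd Δ L β) (fun γ => ∑ k, Δ.repr γ k)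
    ⟨β, Finset.mem_filter.2 ⟨hβ, hpos, [], rfl⟩⟩
  obtain ⟨hγΦ, hγpos, L, hL⟩ := Finset.mem_filter.1 hγ
  obtain ⟨i, hi⟩ : ∃ i, 0 < ⟪γ, Δ i⟫_ℝ := by
    by_contra hcon
    push Not at hcon
    have h1 : ⟪γ, γ⟫_ℝ ≤ 0 := by
      rw [inner_eq_sum_repr Δ]
      exact Finset.sum_nonpos fun k _ => mul_nonpos_of_nonneg_of_nonpos (hγpos k) (hcon k)
    rw [real_inner_self_eq_norm_sq] at h1
    have := hΦ.ne_zero hγΦ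
    have : 0 < ‖γ‖ ^ 2 := by positivity
    linarith
  by_cases hγi : γ = Δ i
  · refine ⟨L.reverse, i, ?_⟩
    rw [wordProd_reverse, ← hγi, hL, inv_apply_self']
  · exfalso
    have h1 := hmin (refl (Δ i) γ) (Finset.mem_filter.2
      ⟨hΦ.refl_mem _ (hΔ.mem i) _ hγΦ, isNonneg_refl hΦ hΔ hγΦ hγpos hγi, i :: L, by
        rw [wordProd_cons, hL]; rfl⟩)
    have h2 : ∑ k, Δ.repr (refl (Δ i) γ) k =
        ∑ k, Δ.repr γ k - 2 * ⟪Δ i, γ⟫_ℝ / ‖Δ i‖ ^ 2 := by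
      rw [refl_apply]
      simp [Finset.sum_sub_distrib, Finsupp.single_apply]
    have h3 := norm_simple_sq_pos hΦ hΔ i
    rw [real_inner_comm] at hi
    have h4 : 0 < 2 * ⟪Δ i, γ⟫_ℝ / ‖Δ i‖ ^ 2 := by positivity
    linarith

theorem exists_word {w : V ≃ₗᵢ[ℝ] V} (hw : w ∈ coxeterGroup Φ) : ∃ L, w = wordProd Δ L := by
  induction hw using Subgroup.closure_induction with
  | mem g hg =>
    obtain ⟨β, hβ, rfl⟩ := hg
    have key : ∀ {β : V}, β ∈ Φ → IsNonneg Δ β → ∃ L, refl β = wordProd Δ L := by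
      intro β hβ hpos
      obtain ⟨L, i, rfl⟩ := exists_wordProd_simple hΦ hΔ hβ hpos
      refine ⟨L ++ [i] ++ L.reverse, ?_⟩
      rw [wordProd_append, wordProd_append, wordProd_singleton, wordProd_reverse, refl_conj]
    rcases isNonneg_or_neg hΦ hΔ hβ with h | h
    · exact key hβ h
    · rw [← refl_neg]
      exact key (hΦ.neg_mem hβ) h
  | one => exact ⟨[], rfl⟩
  | mul g h _ _ h1 h2 =>
    obtain ⟨L, rfl⟩ := h1
    obtain ⟨L', rfl⟩ := h2
    exact ⟨L ++ L', (wordProd_append L L').symm⟩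
  | inv g _ h1 =>
    obtain ⟨L, rfl⟩ := h1
    exact ⟨L.reverse, (wordProd_reverse L).symm⟩

/-- Induction on the length of a word w₀ s_i. If w₀(Δ i) is positive, the last letter adds a
nonnegative multiple of it to ω - w₀ω; otherwise the exchange condition gives a shorter word. -/
theorem isNonneg_sub_apply {w : V ≃ₗᵢ[ℝ] V} (hw : w ∈ coxeterGroup Φ) {ω : V}
    (hω : IsDominant Δ ω) : IsNonneg Δ (ω - w ω) := by
  obtain ⟨L, rfl⟩ := exists_word hΦ hΔ hw
  clear hw
  induction hk : L.length using Nat.strong_induction_on generalizing L with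
  | _ k ih =>
    rcases L.eq_nil_or_concat with rfl | ⟨L₀, i, rfl⟩
    · intro j
      simp [wordProd_nil]
    · rw [List.concat_eq_append] at hk ⊢
      rw [List.length_append, List.length_singleton] at hk
      rw [wordProd_append, wordProd_singleton]
      by_cases hpos : IsNonneg Δ (wordProd Δ L₀ (Δ i))
      · have h1 := ih L₀.length (by omega) L₀ rfl
        have h2 : 0 ≤ 2 * ⟪Δ i, ω⟫_ℝ / ‖Δ i‖ ^ 2 := by
          have := hω i
          rw [real_inner_comm] at this
          positivity
        have h3 : ω - (wordProd Δ L₀ * refl (Δ i)) ω = (ω - wordProd Δ L₀ ω) +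
            (2 * ⟪Δ i, ω⟫_ℝ / ‖Δ i‖ ^ 2) • wordProd Δ L₀ (Δ i) := by
          show ω - wordProd Δ L₀ (refl (Δ i) ω) = _
          rw [refl_apply, map_sub, map_smul]
          abel
        rw [h3]
        intro j
        simp only [map_add, map_smul, Finsupp.coe_add, Finsupp.coe_smul, Pi.add_apply,
          Pi.smul_apply, smul_eq_mul]
        exact add_nonneg (h1 j) (mul_nonneg h2 (hpos j))
      · obtain ⟨L', h1, h2⟩ := exchange hΦ hΔ L₀ i hpos
        rw [← h2]
        exact ih L'.length (by omega) L' rfl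

theorem inner_apply_le {w : V ≃ₗᵢ[ℝ] V} (hw : w ∈ coxeterGroup Φ) {x ω : V}
    (hx : IsDominant Δ x) (hω : IsDominant Δ ω) : ⟪x, w ω⟫_ℝ ≤ ⟪x, ω⟫_ℝ := by
  have := hx.inner_nonneg (isNonneg_sub_apply hΦ hΔ hw hω)
  rw [inner_sub_right] at this
  linarith

/-- Equality in `⟪x, w ω⟫ ≤ ⟪x, ω⟫`. -/
theorem apply_eq_of_inner_eq {w : V ≃ₗᵢ[ℝ] V} (hw : w ∈ coxeterGroup Φ) {x ω : V}
    (hx : IsDominant Δ x) (hω : IsDominant Δ ω) (h0 : ∀ i, ⟪x, Δ i⟫_ℝ = 0 → ⟪ω, Δ i⟫_ℝ = 0)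
    (heq : ⟪x, w ω⟫_ℝ = ⟪x, ω⟫_ℝ) : w ω = ω := by
  set κ := ω - w ω with hκ
  have hnn := isNonneg_sub_apply hΦ hΔ hw hω
  have h1 : ⟪x, κ⟫_ℝ = 0 := by rw [hκ, inner_sub_right, heq, sub_self]
  rw [inner_eq_sum_repr Δ, Finset.sum_eq_zero_iff_of_nonneg fun i _ =>
    mul_nonneg (hnn i) (hx i)] at h1
  -- κ is supported on simple roots orthogonal to x, hence to ω. Then ω - κ = wω has the norm of ω
  -- and κ is orthogonal to ω, so κ = 0.
  have h2 : ⟪ω, κ⟫_ℝ = 0 := by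
    rw [inner_eq_sum_repr Δ]
    refine Finset.sum_eq_zero fun i hi => ?_
    rcases mul_eq_zero.1 (h1 i hi) with h | h
    · rw [h, zero_mul]
    · rw [h0 i h, mul_zero]
  have h3 : ‖ω - κ‖ ^ 2 = ‖ω‖ ^ 2 := by
    rw [hκ, sub_sub_cancel, w.norm_map]
  rw [norm_sub_sq_real, h2] at h3
  have h4 : κ = 0 := by
    have : ‖κ‖ ^ 2 = 0 := by linarith
    simpa using this
  rw [hκ, sub_eq_zero] at h4
  exact h4.symm

/-- In a nonempty word w₀ s_i for w, positivity of w(Δ i) = -w₀(Δ i) makes w₀(Δ i) negative, so the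
exchange condition shortens the word. -/
theorem eq_one_of_isNonneg {w : V ≃ₗᵢ[ℝ] V} (hw : w ∈ coxeterGroup Φ)
    (h : ∀ i, IsNonneg Δ (w (Δ i))) : w = 1 := by
  obtain ⟨L, rfl⟩ := exists_word hΦ hΔ hw
  clear hw
  induction hk : L.length using Nat.strong_induction_on generalizing L with
  | _ k ih =>
    rcases L.eq_nil_or_concat with rfl | ⟨L₀, i, rfl⟩
    · rfl
    · rw [List.concat_eq_append] at hk h ⊢
      rw [List.length_append, List.length_singleton] at hk
      have h1 := h i
      rw [wordProd_append, wordProd_singleton] at h1 ⊢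
      have h2 : (wordProd Δ L₀ * refl (Δ i)) (Δ i) = -wordProd Δ L₀ (Δ i) := by
        show wordProd Δ L₀ (refl (Δ i) (Δ i)) = _
        rw [refl_self (hΦ.ne_zero (hΔ.mem i)), map_neg]
      rw [h2] at h1
      have h3 : ¬ IsNonneg Δ (wordProd Δ L₀ (Δ i)) := fun h3 => by
        have h4 := IsNonneg.eq_zero_of_neg h3 h1
        rw [map_eq_zero_iff _ (wordProd Δ L₀).injective] at h4
        exact hΦ.ne_zero (hΔ.mem i) h4
      obtain ⟨L', h4, h5⟩ := exchange hΦ hΔ L₀ i h3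
      rw [← h5]
      refine ih L'.length (by omega) L' (fun j => ?_) rfl
      rw [h5]
      simpa [wordProd_append, wordProd_singleton] using h j

theorem isNonneg_of_inner_pos {ω β : V} (hω : IsDominant Δ ω) (hβ : β ∈ Φ)
    (h : 0 < ⟪ω, β⟫_ℝ) : IsNonneg Δ β := by
  rcases isNonneg_or_neg hΦ hΔ hβ with h1 | h1
  · exact h1
  · have := hω.inner_nonneg h1
    rw [inner_neg_right] at this
    linarith

theorem eq_one_of_apply_eq_self {w : V ≃ₗᵢ[ℝ] V} (hw : w ∈ coxeterGroup Φ) {x : V}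
    (hx : ∀ i, 0 < ⟪x, Δ i⟫_ℝ) (h : w x = x) : w = 1 := by
  refine eq_one_of_isNonneg hΦ hΔ hw fun i => ?_
  refine isNonneg_of_inner_pos hΦ hΔ (ω := x) (fun j => (hx j).le)
    (hΦ.apply_mem hw (hΔ.mem i)) ?_
  rw [← h, w.inner_map_map]
  exact hx i

/-- s_i permutes the positive roots other than Δ i and negates Δ i. -/
theorem refl_delta (i : Fin n) : refl (Δ i) (delta Φ Δ) = delta Φ Δ - Δ i := by
  classical
  have hi : Δ i ∈ Φ.filter fun β => ∀ k, 0 ≤ Δ.repr β k :=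
    Finset.mem_filter.2 ⟨hΔ.mem i, isNonneg_simple hΦ hΔ i⟩
  have hsum : refl (Δ i) (∑ β ∈ (Φ.filter fun β => ∀ k, 0 ≤ Δ.repr β k).erase (Δ i), β) =
      ∑ β ∈ (Φ.filter fun β => ∀ k, 0 ≤ Δ.repr β k).erase (Δ i), β := by
    rw [map_sum]
    have hinv : ∀ β : V, refl (Δ i) (refl (Δ i) β) = β := fun β =>
      Submodule.reflection_reflection _ β
    have hmaps : ∀ β ∈ (Φ.filter fun β => ∀ k, 0 ≤ Δ.repr β k).erase (Δ i),
        refl (Δ i) β ∈ (Φ.filter fun β => ∀ k, 0 ≤ Δ.repr β k).erase (Δ i) := by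
      intro β hβ
      rw [Finset.mem_erase, Finset.mem_filter] at hβ ⊢
      refine ⟨fun h => ?_, hΦ.refl_mem _ (hΔ.mem i) _ hβ.2.1,
        isNonneg_refl hΦ hΔ hβ.2.1 hβ.2.2 hβ.1⟩
      have h1 : β = -Δ i := by rw [← hinv β, h, refl_self (hΦ.ne_zero (hΔ.mem i))]
      exact not_isNonneg_neg_simple hΦ hΔ i (h1 ▸ hβ.2.2)
    exact Finset.sum_nbij' (fun β => refl (Δ i) β) (fun β => refl (Δ i) β) hmaps hmaps
      (fun β _ => hinv β) (fun β _ => hinv β) fun _ _ => rfl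
  have hd : delta Φ Δ = (1 / 2 : ℝ) • (Δ i +
      ∑ β ∈ (Φ.filter fun β => ∀ k, 0 ≤ Δ.repr β k).erase (Δ i), β) := by
    rw [Finset.add_sum_erase _ (fun β => β) hi]
    unfold delta
    congr!
  rw [hd, map_smul, map_add, hsum, refl_self (hΦ.ne_zero (hΔ.mem i))]
  module

theorem inner_delta_simple (i : Fin n) : ⟪delta Φ Δ, Δ i⟫_ℝ = ‖Δ i‖ ^ 2 / 2 := by
  have h1 := refl_delta hΦ hΔ i
  have h2 := norm_simple_sq_pos hΦ hΔ i
  rw [refl_apply, sub_right_inj] at h1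
  have h3 : (2 * ⟪Δ i, delta Φ Δ⟫_ℝ / ‖Δ i‖ ^ 2 - 1) • Δ i = 0 := by
    rw [sub_smul, h1, one_smul, sub_self]
  have h4 := (smul_eq_zero.1 h3).resolve_right (hΦ.ne_zero (hΔ.mem i))
  rw [real_inner_comm]
  rw [sub_eq_zero, div_eq_one_iff_eq h2.ne'] at h4
  linarith

theorem inner_delta_simple_pos (i : Fin n) : 0 < ⟪delta Φ Δ, Δ i⟫_ℝ := by
  rw [inner_delta_simple hΦ hΔ]
  have := norm_simple_sq_pos hΦ hΔ i
  positivity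

/-- Every vector can be moved by `H` into the half-spaces of the simple reflections of `H`. -/
theorem exists_apply_dominant (H : Subgroup (V ≃ₗᵢ[ℝ] V)) (hH : H ≤ coxeterGroup Φ) (x : V) :
    ∃ w ∈ H, ∀ i, refl (Δ i) ∈ H → 0 ≤ ⟪w x, Δ i⟫_ℝ := by
  have := hΦ.finite_coxeterGroup
  have hfin : Finite H := Finite.of_injective _ (Subgroup.inclusion_injective hH)
  -- The best translate maximizes the pairing with δ; a further s_i ∈ H changes the pairing by -⟪w
  -- x, Δ i⟫.
  obtain ⟨w, hw⟩ := Finite.exists_max fun w : H => ⟪w.1 x, delta Φ Δ⟫_ℝ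
  refine ⟨w.1, w.2, fun i hi => ?_⟩
  have h1 := hw ⟨refl (Δ i) * w.1, H.mul_mem hi w.2⟩
  have h2 : ⟪(refl (Δ i) * w.1) x, delta Φ Δ⟫_ℝ =
      ⟪w.1 x, delta Φ Δ⟫_ℝ - ⟪w.1 x, Δ i⟫_ℝ := by
    show ⟪refl (Δ i) (w.1 x), delta Φ Δ⟫_ℝ = _
    have h3 : (refl (Δ i))⁻¹ = refl (Δ i) := inv_eq_of_mul_eq_one_left (refl_mul_self _)
    rw [inner_apply_inv, h3, refl_delta hΦ hΔ, inner_sub_right]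
  dsimp only at h1
  rw [h2] at h1
  linarith

theorem exists_dominant (x : V) : ∃ w ∈ coxeterGroup Φ, IsDominant Δ (w x) := by
  obtain ⟨w, hw, h⟩ := exists_apply_dominant hΦ hΔ (coxeterGroup Φ) le_rfl x
  exact ⟨w, hw, fun i => h i (Subgroup.subset_closure ⟨Δ i, hΔ.mem i, rfl⟩)⟩

/-- The stabilizer of a dominant vector is generated by reflections in simple roots. -/
theorem mem_parabolic_of_apply_eq_self {w : V ≃ₗᵢ[ℝ] V} (hw : w ∈ coxeterGroup Φ) {ω : V}
    (hω : IsDominant Δ ω) (h : w ω = ω) :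
    w ∈ parabolic Φ (Submodule.span ℝ (Δ '' {i | ⟪ω, Δ i⟫_ℝ = 0})) := by
  set A := Submodule.span ℝ (Δ '' {i | ⟪ω, Δ i⟫_ℝ = 0}) with hA
  obtain ⟨g, hg, hdom⟩ := exists_apply_dominant hΦ hΔ (parabolic Φ A) (parabolic_le Φ A)
    (w (delta Φ Δ))
  have hgW := parabolic_le Φ A hg
  have hgω : g ω = ω := by
    refine apply_eq_self_of_mem_parabolic hg fun β hβ => ?_
    have hle : A ≤ LinearMap.ker (innerSL ℝ ω).toLinearMap := by
      rw [hA, Submodule.span_le]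
      rintro _ ⟨i, hi, rfl⟩
      exact LinearMap.mem_ker.2 hi
    rw [real_inner_comm]
    exact LinearMap.mem_ker.1 (hle hβ)
  set τ := g * w with hτ
  have hτW : τ ∈ coxeterGroup Φ := Subgroup.mul_mem _ hgW hw
  have hτω : τ ω = ω := by
    show g (w ω) = ω
    rw [h, hgω]
  have hδ : IsDominant Δ (delta Φ Δ) := fun i => (inner_delta_simple_pos hΦ hΔ i).le
  -- For simple roots orthogonal to ω this is the choice of g; for the others, τ⁻¹(Δ i) pairs
  -- positively with ω and is therefore a positive root. Then δ - τδ and τδ - δ are both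
  -- nonnegative, so τ fixes δ and is the identity.
  have hτδ : IsDominant Δ (τ (delta Φ Δ)) := by
    intro i
    by_cases hi : ⟪ω, Δ i⟫_ℝ = 0
    · exact hdom i (refl_mem_parabolic (hΔ.mem i) (Submodule.subset_span ⟨i, hi, rfl⟩))
    · rw [inner_apply_inv]
      refine hδ.inner_nonneg (isNonneg_of_inner_pos hΦ hΔ hω
        (hΦ.apply_mem (Subgroup.inv_mem _ hτW) (hΔ.mem i)) ?_)
      rw [← inner_apply_inv, hτω]
      exact lt_of_le_of_ne (hω i) (Ne.symm hi)
  have h1 := isNonneg_sub_apply hΦ hΔ hτW hδ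
  have h2 := isNonneg_sub_apply hΦ hΔ (Subgroup.inv_mem _ hτW) hτδ
  rw [inv_apply_self'] at h2
  have h3 := IsNonneg.eq_zero_of_neg h1 (by rwa [neg_sub])
  have h4 := eq_one_of_apply_eq_self hΦ hΔ hτW (inner_delta_simple_pos hΦ hΔ)
    (sub_eq_zero.1 h3).symm
  have h5 : w = g⁻¹ := by
    rw [hτ] at h4
    exact eq_inv_of_mul_eq_one_right h4
  rw [h5]
  exact Subgroup.inv_mem _ hg

end Simple

end Reflections

/-! ### From subspaces spanned by simple roots to index sets -/

section Bridge

variable {V : Type*} [NormedAddCommGroup V] [InnerProductSpace ℝ V] {Φ : Finset V}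
  {n : ℕ} {Δ : Module.Basis (Fin n) ℝ V} {G : Set (Submodule ℝ V)} {ε : ℕ → ℝ}
  {I J K A B D : Finset (Fin n)}

/-- The span of the simple roots with index in `I`. -/
def simpleSpan (Δ : Module.Basis (Fin n) ℝ V) (I : Finset (Fin n)) : Submodule ℝ V :=
  Submodule.span ℝ (Δ '' (I : Set (Fin n)))

theorem mem_simpleSpan {v : V} : v ∈ simpleSpan Δ I ↔ ∀ i, i ∉ I → Δ.repr v i = 0 := by
  rw [simpleSpan, Module.Basis.mem_span_image]
  constructor
  · intro h i hi
    by_contra h0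
    exact hi (h (Finsupp.mem_support_iff.2 h0))
  · intro h i hi
    by_contra h0
    exact Finsupp.mem_support_iff.1 hi (h i h0)

theorem simple_mem_simpleSpan {i : Fin n} : Δ i ∈ simpleSpan Δ I ↔ i ∈ I := by
  rw [simpleSpan, Module.Basis.self_mem_span_image, Finset.mem_coe]

theorem simpleSpan_le_iff {C : Submodule ℝ V} : simpleSpan Δ I ≤ C ↔ ∀ i ∈ I, Δ i ∈ C := by
  rw [simpleSpan, Submodule.span_le, Set.image_subset_iff]
  rfl

theorem simpleSpan_le_simpleSpan : simpleSpan Δ I ≤ simpleSpan Δ J ↔ I ⊆ J := by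
  rw [simpleSpan_le_iff]
  simp only [simple_mem_simpleSpan]
  rfl

theorem simpleSpan_injective : Function.Injective (simpleSpan Δ) := fun _ _ h =>
  Finset.Subset.antisymm (simpleSpan_le_simpleSpan.1 h.le) (simpleSpan_le_simpleSpan.1 h.ge)

theorem simpleSpan_univ : simpleSpan Δ Finset.univ = ⊤ := by
  rw [simpleSpan, Finset.coe_univ, Set.image_univ, Δ.span_eq]

theorem simpleSpan_empty : simpleSpan Δ ∅ = ⊥ := by
  simp [simpleSpan]

theorem simpleSpan_eq_top : simpleSpan Δ I = ⊤ ↔ I = Finset.univ := by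
  rw [← simpleSpan_univ (Δ := Δ), simpleSpan_injective.eq_iff]

theorem simpleSpan_singleton (i : Fin n) : simpleSpan Δ {i} = ℝ ∙ Δ i := by
  simp [simpleSpan]

theorem simpleSpan_union : simpleSpan Δ (I ∪ J) = simpleSpan Δ I ⊔ simpleSpan Δ J := by
  rw [simpleSpan, Finset.coe_union, Set.image_union, Submodule.span_union]
  rfl

theorem simpleSpan_biUnion (T : Finset (Finset (Fin n))) :
    simpleSpan Δ (T.biUnion id) = sSup (simpleSpan Δ '' (T : Set (Finset (Fin n)))) := by
  refine le_antisymm (simpleSpan_le_iff.2 fun i hi => ?_) (sSup_le ?_)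
  · obtain ⟨A, hA, hiA⟩ := Finset.mem_biUnion.1 hi
    exact le_sSup (Set.mem_image_of_mem (simpleSpan Δ) (Finset.mem_coe.2 hA))
      (simple_mem_simpleSpan.2 hiA)
  · rintro _ ⟨A, hA, rfl⟩
    exact simpleSpan_le_simpleSpan.2 (Finset.subset_biUnion_of_mem id hA)

theorem finrank_simpleSpan : Module.finrank ℝ (simpleSpan Δ I) = I.card := by
  have h := finrank_span_finset_eq_card (R := ℝ) (M := V) (s := I.map ⟨Δ, Δ.injective⟩) (by
    refine (Δ.linearIndependent.linearIndepOn_id).mono ?_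
    simp)
  rw [Finset.card_map, Finset.coe_map] at h
  exact h

/-- The index sets of the elements of `G_fund`. -/
def indexFamily (Δ : Module.Basis (Fin n) ℝ V) (G : Set (Submodule ℝ V)) :
    Set (Finset (Fin n)) :=
  {I | simpleSpan Δ I ∈ G}

theorem mem_fund_iff {C : Submodule ℝ V} :
    C ∈ fund Δ G ↔ ∃ I ∈ indexFamily Δ G, C = simpleSpan Δ I := by
  classical
  constructor
  · rintro ⟨hC, I, rfl⟩
    have : I.toFinset = I.toFinset := rfl
    refine ⟨I.toFinset, ?_, ?_⟩
    · show Submodule.span ℝ _ ∈ G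
      rwa [Set.coe_toFinset]
    · rw [simpleSpan, Set.coe_toFinset]
  · rintro ⟨I, hI, rfl⟩
    exact ⟨hI, I, rfl⟩

theorem simpleSpan_mem_fund_iff : simpleSpan Δ I ∈ fund Δ G ↔ I ∈ indexFamily Δ G :=
  ⟨fun h => h.1, fun h => ⟨h, I, rfl⟩⟩

theorem maxIn_fund : maxIn (fund Δ G) (simpleSpan Δ I) =
    simpleSpan Δ '' (comps (indexFamily Δ G) I : Set (Finset (Fin n))) := by
  ext C
  constructor
  · intro hC
    have hC' : Maximal (fun A => A ∈ fund Δ G ∧ A ≤ simpleSpan Δ I) C := hC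
    obtain ⟨A, hA, rfl⟩ := mem_fund_iff.1 hC'.prop.1
    refine ⟨A, mem_comps.2 ⟨⟨hA, simpleSpan_le_simpleSpan.1 hC'.prop.2⟩, fun B hB hAB => ?_⟩, rfl⟩
    exact simpleSpan_le_simpleSpan.1 (hC'.2 ⟨simpleSpan_mem_fund_iff.2 hB.1,
      simpleSpan_le_simpleSpan.2 hB.2⟩ (simpleSpan_le_simpleSpan.2 hAB))
  · rintro ⟨A, hA, rfl⟩
    refine ⟨⟨simpleSpan_mem_fund_iff.2 (mem_of_mem_comps hA),
      simpleSpan_le_simpleSpan.2 (subset_of_mem_comps hA)⟩, fun C hC hAC => ?_⟩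
    obtain ⟨B, hB, rfl⟩ := mem_fund_iff.1 hC.1
    rw [eq_of_mem_comps_of_subset hA hB (simpleSpan_le_simpleSpan.1 hC.2)
      (simpleSpan_le_simpleSpan.1 hAC)]

section Systems

variable (hΦ : IsRootSystem Φ) (hΔ : IsSimpleSystem Φ Δ) (hG : IsBuildingSet Φ G)
include hΦ hΔ

theorem simpleSpan_mem_rootSpaces (hI : I.Nonempty) : simpleSpan Δ I ∈ rootSpaces Φ := by
  refine ⟨Δ '' I, ?_, hI.to_set.image _, rfl⟩
  rintro _ ⟨i, -, rfl⟩
  exact hΔ.mem i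

theorem simpleSpan_mem_rootSpaces_iff : simpleSpan Δ I ∈ rootSpaces Φ ↔ I.Nonempty := by
  refine ⟨fun ⟨T, hT, ⟨β, hβ⟩, h⟩ => ?_, simpleSpan_mem_rootSpaces hΦ hΔ⟩
  by_contra hI
  rw [Finset.not_nonempty_iff_eq_empty] at hI
  rw [hI, simpleSpan_empty] at h
  have : β ∈ (⊥ : Submodule ℝ V) := h ▸ Submodule.subset_span hβ
  exact hΦ.ne_zero (hT hβ) ((Submodule.mem_bot ℝ).1 this)

variable [FiniteDimensional ℝ V]
include hG

theorem exists_le_mem_maxIn {A C : Submodule ℝ V} (hA : A ∈ G) (hAC : A ≤ C) :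
    ∃ M ∈ maxIn G C, A ≤ M := by
  obtain ⟨M, hM, hmax⟩ := (wellFounded_gt (α := Submodule ℝ V)).has_min
    {B | (B ∈ G ∧ B ≤ C) ∧ A ≤ B} ⟨A, ⟨hA, hAC⟩, le_rfl⟩
  refine ⟨M, ⟨hM.1, fun B hB hMB => ?_⟩, hM.2⟩
  by_contra hlt
  exact hmax B ⟨hB, hM.2.trans hMB⟩ (lt_of_le_not_ge hMB hlt)

theorem exists_mem_maxIn {β : V} {C : Submodule ℝ V} (hβ : β ∈ Φ) (hβC : β ∈ C) :
    ∃ M ∈ maxIn G C, β ∈ M := by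
  obtain ⟨M, hM, h⟩ := exists_le_mem_maxIn hΦ hΔ hG (hG.line_mem β hβ)
    ((Submodule.span_singleton_le_iff_mem β C).2 hβC)
  exact ⟨M, hM, (Submodule.span_singleton_le_iff_mem β M).1 h⟩

theorem eq_of_mem_maxIn {C M M' : Submodule ℝ V} (hC : C ∈ rootSpaces Φ) (hM : M ∈ maxIn G C)
    (hM' : M' ∈ maxIn G C) {v : V} (hv : v ≠ 0) (hvM : v ∈ M) (hvM' : v ∈ M') : M = M' := by
  by_contra hne
  have h1 : M' ≤ sSup (maxIn G C \ {M}) := le_sSup ⟨hM', fun h => hne h.symm⟩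
  exact hv (Submodule.disjoint_def.1 (hG.indep_maxIn C hC hM) v hvM (h1 hvM'))

/-- If A and B share i, the maximal elements of G in the span of A ∪ B above each of them share Δ i.
By independence they coincide, so the whole span is in G. -/
theorem isBuildingFamily : IsBuildingFamily (indexFamily Δ G) := by
  refine ⟨fun A hA => ?_, fun i => ?_, fun A hA B hB hAB => ?_⟩
  · exact (simpleSpan_mem_rootSpaces_iff hΦ hΔ).1 (hG.subset hA)
  · show simpleSpan Δ {i} ∈ G
    rw [simpleSpan_singleton]
    exact hG.line_mem _ (hΔ.mem i)
  · obtain ⟨i, hi⟩ := hAB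
    have hi' := Finset.mem_inter.1 hi
    have hC : simpleSpan Δ (A ∪ B) ∈ rootSpaces Φ :=
      simpleSpan_mem_rootSpaces hΦ hΔ ⟨i, Finset.mem_union_left _ hi'.1⟩
    obtain ⟨M, hM, hAM⟩ := exists_le_mem_maxIn hΦ hΔ hG (C := simpleSpan Δ (A ∪ B)) hA
      (simpleSpan_le_simpleSpan.2 Finset.subset_union_left)
    obtain ⟨M', hM', hBM⟩ := exists_le_mem_maxIn hΦ hΔ hG (C := simpleSpan Δ (A ∪ B)) hB
      (simpleSpan_le_simpleSpan.2 Finset.subset_union_right)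
    have h := eq_of_mem_maxIn hΦ hΔ hG hC hM hM' (hΦ.ne_zero (hΔ.mem i))
      (hAM (simple_mem_simpleSpan.2 hi'.1)) (hBM (simple_mem_simpleSpan.2 hi'.2))
    have hle : simpleSpan Δ (A ∪ B) ≤ M := by
      rw [simpleSpan_union]
      exact sup_le hAM (h ▸ hBM)
    have hM1 : Maximal (fun A => A ∈ G ∧ A ≤ simpleSpan Δ (_)) M := hM
    show simpleSpan Δ (A ∪ B) ∈ G
    rw [le_antisymm hle hM1.prop.2]
    exact hM1.prop.1

/-- The root s_i(Δ j) is a combination of Δ i and Δ j with both coefficients nonzero. It must lie in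
one summand of the decomposition of the plane, which is impossible if Δ i and Δ j lie in different
summands. -/
theorem pair_mem_of_inner_ne_zero {i j : Fin n} (hij : ⟪Δ i, Δ j⟫_ℝ ≠ 0) :
    {i, j} ∈ indexFamily Δ G := by
  set C := simpleSpan Δ {i, j} with hCdef
  have hC : C ∈ rootSpaces Φ := simpleSpan_mem_rootSpaces hΦ hΔ ⟨i, by simp⟩
  have hiC : Δ i ∈ C := simple_mem_simpleSpan.2 (by simp)
  have hjC : Δ j ∈ C := simple_mem_simpleSpan.2 (by simp)
  obtain ⟨M, hM, hiM⟩ := exists_mem_maxIn hΦ hΔ hG (hΔ.mem i) hiC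
  obtain ⟨M', hM', hjM'⟩ := exists_mem_maxIn hΦ hΔ hG (hΔ.mem j) hjC
  have hM1 : Maximal (fun A => A ∈ G ∧ A ≤ C) M := hM
  have hi0 := hΦ.ne_zero (hΔ.mem i)
  have hj0 := hΦ.ne_zero (hΔ.mem j)
  have heq : M = M' := by
    by_contra hne
    set t := 2 * ⟪Δ i, Δ j⟫_ℝ / ‖Δ i‖ ^ 2 with ht
    have ht0 : t ≠ 0 := by
      have := norm_simple_sq_pos hΦ hΔ i
      positivity
    have hβ : refl (Δ i) (Δ j) = Δ j - t • Δ i := refl_apply _ _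
    have hβΦ := hΦ.refl_mem _ (hΔ.mem i) _ (hΔ.mem j)
    have hβC : refl (Δ i) (Δ j) ∈ C := by
      rw [hβ]
      exact C.sub_mem hjC (C.smul_mem _ hiC)
    obtain ⟨N, hN, hβN⟩ := exists_mem_maxIn hΦ hΔ hG hβΦ hβC
    by_cases hNM : N = M
    · subst hNM
      have : Δ j ∈ N := by
        have := N.add_mem hβN (N.smul_mem t hiM)
        rwa [hβ, sub_add_cancel] at this
      exact hne (eq_of_mem_maxIn hΦ hΔ hG hC hM hM' hj0 this hjM')
    by_cases hNM' : N = M'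
    · subst hNM'
      have : Δ i ∈ N := by
        have := N.sub_mem hjM' hβN
        rw [hβ, sub_sub_cancel] at this
        exact (N.smul_mem_iff ht0).1 this
      exact hne (eq_of_mem_maxIn hΦ hΔ hG hC hM hM' hi0 hiM this)
    have h1 : M ≤ sSup (maxIn G C \ {N}) := le_sSup ⟨hM, fun h => hNM h.symm⟩
    have h2 : M' ≤ sSup (maxIn G C \ {N}) := le_sSup ⟨hM', fun h => hNM' h.symm⟩
    refine hΦ.ne_zero hβΦ (Submodule.disjoint_def.1 (hG.indep_maxIn C hC hN) _ hβN ?_)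
    rw [hβ]
    exact Submodule.sub_mem _ (h2 hjM') (Submodule.smul_mem _ _ (h1 hiM))
  have hle : C ≤ M := by
    rw [hCdef, simpleSpan_le_iff]
    intro k hk
    rcases Finset.mem_insert.1 hk with rfl | hk
    · exact hiM
    · rw [Finset.mem_singleton.1 hk, heq]
      exact hjM'
  show C ∈ G
  rw [le_antisymm hle hM1.prop.2]
  exact hM1.prop.1

theorem inner_eq_zero_of_separated (h : Separated (indexFamily Δ G) J K) {i j : Fin n}
    (hi : i ∈ J) (hj : j ∈ K) : ⟪Δ i, Δ j⟫_ℝ = 0 := by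
  by_contra hne
  have hmem := pair_mem_of_inner_ne_zero hΦ hΔ hG hne
  have hsub : {i, j} ⊆ J ∪ K := by
    intro k hk
    rcases Finset.mem_insert.1 hk with rfl | hk
    · exact Finset.mem_union_left _ hi
    · rw [Finset.mem_singleton.1 hk]
      exact Finset.mem_union_right _ hj
  rcases h.2 _ hmem hsub with h' | h'
  · exact Finset.disjoint_left.1 h.1 (h' (by simp : j ∈ ({i, j} : Finset (Fin n)))) hj
  · exact Finset.disjoint_left.1 h.1 hi (h' (by simp : i ∈ ({i, j} : Finset (Fin n))))

/-- The maximal elements of `G` in a span of simple roots are spans of simple roots. -/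
theorem eq_simpleSpan_of_mem_maxIn (hD : D.Nonempty) {M : Submodule ℝ V}
    (hM : M ∈ maxIn G (simpleSpan Δ D)) : ∃ A ⊆ D, M = simpleSpan Δ A := by
  classical
  have hC := simpleSpan_mem_rootSpaces hΦ hΔ hD
  have hM1 : Maximal (fun A => A ∈ G ∧ A ≤ simpleSpan Δ D) M := hM
  refine ⟨D.filter fun i => Δ i ∈ M, Finset.filter_subset _ _, le_antisymm (fun x hx => ?_)
    (simpleSpan_le_iff.2 fun i hi => (Finset.mem_filter.1 hi).2)⟩
  have hxD := mem_simpleSpan.1 (hM1.prop.2 hx)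
  -- x is split according to whether Δ i belongs to M. The part `b` lies in M and also in the sum of
  -- the other maximal elements, so it vanishes.
  set a := ∑ i ∈ D.filter (fun i => Δ i ∈ M), Δ.repr x i • Δ i with ha
  set b := ∑ i ∈ D.filter (fun i => ¬ Δ i ∈ M), Δ.repr x i • Δ i with hb
  have hsum : x = a + b := by
    rw [ha, hb, Finset.sum_filter_add_sum_filter_not]
    conv_lhs => rw [← Δ.sum_repr x]
    refine (Finset.sum_subset (Finset.subset_univ D) fun i _ hi => ?_).symm
    rw [hxD i hi, zero_smul]
  have haM : a ∈ M := M.sum_mem fun i hi => M.smul_mem _ (Finset.mem_filter.1 hi).2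
  have hbM : b ∈ M := by
    have := M.sub_mem hx haM
    rwa [hsum, add_sub_cancel_left] at this
  have hbS : b ∈ sSup (maxIn G (simpleSpan Δ D) \ {M}) := by
    refine Submodule.sum_mem _ fun i hi => Submodule.smul_mem _ _ ?_
    obtain ⟨hiD, hiM⟩ := Finset.mem_filter.1 hi
    obtain ⟨M', hM', hiM'⟩ := exists_mem_maxIn hΦ hΔ hG (hΔ.mem i)
      (simple_mem_simpleSpan.2 hiD)
    exact le_sSup (show M' ∈ maxIn G (simpleSpan Δ D) \ {M} from
      ⟨hM', fun h => hiM (h ▸ hiM')⟩) hiM'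
  have hb0 := Submodule.disjoint_def.1 (hG.indep_maxIn _ hC hM) b hbM hbS
  rw [hsum, hb0, add_zero]
  exact Submodule.sum_mem _ fun i hi => Submodule.smul_mem _ _ (simple_mem_simpleSpan.2 hi)

theorem exists_comp_of_root {β : V} (hβ : β ∈ Φ) (hβD : β ∈ simpleSpan Δ D) :
    ∃ A ∈ comps (indexFamily Δ G) D, β ∈ simpleSpan Δ A := by
  have hD : D.Nonempty := by
    by_contra hD
    rw [Finset.not_nonempty_iff_eq_empty] at hD
    rw [hD, simpleSpan_empty] at hβD
    exact hΦ.ne_zero hβ ((Submodule.mem_bot ℝ).1 hβD)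
  obtain ⟨M, hM, hβM⟩ := exists_mem_maxIn hΦ hΔ hG hβ hβD
  obtain ⟨A, hA, rfl⟩ := eq_simpleSpan_of_mem_maxIn hΦ hΔ hG hD hM
  have hM1 : Maximal (fun B => B ∈ G ∧ B ≤ simpleSpan Δ D) (simpleSpan Δ A) := hM
  obtain ⟨B, hB, hAB⟩ := exists_subset_mem_comps (𝓑 := indexFamily Δ G) hM1.prop.1 hA
  exact ⟨B, hB, simpleSpan_le_simpleSpan.2 hAB hβM⟩

/-- Every root in the span of D already lies in the span of one component, so no reflection is lost.
-/
theorem parabolic_simpleSpan (D : Finset (Fin n)) :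
    parabolic Φ (simpleSpan Δ D) =
      ⨆ A ∈ comps (indexFamily Δ G) D, parabolic Φ (simpleSpan Δ A) := by
  refine le_antisymm ((Subgroup.closure_le _).2 ?_) (iSup₂_le fun A hA =>
    parabolic_mono Φ (simpleSpan_le_simpleSpan.2 (subset_of_mem_comps hA)))
  rintro _ ⟨β, hβ, hβD, rfl⟩
  obtain ⟨A, hA, hβA⟩ := exists_comp_of_root hΦ hΔ hG hβ hβD
  exact (le_iSup₂_of_le A hA le_rfl : parabolic Φ (simpleSpan Δ A) ≤ _)
    (refl_mem_parabolic hβ hβA)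

end Systems

/-! ### Coefficients of the projections of δ and the weight conditions -/

section Projections

variable [FiniteDimensional ℝ V]

/-- The coefficients of the projection of `δ` to the span of the simple roots in `I`. -/
def coef (Φ : Finset V) (Δ : Module.Basis (Fin n) ℝ V) (I : Finset (Fin n)) (i : Fin n) : ℝ :=
  Δ.repr (piVec Φ Δ (simpleSpan Δ I)) i

theorem piVec_mem (A : Submodule ℝ V) : piVec Φ Δ A ∈ A := Submodule.starProjection_apply_mem A _

theorem inner_piVec {A : Submodule ℝ V} {v : V} (hv : v ∈ A) :
    ⟪piVec Φ Δ A, v⟫_ℝ = ⟪delta Φ Δ, v⟫_ℝ := by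
  have := Submodule.starProjection_inner_eq_zero (K := A) (delta Φ Δ) v hv
  rw [inner_sub_left, sub_eq_zero] at this
  exact this.symm

theorem piVec_top : piVec Φ Δ ⊤ = delta Φ Δ :=
  Submodule.starProjection_eq_self_iff.2 Submodule.mem_top

theorem piVec_bot : piVec Φ Δ (⊥ : Submodule ℝ V) = 0 :=
  (Submodule.mem_bot ℝ).1 (piVec_mem ⊥)

theorem inner_piVec_eq_wsum (x : V) (I : Finset (Fin n)) :
    ⟪x, piVec Φ Δ (simpleSpan Δ I)⟫_ℝ = wsum (coef Φ Δ) (fun i => ⟪x, Δ i⟫_ℝ) I := by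
  rw [inner_eq_sum_repr Δ, wsum]
  refine (Finset.sum_subset (Finset.subset_univ I) fun i _ hi => ?_).symm
  show Δ.repr (piVec Φ Δ (simpleSpan Δ I)) i * _ = 0
  rw [mem_simpleSpan.1 (piVec_mem _) i hi, zero_mul]

variable (hΦ : IsRootSystem Φ) (hΔ : IsSimpleSystem Φ Δ) (hG : IsBuildingSet Φ G)
include hΦ hΔ

/-- Let p - q be the splitting of the projection v into positive and negative coordinates.
Obtuseness of the simple roots gives ⟪p, q⟫ ≤ 0, while ⟪v, q⟫ ≥ 0 as v pairs positively with the
simple roots in I; hence q = 0. A zero coefficient at i would make ⟪v, Δ i⟫ nonpositive. -/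
theorem coef_pos {i : Fin n} (hi : i ∈ I) : 0 < coef Φ Δ I i := by
  set v := piVec Φ Δ (simpleSpan Δ I) with hv
  have hinner : ∀ k ∈ I, 0 < ⟪v, Δ k⟫_ℝ := fun k hk => by
    rw [hv, inner_piVec (simple_mem_simpleSpan.2 hk)]
    exact inner_delta_simple_pos hΦ hΔ k
  have hsupp := mem_simpleSpan.1 (piVec_mem (Φ := Φ) (Δ := Δ) (simpleSpan Δ I))
  rw [← hv] at hsupp
  set p : V := ∑ k, max (Δ.repr v k) 0 • Δ k with hp
  set q : V := ∑ k, max (-Δ.repr v k) 0 • Δ k with hq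
  have hvpq : v = p - q := by
    rw [hp, hq, ← Finset.sum_sub_distrib]
    conv_lhs => rw [← Δ.sum_repr v]
    refine Finset.sum_congr rfl fun k _ => ?_
    rw [← sub_smul]
    congr 1
    rcases le_total 0 (Δ.repr v k) with h | h
    · rw [max_eq_left h, max_eq_right (by linarith), sub_zero]
    · rw [max_eq_right h, max_eq_left (by linarith)]
      ring
  have hpq : ⟪p, q⟫_ℝ ≤ 0 := by
    rw [hp, hq, sum_inner]
    refine Finset.sum_nonpos fun k _ => ?_
    rw [inner_sum]
    refine Finset.sum_nonpos fun l _ => ?_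
    rw [real_inner_smul_left, real_inner_smul_right]
    by_cases hkl : k = l
    · subst hkl
      rcases le_total 0 (Δ.repr v k) with h | h
      · rw [max_eq_right (by linarith : -Δ.repr v k ≤ 0)]
        simp
      · rw [max_eq_right h]
        simp
    · have h1 := inner_simple_nonpos hΦ hΔ hkl
      have h2 : 0 ≤ max (Δ.repr v k) 0 := le_max_right _ _
      have h3 : 0 ≤ max (-Δ.repr v l) 0 := le_max_right _ _
      exact mul_nonpos_of_nonneg_of_nonpos h2 (mul_nonpos_of_nonneg_of_nonpos h3 h1)
  have hvq : 0 ≤ ⟪v, q⟫_ℝ := by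
    rw [hq, inner_sum]
    refine Finset.sum_nonneg fun k _ => ?_
    rw [real_inner_smul_right]
    by_cases hk : k ∈ I
    · exact mul_nonneg (le_max_right _ _) (hinner k hk).le
    · rw [hsupp k hk]
      simp
  have hq0 : q = 0 := by
    have h1 : ⟪v, q⟫_ℝ = ⟪p, q⟫_ℝ - ⟪q, q⟫_ℝ := by rw [hvpq, inner_sub_left]
    have h2 : ⟪q, q⟫_ℝ ≤ 0 := by linarith
    exact real_inner_self_nonpos.1 h2
  have hnn : ∀ k, 0 ≤ Δ.repr v k := by
    intro k
    have h1 : v = p := by rw [hvpq, hq0, sub_zero]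
    rw [h1, hp, Δ.repr_sum_self]
    exact le_max_right _ _
  refine lt_of_le_of_ne (hnn i) fun h0 => ?_
  have h1 : ⟪v, Δ i⟫_ℝ ≤ 0 := by
    rw [real_inner_comm, inner_eq_sum_repr Δ]
    refine Finset.sum_nonpos fun k _ => ?_
    by_cases hk : i = k
    · subst hk
      rw [show Δ.repr v i = 0 from h0.symm, zero_mul]
    · exact mul_nonpos_of_nonneg_of_nonpos (hnn k) (inner_simple_nonpos hΦ hΔ hk)
  linarith [hinner i hi]

theorem coef_nonneg (I : Finset (Fin n)) (i : Fin n) : 0 ≤ coef Φ Δ I i := by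
  by_cases hi : i ∈ I
  · exact (coef_pos hΦ hΔ hi).le
  · exact (mem_simpleSpan.1 (piVec_mem _) i hi).ge

include hG

/-- Separated sets of simple roots are orthogonal, so the sum of the two projections has the
defining property of the projection to the sum. -/
theorem piVec_union (h : Separated (indexFamily Δ G) J K) :
    piVec Φ Δ (simpleSpan Δ (J ∪ K)) =
      piVec Φ Δ (simpleSpan Δ J) + piVec Φ Δ (simpleSpan Δ K) := by
  refine Submodule.eq_starProjection_of_mem_of_inner_eq_zero ?_ ?_
  · rw [simpleSpan_union]
    exact Submodule.add_mem_sup (piVec_mem _) (piVec_mem _)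
  · have hortho : ∀ {J K : Finset (Fin n)}, Separated (indexFamily Δ G) J K → ∀ i ∈ J,
        ⟪piVec Φ Δ (simpleSpan Δ K), Δ i⟫_ℝ = 0 := by
      intro J K h i hi
      rw [real_inner_comm, inner_eq_sum_repr Δ]
      refine Finset.sum_eq_zero fun k _ => ?_
      by_cases hk : k ∈ K
      · rw [inner_eq_zero_of_separated hΦ hΔ hG h hi hk, mul_zero]
      · rw [mem_simpleSpan.1 (piVec_mem _) k hk, zero_mul]
    have hle : simpleSpan Δ (J ∪ K) ≤ LinearMap.ker (innerSL ℝ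
        (delta Φ Δ - (piVec Φ Δ (simpleSpan Δ J) + piVec Φ Δ (simpleSpan Δ K)))).toLinearMap := by
      refine simpleSpan_le_iff.2 fun i hi => LinearMap.mem_ker.2 ?_
      show ⟪_, Δ i⟫_ℝ = 0
      rw [inner_sub_left, inner_add_left]
      rcases Finset.mem_union.1 hi with hi | hi
      · rw [hortho h i hi, inner_piVec (simple_mem_simpleSpan.2 hi)]
        ring
      · rw [hortho h.symm i hi, inner_piVec (simple_mem_simpleSpan.2 hi)]
        ring
    intro w hw
    exact LinearMap.mem_ker.1 (hle hw)

theorem coef_union (h : Separated (indexFamily Δ G) J K) {i : Fin n} (hi : i ∈ J) :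
    coef Φ Δ (J ∪ K) i = coef Φ Δ J i := by
  rw [coef, piVec_union hΦ hΔ hG h, map_add, Finsupp.add_apply,
    mem_simpleSpan.1 (piVec_mem (simpleSpan Δ K)) i (Finset.disjoint_left.1 h.1 hi), add_zero, coef]

theorem bddAbove_ratios (i j : ℕ) :
    BddAbove (insert 1 {r | ∃ A ∈ fund Δ G, ∃ B ∈ fund Δ G, B < A ∧
      Module.finrank ℝ A = i ∧ Module.finrank ℝ B = j ∧ r = ratio Φ Δ A B}) := by
  have hfin : (fund Δ G).Finite := by
    refine (Set.finite_range (simpleSpan Δ)).subset fun C hC => ?_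
    obtain ⟨I, -, rfl⟩ := mem_fund_iff.1 hC
    exact ⟨I, rfl⟩
  refine Set.Finite.bddAbove (Set.Finite.insert _
    ((Set.Finite.image2 (ratio Φ Δ) hfin hfin).subset ?_))
  rintro r ⟨A, hA, B, hB, -, -, -, rfl⟩
  exact ⟨A, hA, B, hB, rfl⟩

theorem one_le_maxRatio (i j : ℕ) : 1 ≤ maxRatio Φ Δ G i j :=
  le_csSup (bddAbove_ratios hΦ hΔ hG i j) (Set.mem_insert _ _)

theorem coef_le_maxRatio_mul (hA : A ∈ indexFamily Δ G) (hB : B ∈ indexFamily Δ G) (hBA : B ⊂ A)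
    {i : Fin n} (hi : i ∈ B) :
    coef Φ Δ A i ≤ maxRatio Φ Δ G A.card B.card * coef Φ Δ B i := by
  have hr : ratio Φ Δ (simpleSpan Δ A) (simpleSpan Δ B) ≤ maxRatio Φ Δ G A.card B.card := by
    refine le_csSup (bddAbove_ratios hΦ hΔ hG _ _) (Set.mem_insert_of_mem _ ?_)
    refine ⟨_, simpleSpan_mem_fund_iff.2 hA, _, simpleSpan_mem_fund_iff.2 hB, ?_,
      finrank_simpleSpan, finrank_simpleSpan, rfl⟩
    exact lt_of_le_not_ge (simpleSpan_le_simpleSpan.2 hBA.1)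
      fun h => hBA.2 (simpleSpan_le_simpleSpan.1 h)
  have hiA := hBA.1 hi
  have hiB' : Δ i ∈ simpleSpan Δ B := simple_mem_simpleSpan.2 hi
  have hiA' : Δ i ∈ simpleSpan Δ A := simple_mem_simpleSpan.2 hiA
  have h1 : coef Φ Δ A i ≤ ⨆ k : {k : Fin n // Δ k ∈ simpleSpan Δ A},
      Δ.repr (piVec Φ Δ (simpleSpan Δ A)) k :=
    le_ciSup (f := fun k : {k : Fin n // Δ k ∈ simpleSpan Δ A} =>
      Δ.repr (piVec Φ Δ (simpleSpan Δ A)) k) (Set.finite_range _).bddAbove ⟨i, hiA'⟩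
  have h2 : (⨅ k : {k : Fin n // Δ k ∈ simpleSpan Δ B},
      Δ.repr (piVec Φ Δ (simpleSpan Δ B)) k) ≤ coef Φ Δ B i :=
    ciInf_le (f := fun k : {k : Fin n // Δ k ∈ simpleSpan Δ B} =>
      Δ.repr (piVec Φ Δ (simpleSpan Δ B)) k) (Set.finite_range _).bddBelow ⟨i, hiB'⟩
  have h3 : 0 < ⨅ k : {k : Fin n // Δ k ∈ simpleSpan Δ B},
      Δ.repr (piVec Φ Δ (simpleSpan Δ B)) k := by
    have : Nonempty {k : Fin n // Δ k ∈ simpleSpan Δ B} := ⟨⟨i, hiB'⟩⟩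
    obtain ⟨k, hk⟩ := exists_eq_ciInf_of_finite (f := fun k : {k : Fin n // Δ k ∈ simpleSpan Δ B} =>
      Δ.repr (piVec Φ Δ (simpleSpan Δ B)) k)
    rw [← hk]
    exact coef_pos hΦ hΔ (simple_mem_simpleSpan.1 k.2)
  have h4 := coef_pos hΦ hΔ hiA
  have h5 : ratio Φ Δ (simpleSpan Δ A) (simpleSpan Δ B) * (⨅ k : {k : Fin n // Δ k ∈ simpleSpan Δ B},
      Δ.repr (piVec Φ Δ (simpleSpan Δ B)) k) = ⨆ k : {k : Fin n // Δ k ∈ simpleSpan Δ A},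
      Δ.repr (piVec Φ Δ (simpleSpan Δ A)) k := div_mul_cancel₀ _ h3.ne'
  have h6 : 0 ≤ maxRatio Φ Δ G A.card B.card :=
    zero_le_one.trans (one_le_maxRatio hΦ hΔ hG _ _)
  calc coef Φ Δ A i ≤ _ := h1
    _ = _ := h5.symm
    _ ≤ _ := mul_le_mul hr h2 h3.le h6

variable (hGtop : ⊤ ∈ G) (hε : IsSuitable Φ Δ G ε)
include hε

theorem eps_pos {k : ℕ} (h1 : 1 ≤ k) (hk : k ≤ n) : 0 < ε k := by
  induction k, h1 using Nat.le_induction with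
  | base => exact hε.pos
  | succ k h1 ih => exact (ih (by omega)).trans (hε.lt k h1 (by omega))

/-- The factor 2 in suitability is absorbed by the powers of 2 in κ. -/
theorem kap_lt_succ {k : ℕ} (h1 : 1 ≤ k) (hk : k < n) :
    maxRatio Φ Δ G (k + 1) k * kap ε k < kap ε (k + 1) := by
  have := hε.suitable k h1 hk
  rw [kap, kap, pow_succ, ← mul_div_assoc, div_lt_div_iff₀ (by positivity) (by positivity)]
  have h2 : (0 : ℝ) < 2 ^ k := by positivity
  nlinarith

theorem kap_pos' {k : ℕ} (h1 : 1 ≤ k) (hk : k ≤ n) : 0 < kap ε k :=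
  div_pos (eps_pos hΦ hΔ hG hε h1 hk) (by positivity)

theorem kap_lt {j k : ℕ} (h1 : 1 ≤ j) (hjk : j < k) (hk : k ≤ n) : kap ε j < kap ε k := by
  have step : ∀ k, 1 ≤ k → k < n → kap ε k < kap ε (k + 1) := fun k h1 hk => by
    have h2 := kap_lt_succ hΦ hΔ hG hε h1 hk
    have h3 := kap_pos' hΦ hΔ hG hε h1 hk.le
    nlinarith [one_le_maxRatio hΦ hΔ hG (k + 1) k]
  induction k, hjk using Nat.le_induction with
  | base => exact step j h1 (by omega)
  | succ k hjk ih => exact (ih (by omega)).trans (step k (by omega) (by omega))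

/-- Suitability compares only consecutive dimensions, so B is enlarged one simple root at a time,
always by a root of A not orthogonal to B, which keeps the set in the family. If there is no such
root, B splits off orthogonally from A, the coefficients agree, and κ alone increases. -/
theorem coef_mul_kap_lt (hB : B ∈ indexFamily Δ G) (hBA : B ⊂ A)
    {i : Fin n} (hi : i ∈ B) :
    coef Φ Δ A i * kap ε B.card < coef Φ Δ B i * kap ε A.card := by
  have h𝓑 := isBuildingFamily hΦ hΔ hG
  have hle : ∀ X : Finset (Fin n), X.card ≤ n := fun X => by
    simpa using Finset.card_le_univ X
  have hB1 : 1 ≤ B.card := Finset.card_pos.2 ⟨i, hi⟩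
  induction hd : A.card - B.card using Nat.strong_induction_on generalizing B with
  | _ d ih =>
    have hcard := Finset.card_lt_card hBA
    by_cases hadj : ∃ j ∈ B, ∃ v ∈ A \ B, ⟪Δ j, Δ v⟫_ℝ ≠ 0
    · obtain ⟨j, hj, v, hv, hne⟩ := hadj
      obtain ⟨hvA, hvB⟩ := Finset.mem_sdiff.1 hv
      have hB' : insert v B ∈ indexFamily Δ G := by
        have h1 := h𝓑.union_mem B hB _ (pair_mem_of_inner_ne_zero hΦ hΔ hG hne)
          ⟨j, by simp [hj]⟩
        have h2 : B ∪ {j, v} = insert v B := by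
          ext k
          simp only [Finset.mem_union, Finset.mem_insert, Finset.mem_singleton]
          constructor
          · rintro (h | rfl | rfl)
            exacts [Or.inr h, Or.inr hj, Or.inl rfl]
          · rintro (h | h)
            exacts [Or.inr (Or.inr h), Or.inl h]
        rwa [h2] at h1
      have hc := Finset.card_insert_of_notMem hvB
      have hsub : insert v B ⊆ A := Finset.insert_subset hvA hBA.1
      have h1 := coef_le_maxRatio_mul hΦ hΔ hG hB' hB (Finset.ssubset_insert hvB) hi
      have hκB := kap_pos' hΦ hΔ hG hε hB1 (hle B)
      have hcB := coef_pos hΦ hΔ hi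
      have h2 := kap_lt_succ hΦ hΔ hG hε hB1 (hcard.trans_le (hle A))
      rw [hc] at h1
      have h3 : coef Φ Δ (insert v B) i * kap ε B.card < coef Φ Δ B i * kap ε (B.card + 1) := by
        calc _ ≤ maxRatio Φ Δ G (B.card + 1) B.card * coef Φ Δ B i * kap ε B.card := by gcongr
          _ = coef Φ Δ B i * (maxRatio Φ Δ G (B.card + 1) B.card * kap ε B.card) := by ring
          _ < _ := by gcongr
      rcases hsub.eq_or_ssubset with heq | hss
      · rwa [← heq, hc]
      · have h4 := ih (A.card - (insert v B).card) (by omega) hB' hss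
          (Finset.mem_insert_of_mem hi) (by omega) rfl
        rw [hc] at h4
        have hκ' := kap_pos' hΦ hΔ hG hε (k := B.card + 1) (by omega) (by have := hle A; omega)
        have hκA := kap_pos' hΦ hΔ hG hε (k := A.card) (by omega) (hle A)
        refine lt_of_mul_lt_mul_right ?_ hκ'.le
        calc coef Φ Δ A i * kap ε B.card * kap ε (B.card + 1)
            = coef Φ Δ A i * kap ε (B.card + 1) * kap ε B.card := by ring
          _ < coef Φ Δ (insert v B) i * kap ε A.card * kap ε B.card := by gcongr
          _ = coef Φ Δ (insert v B) i * kap ε B.card * kap ε A.card := by ring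
          _ < coef Φ Δ B i * kap ε (B.card + 1) * kap ε A.card := by gcongr
          _ = coef Φ Δ B i * kap ε A.card * kap ε (B.card + 1) := by ring
    · push Not at hadj
      have hcoef : coef Φ Δ A i = coef Φ Δ B i := by
        have hle1 : piVec Φ Δ (simpleSpan Δ A) =
            piVec Φ Δ (simpleSpan Δ B) + piVec Φ Δ (simpleSpan Δ (A \ B)) := by
          refine Submodule.eq_starProjection_of_mem_of_inner_eq_zero ?_ ?_
          · exact Submodule.add_mem _
              (simpleSpan_le_simpleSpan.2 hBA.1 (piVec_mem _))
              (simpleSpan_le_simpleSpan.2 Finset.sdiff_subset (piVec_mem _))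
          · have hle : simpleSpan Δ A ≤ LinearMap.ker (innerSL ℝ (delta Φ Δ -
                (piVec Φ Δ (simpleSpan Δ B) + piVec Φ Δ (simpleSpan Δ (A \ B))))).toLinearMap := by
              refine simpleSpan_le_iff.2 fun k hk => LinearMap.mem_ker.2 ?_
              show ⟪_, Δ k⟫_ℝ = 0
              rw [inner_sub_left, inner_add_left]
              by_cases hkB : k ∈ B
              · have h0 : ⟪piVec Φ Δ (simpleSpan Δ (A \ B)), Δ k⟫_ℝ = 0 := by
                  rw [real_inner_comm, inner_eq_sum_repr Δ]
                  refine Finset.sum_eq_zero fun l _ => ?_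
                  by_cases hl : l ∈ A \ B
                  · rw [hadj k hkB l hl, mul_zero]
                  · rw [mem_simpleSpan.1 (piVec_mem _) l hl, zero_mul]
                rw [h0, inner_piVec (simple_mem_simpleSpan.2 hkB)]
                ring
              · have h0 : ⟪piVec Φ Δ (simpleSpan Δ B), Δ k⟫_ℝ = 0 := by
                  rw [real_inner_comm, inner_eq_sum_repr Δ]
                  refine Finset.sum_eq_zero fun l _ => ?_
                  by_cases hl : l ∈ B
                  · rw [real_inner_comm, hadj l hl k (Finset.mem_sdiff.2 ⟨hk, hkB⟩), mul_zero]
                  · rw [mem_simpleSpan.1 (piVec_mem _) l hl, zero_mul]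
                rw [h0, inner_piVec (simple_mem_simpleSpan.2 (Finset.mem_sdiff.2 ⟨hk, hkB⟩))]
                ring
            intro w hw
            exact LinearMap.mem_ker.1 (hle hw)
        rw [coef, hle1, map_add, Finsupp.add_apply,
          mem_simpleSpan.1 (piVec_mem (simpleSpan Δ (A \ B))) i (by simp [hi]), add_zero, coef]
      rw [hcoef]
      have := kap_lt hΦ hΔ hG hε hB1 hcard (hle A)
      have := coef_pos hΦ hΔ hi
      gcongr

include hGtop

theorem isWeight : IsWeight (indexFamily Δ G) (coef Φ Δ) ε := by
  have h𝓑 := isBuildingFamily hΦ hΔ hG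
  have hle : ∀ X : Finset (Fin n), X.card ≤ n := fun X => by
    simpa using Finset.card_le_univ X
  refine ⟨h𝓑, ?_, fun A _ i hi => coef_pos hΦ hΔ hi, fun J K h i hi => coef_union hΦ hΔ hG h hi,
    fun A _ B hB hBA i hi => coef_mul_kap_lt hΦ hΔ hG hε hB hBA hi,
    fun A hA => kap_pos' hΦ hΔ hG hε (h𝓑.nonempty A hA).card_pos (hle A), fun A hA B hB hBA => ?_⟩
  · show simpleSpan Δ Finset.univ ∈ G
    rwa [simpleSpan_univ]
  · rcases hBA.eq_or_ssubset with rfl | h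
    · exact le_rfl
    · exact (kap_lt hΦ hΔ hG hε (h𝓑.nonempty B hB).card_pos (Finset.card_lt_card h) (hle A)).le

end Projections

end Bridge

/-! ### Faces as convex hulls of vertices -/

section ExtremePoints

variable {V : Type*} [NormedAddCommGroup V] [InnerProductSpace ℝ V] {J : Type*} [Finite J]
  {m : J → V} {b : J → ℝ} {x : V}

/-- A vertex is determined by its set of tight inequalities, and there are finitely many such sets.
-/
theorem finite_extremePoints_polyhedron (m : J → V) (b : J → ℝ) :
    ((polyhedron m b).extremePoints ℝ).Finite := by
  refine Set.Finite.of_finite_image (f := tightAt m b) (Set.toFinite _) fun y hy z hz h => ?_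
  have h1 := faceOf_extreme hy
  rw [faceOf_congr h, faceOf_extreme hz] at h1
  exact (Set.singleton_injective h1).symm

theorem faceOf_eq_convexHull (hx : x ∈ polyhedron m b) (hc : IsCompact (polyhedron m b)) :
    faceOf m b x = convexHull ℝ (faceOf m b x ∩ (polyhedron m b).extremePoints ℝ) := by
  have h1 : IsCompact (faceOf m b x) :=
    hc.of_isClosed_subset (isClosed_faceOf m b x) fun z hz => hz.1
  have h2 := closure_convexHull_extremePoints h1 (convex_faceOf m b x)
  rw [(isExposed_faceOf hx).isExtreme.extremePoints_eq] at h2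
  have h3 := ((finite_extremePoints_polyhedron m b).subset
    (Set.inter_subset_right (s := faceOf m b x))).isCompact_convexHull ℝ
  rwa [h3.isClosed.closure_eq, eq_comm] at h2

end ExtremePoints

/-! ### The permutonestohedron as a polyhedron -/

section Geometry

variable {V : Type*} [NormedAddCommGroup V] [InnerProductSpace ℝ V] [FiniteDimensional ℝ V]
  {Φ : Finset V} {n : ℕ} {Δ : Module.Basis (Fin n) ℝ V} {G : Set (Submodule ℝ V)} {ε : ℕ → ℝ}
  {I J K A B D : Finset (Fin n)} {x y z : V} {σ w : V ≃ₗᵢ[ℝ] V}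

/-- The data from which a permutonestohedron is built. -/
structure IsAdmissible (Φ : Finset V) (Δ : Module.Basis (Fin n) ℝ V) (G : Set (Submodule ℝ V))
    (ε : ℕ → ℝ) : Prop where
  root : IsRootSystem Φ
  simple : IsSimpleSystem Φ Δ
  building : IsBuildingSet Φ G
  top_mem : ⊤ ∈ G
  suitable : IsSuitable Φ Δ G ε

/-- The normal vector of the wall of `I`; the empty set stands for the wall of `V`. -/
def normal (Φ : Finset V) (Δ : Module.Basis (Fin n) ℝ V) (I : Finset (Fin n)) : V :=
  delta Φ Δ - piVec Φ Δ (simpleSpan Δ I)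

/-- The level of the wall of `I`; the empty set stands for the wall of `V`. -/
def level (Δ : Module.Basis (Fin n) ℝ V) (G : Set (Submodule ℝ V)) (ε : ℕ → ℝ)
    (I : Finset (Fin n)) : ℝ :=
  ε n - epsSum (indexFamily Δ G) ε I

/-- The excess of `I` at the point `x`. -/
def excessAt (Φ : Finset V) (Δ : Module.Basis (Fin n) ℝ V) (G : Set (Submodule ℝ V)) (ε : ℕ → ℝ)
    (x : V) (I : Finset (Fin n)) : ℝ :=
  excess (indexFamily Δ G) (coef Φ Δ) ε (fun i => ⟪x, Δ i⟫_ℝ) I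

/-- The indices of the inequalities of the permutonestohedron. -/
abbrev WallIndex (Φ : Finset V) (n : ℕ) : Type _ :=
  {p : coxeterGroup Φ × Finset (Fin n) // p.2 ≠ Finset.univ}

/-- The normal vectors of the inequalities of the permutonestohedron. -/
def wallVec (Φ : Finset V) (Δ : Module.Basis (Fin n) ℝ V) (j : WallIndex Φ n) : V :=
  (j.1.1 : V ≃ₗᵢ[ℝ] V) (normal Φ Δ j.1.2)

/-- The constants in the inequalities of the permutonestohedron. -/
def wallConst (Φ : Finset V) (Δ : Module.Basis (Fin n) ℝ V) (G : Set (Submodule ℝ V))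
    (ε : ℕ → ℝ) (j : WallIndex Φ n) : ℝ :=
  level Δ G ε j.1.2

/-- The points where a linear map to coordinates against the simple roots is prescribed. -/
def coords (Δ : Module.Basis (Fin n) ℝ V) : V →ₗ[ℝ] (Fin n → ℝ) :=
  LinearMap.pi fun i => (innerSL ℝ (Δ i)).toLinearMap

theorem coords_apply (x : V) (i : Fin n) : coords Δ x i = ⟪x, Δ i⟫_ℝ :=
  real_inner_comm _ _

theorem ker_coords : LinearMap.ker (coords Δ) = ⊥ := by
  rw [LinearMap.ker_eq_bot']
  intro x hx
  rw [← inner_self_eq_zero (𝕜 := ℝ), inner_eq_sum_repr Δ]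
  refine Finset.sum_eq_zero fun i _ => ?_
  rw [← coords_apply, hx, Pi.zero_apply, mul_zero]

theorem exists_coords_eq (y : Fin n → ℝ) : ∃ x : V, ∀ i, ⟪x, Δ i⟫_ℝ = y i := by
  have hfin : Module.finrank ℝ V = Module.finrank ℝ (Fin n → ℝ) := by
    rw [Module.finrank_eq_card_basis Δ, Module.finrank_fintype_fun_eq_card]
  obtain ⟨x, hx⟩ := (LinearMap.injective_iff_surjective_of_finrank_eq_finrank hfin).1
    (LinearMap.ker_eq_bot.1 (ker_coords (Δ := Δ))) y
  exact ⟨x, fun i => by rw [← coords_apply, hx]⟩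

theorem inner_normal_of_mem {v : V} (hv : v ∈ simpleSpan Δ I) : ⟪normal Φ Δ I, v⟫_ℝ = 0 := by
  rw [normal, inner_sub_left, inner_piVec hv, sub_self]

theorem wallNormal_univ : wallNormal Φ Δ G ⊤ = normal Φ Δ ∅ := by
  rw [wallNormal, if_pos rfl, normal, simpleSpan_empty, piVec_bot, sub_zero]

namespace IsAdmissible

variable (h : IsAdmissible Φ Δ G ε)
include h

theorem weight : IsWeight (indexFamily Δ G) (coef Φ Δ) ε :=
  isWeight h.root h.simple h.building h.top_mem h.suitable

theorem family : IsBuildingFamily (indexFamily Δ G) := h.weight.building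

theorem univ_mem : Finset.univ ∈ indexFamily Δ G := h.weight.univ_mem

theorem sepAdditive_excessAt (x : V) : SepAdditive (indexFamily Δ G) (excessAt Φ Δ G ε x) :=
  h.weight.sepAdditive_excess _

theorem excessAt_empty (x : V) : excessAt Φ Δ G ε x ∅ = 0 := (h.sepAdditive_excessAt x).empty

theorem excessAt_univ (x : V) : excessAt Φ Δ G ε x Finset.univ = ⟪x, delta Φ Δ⟫_ℝ - ε n := by
  rw [excessAt, excess, ← inner_piVec_eq_wsum, simpleSpan_univ, piVec_top, epsSum,
    comps_of_mem h.univ_mem, Finset.sum_singleton, Finset.card_univ, Fintype.card_fin]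

/-- The slack of the inequality of I is its excess minus that of the full set: membership in P
becomes minimization, and tight walls become minimizers. -/
theorem level_sub_inner (x : V) (I : Finset (Fin n)) :
    level Δ G ε I - ⟪x, normal Φ Δ I⟫_ℝ =
      excessAt Φ Δ G ε x I - excessAt Φ Δ G ε x Finset.univ := by
  rw [h.excessAt_univ, excessAt, excess, ← inner_piVec_eq_wsum, normal, inner_sub_right, level]
  ring

theorem inner_eq_level_iff :
    ⟪x, normal Φ Δ I⟫_ℝ = level Δ G ε I ↔
      excessAt Φ Δ G ε x I = excessAt Φ Δ G ε x Finset.univ := by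
  have := h.level_sub_inner x I
  constructor <;> intro h' <;> linarith

theorem inner_le_level_iff :
    ⟪x, normal Φ Δ I⟫_ℝ ≤ level Δ G ε I ↔
      excessAt Φ Δ G ε x Finset.univ ≤ excessAt Φ Δ G ε x I := by
  have := h.level_sub_inner x I
  constructor <;> intro h' <;> linarith

theorem sum_piVec_comps (I : Finset (Fin n)) :
    ∑ A ∈ comps (indexFamily Δ G) I, piVec Φ Δ (simpleSpan Δ A) =
      piVec Φ Δ (simpleSpan Δ I) := by
  refine Δ.ext_elem fun k => ?_
  have hsep : SepAdditive (indexFamily Δ G)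
      fun I => Δ.repr (piVec Φ Δ (simpleSpan Δ I)) k := by
    intro J K hJK
    dsimp only
    rw [piVec_union h.root h.simple h.building hJK, map_add, Finsupp.add_apply]
  rw [hsep.sum_comps h.family I, map_sum, Finsupp.finsetSum_apply]

theorem wallNormal_of_ne (hI : I ≠ Finset.univ) :
    wallNormal Φ Δ G (simpleSpan Δ I) = normal Φ Δ I := by
  rw [wallNormal, if_neg fun h' => hI (simpleSpan_eq_top.1 h'), maxIn_fund,
    finsum_mem_image simpleSpan_injective.injOn, finsum_mem_coe_finset, h.sum_piVec_comps, normal]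

theorem wallLevel_of_ne (hI : I ≠ Finset.univ) :
    wallLevel Δ G ε (simpleSpan Δ I) = level Δ G ε I := by
  rw [wallLevel, if_neg fun h' => hI (simpleSpan_eq_top.1 h'), maxIn_fund,
    finsum_mem_image simpleSpan_injective.injOn, finsum_mem_coe_finset, level, epsSum]
  simp only [finrank_simpleSpan]

theorem wallLevel_top : wallLevel Δ G ε ⊤ = level Δ G ε ∅ := by
  rw [wallLevel, if_pos rfl, level, h.weight.sepAdditive_epsSum.empty, sub_zero]

theorem mem_wall_iff (hI : I ≠ Finset.univ) :
    x ∈ wall Φ Δ G ε (simpleSpan Δ I) ↔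
      excessAt Φ Δ G ε x I = excessAt Φ Δ G ε x Finset.univ := by
  rw [← h.inner_eq_level_iff, ← h.wallNormal_of_ne hI, ← h.wallLevel_of_ne hI]
  rfl

theorem mem_wall_top : x ∈ wall Φ Δ G ε ⊤ ↔ excessAt Φ Δ G ε x Finset.univ = 0 := by
  rw [eq_comm, ← h.excessAt_empty x, ← h.inner_eq_level_iff, ← wallNormal_univ (G := G),
    ← h.wallLevel_top]
  rfl

theorem mem_halfSpace_iff (hI : I ≠ Finset.univ) :
    x ∈ halfSpace Φ Δ G ε (simpleSpan Δ I) ↔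
      excessAt Φ Δ G ε x Finset.univ ≤ excessAt Φ Δ G ε x I := by
  rw [← h.inner_le_level_iff, ← h.wallNormal_of_ne hI, ← h.wallLevel_of_ne hI]
  rfl

theorem mem_halfSpace_top : x ∈ halfSpace Φ Δ G ε ⊤ ↔ ⟪x, normal Φ Δ ∅⟫_ℝ ≤ level Δ G ε ∅ := by
  rw [← wallNormal_univ (G := G), ← h.wallLevel_top]
  rfl

theorem univ_nonempty : (Finset.univ : Finset (Fin n)).Nonempty :=
  h.family.nonempty _ h.univ_mem

theorem permutonestohedron_eq :
    permutonestohedron Φ Δ G ε = polyhedron (wallVec Φ Δ) (wallConst Φ Δ G ε) := by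
  have himg : ∀ (σ : V ≃ₗᵢ[ℝ] V) (s : Set V) (x : V), x ∈ (fun x : V => σ x) '' s ↔ σ⁻¹ x ∈ s := by
    intro σ s x
    constructor
    · rintro ⟨z, hz, rfl⟩
      show σ⁻¹ (σ z) ∈ s
      rwa [inv_apply_self']
    · exact fun hx => ⟨σ⁻¹ x, hx, apply_inv_self' σ x⟩
  have hin : ∀ (σ : V ≃ₗᵢ[ℝ] V) (x v : V), ⟪σ⁻¹ x, v⟫_ℝ = ⟪x, σ v⟫_ℝ := by
    intro σ x v
    rw [inner_apply_inv, inv_inv]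
  ext x
  simp only [permutonestohedron, Set.mem_iInter, himg]
  constructor
  · rintro hx ⟨⟨σ, I⟩, hI⟩
    show ⟪x, (σ : V ≃ₗᵢ[ℝ] V) (normal Φ Δ I)⟫_ℝ ≤ level Δ G ε I
    rw [← hin]
    by_cases hne : I.Nonempty
    · have h1 := hx σ σ.2 _ ⟨simpleSpan_mem_rootSpaces h.root h.simple hne, I, rfl⟩
      exact h.inner_le_level_iff.2 ((h.mem_halfSpace_iff hI).1 h1)
    · rw [Finset.not_nonempty_iff_eq_empty] at hne
      have h1 := hx σ σ.2 ⊤ ⟨by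
        rw [← simpleSpan_univ (Δ := Δ)]
        exact simpleSpan_mem_rootSpaces h.root h.simple h.univ_nonempty, Set.univ, by simp⟩
      rw [hne]
      exact h.mem_halfSpace_top.1 h1
  · intro hx σ hσ C hC
    obtain ⟨I, hI, rfl⟩ := mem_fund_iff.1 hC
    by_cases hu : I = Finset.univ
    · rw [hu, simpleSpan_univ, h.mem_halfSpace_top, hin]
      exact hx ⟨⟨⟨σ, hσ⟩, ∅⟩, fun h' => by
        have := h.univ_nonempty
        rw [← h'] at this
        exact Finset.not_nonempty_empty this⟩
    · rw [h.mem_halfSpace_iff hu, ← h.inner_le_level_iff, hin]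
      exact hx ⟨⟨⟨σ, hσ⟩, I⟩, hu⟩

/-- The projection is nonnegative on simple roots in I, so by obtuseness it pairs nonpositively with
those outside I. -/
theorem isDominant_normal (I : Finset (Fin n)) : IsDominant Δ (normal Φ Δ I) := by
  intro i
  by_cases hi : i ∈ I
  · exact (inner_normal_of_mem (simple_mem_simpleSpan.2 hi)).ge
  · rw [normal, inner_sub_left, sub_nonneg]
    refine le_trans ?_ (inner_delta_simple_pos h.root h.simple i).le
    rw [real_inner_comm, inner_eq_sum_repr Δ]
    refine Finset.sum_nonpos fun k _ => ?_
    by_cases hk : i = k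
    · subst hk
      rw [mem_simpleSpan.1 (piVec_mem _) i hi, zero_mul]
    · exact mul_nonpos_of_nonneg_of_nonpos (coef_nonneg h.root h.simple I k)
        (inner_simple_nonpos h.root h.simple hk)

theorem inner_normal_simple_eq_zero {i : Fin n} : ⟪normal Φ Δ I, Δ i⟫_ℝ = 0 ↔ i ∈ I := by
  refine ⟨fun h0 => ?_, fun hi => inner_normal_of_mem (simple_mem_simpleSpan.2 hi)⟩
  by_contra hi
  rw [normal, inner_sub_left, sub_eq_zero] at h0
  have h1 := inner_delta_simple_pos h.root h.simple i
  rw [h0, real_inner_comm, inner_eq_sum_repr Δ] at h1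
  refine h1.not_ge (Finset.sum_nonpos fun k _ => ?_)
  by_cases hk : i = k
  · subst hk
    rw [mem_simpleSpan.1 (piVec_mem _) i hi, zero_mul]
  · exact mul_nonpos_of_nonneg_of_nonpos (coef_nonneg h.root h.simple I k)
      (inner_simple_nonpos h.root h.simple hk)

/-- The normal is dominant and orthogonal to exactly the simple roots in I, so its stabilizer is
W_I. -/
theorem apply_normal_iff (hσ : σ ∈ coxeterGroup Φ) :
    σ (normal Φ Δ I) = normal Φ Δ I ↔ σ ∈ parabolic Φ (simpleSpan Δ I) := by
  constructor
  · intro h'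
    have h1 := mem_parabolic_of_apply_eq_self h.root h.simple hσ (h.isDominant_normal I) h'
    have h2 : {i | ⟪normal Φ Δ I, Δ i⟫_ℝ = 0} = (I : Set (Fin n)) := by
      ext i
      exact h.inner_normal_simple_eq_zero
    rwa [h2] at h1
  · intro h'
    refine apply_eq_self_of_mem_parabolic h' fun β hβ => ?_
    rw [real_inner_comm]
    exact inner_normal_of_mem hβ

theorem mem_tightAt_iff {j : WallIndex Φ n} :
    j ∈ tightAt (wallVec Φ Δ) (wallConst Φ Δ G ε) x ↔
      ⟪x, (j.1.1 : V ≃ₗᵢ[ℝ] V) (normal Φ Δ j.1.2)⟫_ℝ = level Δ G ε j.1.2 := Iff.rfl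

theorem mem_polyhedron_iff : x ∈ polyhedron (wallVec Φ Δ) (wallConst Φ Δ G ε) ↔
    ∀ σ ∈ coxeterGroup Φ, ∀ I : Finset (Fin n), I ≠ Finset.univ →
      ⟪x, σ (normal Φ Δ I)⟫_ℝ ≤ level Δ G ε I :=
  ⟨fun hx σ hσ I hI => hx ⟨⟨⟨σ, hσ⟩, I⟩, hI⟩, fun hx j => hx _ j.1.1.2 _ j.2⟩

theorem excessAt_le (hx : x ∈ polyhedron (wallVec Φ Δ) (wallConst Φ Δ G ε))
    (I : Finset (Fin n)) : excessAt Φ Δ G ε x Finset.univ ≤ excessAt Φ Δ G ε x I := by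
  by_cases hI : I = Finset.univ
  · rw [hI]
  · exact h.inner_le_level_iff.1 (h.mem_polyhedron_iff.1 hx 1 (Subgroup.one_mem _) I hI)

/-- For a dominant point the untranslated inequalities are the strongest ones. -/
theorem mem_of_dominant (hx : IsDominant Δ x)
    (hmin : ∀ I, excessAt Φ Δ G ε x Finset.univ ≤ excessAt Φ Δ G ε x I) :
    x ∈ polyhedron (wallVec Φ Δ) (wallConst Φ Δ G ε) :=
  h.mem_polyhedron_iff.2 fun _ hσ I _ =>
    (inner_apply_le h.root h.simple hσ hx (h.isDominant_normal I)).trans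
      (h.inner_le_level_iff.2 (hmin I))

theorem apply_mem (hw : w ∈ coxeterGroup Φ)
    (hx : x ∈ polyhedron (wallVec Φ Δ) (wallConst Φ Δ G ε)) :
    w x ∈ polyhedron (wallVec Φ Δ) (wallConst Φ Δ G ε) := by
  refine h.mem_polyhedron_iff.2 fun σ hσ I hI => ?_
  rw [inner_apply_inv]
  exact h.mem_polyhedron_iff.1 hx (w⁻¹ * σ)
    (Subgroup.mul_mem _ (Subgroup.inv_mem _ hw) hσ) I hI

/-- The inequalities that are tight at a dominant point. -/
theorem mem_tightAt_of_dominant (hx : IsDominant Δ x)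
    (hxP : x ∈ polyhedron (wallVec Φ Δ) (wallConst Φ Δ G ε)) {j : WallIndex Φ n} :
    j ∈ tightAt (wallVec Φ Δ) (wallConst Φ Δ G ε) x ↔
      excessAt Φ Δ G ε x j.1.2 = excessAt Φ Δ G ε x Finset.univ ∧
        (j.1.1 : V ≃ₗᵢ[ℝ] V) ∈ parabolic Φ (simpleSpan Δ j.1.2) := by
  rw [h.mem_tightAt_iff, ← h.apply_normal_iff j.1.1.2]
  constructor
  · intro h1
    have h2 := inner_apply_le h.root h.simple j.1.1.2 hx (h.isDominant_normal j.1.2)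
    have h3 := h.inner_le_level_iff.2 (h.excessAt_le hxP j.1.2)
    -- Equality at σ forces equality throughout ⟪x, σn⟫ ≤ ⟪x, n⟫ ≤ level.
    have h4 : ⟪x, normal Φ Δ j.1.2⟫_ℝ = level Δ G ε j.1.2 := le_antisymm h3 (h1 ▸ h2)
    have h5 := h.inner_eq_level_iff.1 h4
    refine ⟨h5, apply_eq_of_inner_eq h.root h.simple j.1.1.2 hx (h.isDominant_normal _) ?_
      (h1.trans h4.symm)⟩
    intro i hi
    -- The equality case needs every simple root orthogonal to x to be orthogonal to the normal;
    -- such a root lies in I because I is tight.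
    exact h.inner_normal_simple_eq_zero.2
      (h.weight.mem_of_tight (y := fun i => ⟪x, Δ i⟫_ℝ) hx (h.excessAt_le hxP) h5 hi)
  · rintro ⟨h1, h2⟩
    rw [h2]
    exact h.inner_eq_level_iff.2 h1

/-- Every dominant point can be moved into the open chamber without leaving the relative interior
of its face. -/
theorem exists_regular (hx : IsDominant Δ x)
    (hxP : x ∈ polyhedron (wallVec Φ Δ) (wallConst Φ Δ G ε)) :
    ∃ x' ∈ polyhedron (wallVec Φ Δ) (wallConst Φ Δ G ε), (∀ i, 0 < ⟪x', Δ i⟫_ℝ) ∧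
      tightAt (wallVec Φ Δ) (wallConst Φ Δ G ε) x' =
        tightAt (wallVec Φ Δ) (wallConst Φ Δ G ε) x := by
  classical
  have := h.root.finite_coxeterGroup
  set K : Finset (Fin n) := Finset.univ.filter fun i => ⟪x, Δ i⟫_ℝ = 0 with hK
  -- The projection of δ to the span of the simple roots orthogonal to x pairs positively with them.
  -- As every tight set contains K, it is orthogonal to all tight normals.
  set v := piVec Φ Δ (simpleSpan Δ K) with hv
  have hvt : ∀ j ∈ tightAt (wallVec Φ Δ) (wallConst Φ Δ G ε) x, ⟪v, wallVec Φ Δ j⟫_ℝ = 0 := by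
    intro j hj
    obtain ⟨h1, h2⟩ := (h.mem_tightAt_of_dominant hx hxP).1 hj
    rw [wallVec, (h.apply_normal_iff j.1.1.2).2 h2, real_inner_comm]
    refine inner_normal_of_mem (simpleSpan_le_simpleSpan.2 (fun i hi => ?_) (piVec_mem _))
    exact h.weight.mem_of_tight (y := fun i => ⟪x, Δ i⟫_ℝ) hx (h.excessAt_le hxP) h1
      (Finset.mem_filter.1 hi).2
  have hpos : ∀ᶠ t : ℝ in nhdsWithin 0 (Set.Ioi 0), ∀ i, 0 < ⟪x + t • v, Δ i⟫_ℝ := by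
    refine Filter.eventually_all.2 fun i => ?_
    by_cases hi : ⟪x, Δ i⟫_ℝ = 0
    · filter_upwards [self_mem_nhdsWithin] with t ht
      rw [inner_add_left, hi, zero_add, real_inner_smul_left, hv,
        inner_piVec (simple_mem_simpleSpan.2 (Finset.mem_filter.2 ⟨Finset.mem_univ i, hi⟩))]
      exact mul_pos ht (inner_delta_simple_pos h.root h.simple i)
    · have hcont : Continuous fun t : ℝ => ⟪x + t • v, Δ i⟫_ℝ := by fun_prop
      have h1 : Filter.Tendsto (fun t : ℝ => ⟪x + t • v, Δ i⟫_ℝ) (nhds 0)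
          (nhds ⟪x, Δ i⟫_ℝ) := by
        simpa using hcont.tendsto 0
      exact (h1.mono_left nhdsWithin_le_nhds).eventually
        (lt_mem_nhds (lt_of_le_of_ne (hx i) (Ne.symm hi)))
  obtain ⟨t, ⟨h1, h2⟩, h3⟩ := ((eventually_step hxP hvt).and hpos).exists
  exact ⟨x + t • v, h1, h3, h2⟩

/-- An isometry of W makes a point dominant. Its coordinates are then nonnegative, and the
inequality of H_V bounds their positive combination ⟪w x, δ⟫ by `ε n`. -/
theorem isCompact : IsCompact (polyhedron (wallVec Φ Δ) (wallConst Φ Δ G ε)) := by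
  have hclosed : IsClosed (polyhedron (wallVec Φ Δ) (wallConst Φ Δ G ε)) := by
    have : polyhedron (wallVec Φ Δ) (wallConst Φ Δ G ε) =
        ⋂ j, {z | ⟪z, wallVec Φ Δ j⟫_ℝ ≤ wallConst Φ Δ G ε j} := by
      ext z
      simp [polyhedron]
    rw [this]
    exact isClosed_iInter fun j => isClosed_le (by fun_prop) continuous_const
  obtain ⟨k, -, hk⟩ := (coords Δ).exists_antilipschitzWith (ker_coords (Δ := Δ))
  have hbd := hk.isBounded_preimage (s := Set.Icc 0 fun i => ε n / coef Φ Δ Finset.univ i)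
    (Metric.isBounded_Icc _ _)
  obtain ⟨M, hM⟩ := hbd.exists_norm_le
  refine Metric.isCompact_of_isClosed_isBounded hclosed
    (isBounded_iff_forall_norm_le.2 ⟨M, fun x hx => ?_⟩)
  obtain ⟨w, hw, hdom⟩ := exists_dominant h.root h.simple x
  rw [← w.norm_map]
  have hwx := h.apply_mem hw hx
  refine hM _ ⟨fun i => ?_, fun i => ?_⟩
  · rw [coords_apply]
    exact hdom i
  · rw [coords_apply, le_div_iff₀ (coef_pos h.root h.simple (Finset.mem_univ i))]
    have h1 := h.excessAt_le hwx ∅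
    rw [h.excessAt_empty, h.excessAt_univ, sub_nonpos] at h1
    refine le_trans ?_ h1
    rw [← piVec_top (Φ := Φ) (Δ := Δ), ← simpleSpan_univ (Δ := Δ), inner_piVec_eq_wsum, wsum,
      mul_comm]
    exact Finset.single_le_sum (f := fun i => coef Φ Δ Finset.univ i * ⟪w x, Δ i⟫_ℝ)
      (fun i _ => mul_nonneg (coef_nonneg h.root h.simple _ _) (hdom i)) (Finset.mem_univ i)

end IsAdmissible

end Geometry

/-! ### Faces of generic points: inclusion, convex hulls and dimension -/

section Faces

variable {V : Type*} [NormedAddCommGroup V] [InnerProductSpace ℝ V] [FiniteDimensional ℝ V]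
  {Φ : Finset V} {n : ℕ} {Δ : Module.Basis (Fin n) ℝ V} {G : Set (Submodule ℝ V)} {ε : ℕ → ℝ}
  {I D D' : Finset (Fin n)} {S S' : Finset (Finset (Fin n))} {x x' z : V} {σ : V ≃ₗᵢ[ℝ] V}

/-- The face of the permutonestohedron that corresponds to the trivial coset and to a labelled
nested set. -/
def stdFace (Φ : Finset V) (Δ : Module.Basis (Fin n) ℝ V) (G : Set (Submodule ℝ V)) (ε : ℕ → ℝ)
    (S : Finset (Finset (Fin n))) (D : Finset (Fin n)) : Set V :=
  {z | z ∈ polyhedron (wallVec Φ Δ) (wallConst Φ Δ G ε) ∧ ∀ I, IsFaceSet (indexFamily Δ G) S D I →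
    excessAt Φ Δ G ε z I = excessAt Φ Δ G ε z Finset.univ}

/-- A point of the open chamber in the relative interior of the face of `(S, D)`. -/
structure IsGeneric (Φ : Finset V) (Δ : Module.Basis (Fin n) ℝ V) (G : Set (Submodule ℝ V))
    (ε : ℕ → ℝ) (S : Finset (Finset (Fin n))) (D : Finset (Fin n)) (x : V) : Prop where
  mem : x ∈ polyhedron (wallVec Φ Δ) (wallConst Φ Δ G ε)
  pos : ∀ i, 0 < ⟪x, Δ i⟫_ℝ
  tight_iff : ∀ I, excessAt Φ Δ G ε x I = excessAt Φ Δ G ε x Finset.univ ↔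
    IsFaceSet (indexFamily Δ G) S D I

/-- s_i moves Δ i by -2 Δ i, while W_D moves vectors only along the span of D. -/
theorem parabolic_simpleSpan_le_iff (hΦ : IsRootSystem Φ) (hΔ : IsSimpleSystem Φ Δ) :
    parabolic Φ (simpleSpan Δ D') ≤ parabolic Φ (simpleSpan Δ D) ↔ D' ⊆ D := by
  refine ⟨fun h i hi => ?_, fun h => parabolic_mono Φ (simpleSpan_le_simpleSpan.2 h)⟩
  have h1 := apply_sub_self_mem_of_mem_parabolic
    (h (refl_mem_parabolic (hΔ.mem i) (simple_mem_simpleSpan.2 hi))) (Δ i)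
  rw [refl_self (hΦ.ne_zero (hΔ.mem i)), ← neg_add', Submodule.neg_mem_iff, ← two_smul ℝ,
    Submodule.smul_mem_iff _ two_ne_zero] at h1
  exact simple_mem_simpleSpan.1 h1

theorem IsLabelledNested.unlabelled (hS : IsLabelledNested (indexFamily Δ G) S D)
    (h𝓑 : IsBuildingFamily (indexFamily Δ G)) : IsLabelledNested (indexFamily Δ G) S ∅ :=
  ⟨hS.subset, hS.nested, hS.univ_mem, by simp [h𝓑.comps_empty], by simp [h𝓑.comps_empty]⟩

namespace IsAdmissible

variable (h : IsAdmissible Φ Δ G ε)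
include h

theorem exists_isGeneric (hS : IsLabelledNested (indexFamily Δ G) S D) :
    ∃ x, IsGeneric Φ Δ G ε S D x := by
  obtain ⟨y, h1, h2, h3⟩ := h.weight.exists_point hS
  obtain ⟨x, hx⟩ := exists_coords_eq (Δ := Δ) y
  have hy : (fun i => ⟪x, Δ i⟫_ℝ) = y := funext hx
  have hpos : ∀ i, 0 < ⟪x, Δ i⟫_ℝ := fun i => (hx i).symm ▸ h1 i
  refine ⟨x, h.mem_of_dominant (fun i => (hpos i).le) fun I => ?_, hpos, fun I => ?_⟩
  · rw [excessAt, excessAt, hy]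
    exact h2 I
  · rw [excessAt, excessAt, hy]
    exact h3 I

theorem mem_tightAt_apply (hσ : σ ∈ coxeterGroup Φ) {j : WallIndex Φ n} :
    j ∈ tightAt (wallVec Φ Δ) (wallConst Φ Δ G ε) (σ x) ↔
      (⟨⟨⟨σ⁻¹, Subgroup.inv_mem _ hσ⟩ * j.1.1, j.1.2⟩, j.2⟩ : WallIndex Φ n) ∈
        tightAt (wallVec Φ Δ) (wallConst Φ Δ G ε) x := by
  rw [h.mem_tightAt_iff, h.mem_tightAt_iff, inner_apply_inv]
  rfl

theorem mem_faceOf_apply_iff (hσ : σ ∈ coxeterGroup Φ) :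
    σ z ∈ faceOf (wallVec Φ Δ) (wallConst Φ Δ G ε) (σ x) ↔
      z ∈ faceOf (wallVec Φ Δ) (wallConst Φ Δ G ε) x := by
  have key : ∀ {σ : V ≃ₗᵢ[ℝ] V} {x z : V}, σ ∈ coxeterGroup Φ →
      z ∈ faceOf (wallVec Φ Δ) (wallConst Φ Δ G ε) x →
      σ z ∈ faceOf (wallVec Φ Δ) (wallConst Φ Δ G ε) (σ x) := by
    intro σ x z hσ hz
    refine ⟨h.apply_mem hσ hz.1, fun j hj => ?_⟩
    rw [h.mem_tightAt_apply hσ] at hj ⊢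
    exact hz.2 hj
  refine ⟨fun hz => ?_, key hσ⟩
  have := key (Subgroup.inv_mem _ hσ) hz
  rwa [inv_apply_self', inv_apply_self'] at this

theorem faceOf_apply (hσ : σ ∈ coxeterGroup Φ) (x : V) :
    faceOf (wallVec Φ Δ) (wallConst Φ Δ G ε) (σ x) =
      (fun z : V => σ z) '' faceOf (wallVec Φ Δ) (wallConst Φ Δ G ε) x := by
  ext z
  constructor
  · intro hz
    refine ⟨σ⁻¹ z, ?_, apply_inv_self' σ z⟩
    rwa [← h.mem_faceOf_apply_iff hσ, apply_inv_self']
  · rintro ⟨z, hz, rfl⟩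
    exact (h.mem_faceOf_apply_iff hσ).2 hz

theorem mem_tightAt_of_isGeneric (hx : IsGeneric Φ Δ G ε S D x) (hσ : σ ∈ coxeterGroup Φ)
    {j : WallIndex Φ n} :
    j ∈ tightAt (wallVec Φ Δ) (wallConst Φ Δ G ε) (σ x) ↔
      IsFaceSet (indexFamily Δ G) S D j.1.2 ∧
        σ⁻¹ * (j.1.1 : V ≃ₗᵢ[ℝ] V) ∈ parabolic Φ (simpleSpan Δ j.1.2) := by
  rw [h.mem_tightAt_apply hσ, h.mem_tightAt_of_dominant (fun i => (hx.pos i).le) hx.mem,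
    hx.tight_iff]
  rfl

theorem mem_tightAt_of_isGeneric_one (hx : IsGeneric Φ Δ G ε S D x) {j : WallIndex Φ n} :
    j ∈ tightAt (wallVec Φ Δ) (wallConst Φ Δ G ε) x ↔
      IsFaceSet (indexFamily Δ G) S D j.1.2 ∧
        (j.1.1 : V ≃ₗᵢ[ℝ] V) ∈ parabolic Φ (simpleSpan Δ j.1.2) := by
  rw [h.mem_tightAt_of_dominant (fun i => (hx.pos i).le) hx.mem, hx.tight_iff]

theorem faceOf_eq_stdFace (hx : IsGeneric Φ Δ G ε S D x) :
    faceOf (wallVec Φ Δ) (wallConst Φ Δ G ε) x = stdFace Φ Δ G ε S D := by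
  ext z
  refine and_congr_right fun hz => ⟨fun hxz I hI => ?_, fun hxz j hj => ?_⟩
  · by_cases hu : I = Finset.univ
    · rw [hu]
    · exact h.inner_eq_level_iff.1 (hxz (a := ⟨⟨1, I⟩, hu⟩)
        ((h.mem_tightAt_of_isGeneric_one hx).2 ⟨hI, Subgroup.one_mem _⟩))
  · obtain ⟨h1, h2⟩ := (h.mem_tightAt_of_isGeneric_one hx).1 hj
    rw [h.mem_tightAt_iff, (h.apply_normal_iff j.1.1.2).2 h2]
    exact h.inner_eq_level_iff.2 (hxz _ h1)

/-- Inclusion between the faces of two generic points. -/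
theorem faceOf_subset_iff_of_isGeneric (hS : IsLabelledNested (indexFamily Δ G) S D)
    (hS' : IsLabelledNested (indexFamily Δ G) S' D') (hx : IsGeneric Φ Δ G ε S D x)
    (hx' : IsGeneric Φ Δ G ε S' D' x') (hσ : σ ∈ coxeterGroup Φ) :
    faceOf (wallVec Φ Δ) (wallConst Φ Δ G ε) (σ x') ⊆
        faceOf (wallVec Φ Δ) (wallConst Φ Δ G ε) x ↔
      (S ⊆ S' ∧ D' ⊆ D) ∧ σ ∈ parabolic Φ (simpleSpan Δ D) := by
  rw [faceOf_subset_iff (h.apply_mem hσ hx'.mem), ← hS.forall_isFaceSet_imp_iff h.family]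
  constructor
  · intro hsub
    have key : ∀ I, I ≠ Finset.univ → IsFaceSet (indexFamily Δ G) S D I →
        IsFaceSet (indexFamily Δ G) S' D' I ∧ σ ∈ parabolic Φ (simpleSpan Δ I) := by
      intro I hu hI
      have h1 := (h.mem_tightAt_of_isGeneric hx' hσ).1 (hsub (a := ⟨⟨1, I⟩, hu⟩)
        ((h.mem_tightAt_of_isGeneric_one hx).2 ⟨hI, Subgroup.one_mem _⟩))
      refine ⟨h1.1, ?_⟩
      have h2 := h1.2
      rwa [Subgroup.coe_one, mul_one, Subgroup.inv_mem_iff] at h2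
    refine ⟨fun I hI => ?_, ?_⟩
    · by_cases hu : I = Finset.univ
      · rw [hu]
        exact hS'.isFaceSet_univ
      · exact (key I hu hI).1
    -- The full set indexes no wall, but then W_D is all of W.
    · by_cases hu : D = Finset.univ
      · rwa [hu, simpleSpan_univ, parabolic_top]
      · exact (key D hu hS.isFaceSet_label).2
  · rintro ⟨h1, h2⟩ j hj
    obtain ⟨h3, h4⟩ := (h.mem_tightAt_of_isGeneric_one hx).1 hj
    exact (h.mem_tightAt_of_isGeneric hx' hσ).2 ⟨h1 _ h3, Subgroup.mul_mem _ (Subgroup.inv_mem _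
      (parabolic_mono Φ (simpleSpan_le_simpleSpan.2 h3.2) h2)) h4⟩

/-- Every face is the image of the face of a generic point. -/
theorem exists_faceOf_eq (hx : x ∈ polyhedron (wallVec Φ Δ) (wallConst Φ Δ G ε)) :
    ∃ σ ∈ coxeterGroup Φ, ∃ S D x', IsLabelledNested (indexFamily Δ G) S D ∧
      IsGeneric Φ Δ G ε S D x' ∧ faceOf (wallVec Φ Δ) (wallConst Φ Δ G ε) x =
        faceOf (wallVec Φ Δ) (wallConst Φ Δ G ε) (σ x') := by
  obtain ⟨w, hw, hdom⟩ := exists_dominant h.root h.simple x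
  obtain ⟨x', hx', hpos, htight⟩ := h.exists_regular hdom (h.apply_mem hw hx)
  obtain ⟨S, D, hS, hSD⟩ := h.weight.exists_labelledNested hpos (h.excessAt_le hx')
  refine ⟨w⁻¹, Subgroup.inv_mem _ hw, S, D, x', hS, ⟨hx', hpos, hSD⟩, ?_⟩
  rw [h.faceOf_apply (Subgroup.inv_mem _ hw), faceOf_congr htight,
    ← h.faceOf_apply (Subgroup.inv_mem _ hw), inv_apply_self']

theorem stdFace_nonempty (hS : IsLabelledNested (indexFamily Δ G) S D) :
    (stdFace Φ Δ G ε S D).Nonempty := by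
  obtain ⟨x, hx⟩ := h.exists_isGeneric hS
  exact ⟨x, hx.mem, fun I => (hx.tight_iff I).2⟩

theorem apply_mem_stdFace (hσ : σ ∈ parabolic Φ (simpleSpan Δ D))
    (hz : z ∈ stdFace Φ Δ G ε S D) : σ z ∈ stdFace Φ Δ G ε S D := by
  have hσW := parabolic_le Φ _ hσ
  refine ⟨h.apply_mem hσW hz.1, fun I hI => ?_⟩
  rw [← h.inner_eq_level_iff, inner_apply_inv,
    (h.apply_normal_iff (Subgroup.inv_mem _ hσW)).2 (Subgroup.inv_mem _
      (parabolic_mono Φ (simpleSpan_le_simpleSpan.2 hI.2) hσ))]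
  exact h.inner_eq_level_iff.2 (hz.2 I hI)

/-- A face of the compact P is the hull of the vertices of P on it. Each such vertex is σ of a
generic point of some (S', D') with S ⊆ S' and σ ∈ W_D, and that generic point lies on the
nestohedron face of S. -/
theorem stdFace_eq_convexHull (hS : IsLabelledNested (indexFamily Δ G) S D) :
    stdFace Φ Δ G ε S D = convexHull ℝ (⋃ g ∈ parabolic Φ (simpleSpan Δ D),
      (fun z : V => g z) '' stdFace Φ Δ G ε S ∅) := by
  have := h.root.finite_coxeterGroup
  obtain ⟨x, hx⟩ := h.exists_isGeneric hS
  have hface := h.faceOf_eq_stdFace hx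
  refine Set.Subset.antisymm ?_ (convexHull_min ?_ (hface ▸ convex_faceOf _ _ x))
  · rw [← hface, faceOf_eq_convexHull hx.mem h.isCompact]
    refine convexHull_mono ?_
    rintro z ⟨hz, hzext⟩
    obtain ⟨σ, hσ, S', D', x', hS', hx', he⟩ := h.exists_faceOf_eq hz.1
    have h1 : z = σ x' := by
      have h2 := self_mem_faceOf (h.apply_mem hσ hx'.mem)
      rw [← he, faceOf_extreme hzext] at h2
      exact h2.symm
    obtain ⟨⟨hSS', -⟩, hσD⟩ := (h.faceOf_subset_iff_of_isGeneric hS hS' hx hx' hσ).1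
      (h1 ▸ fun y hy => ⟨hy.1, hz.2.trans hy.2⟩)
    refine Set.mem_biUnion hσD ⟨x', ?_, h1.symm⟩
    -- Removing the labels of S' gives a nonempty subset of a face that is a single vertex; hence
    -- the vertex already satisfies the unlabelled equations.
    obtain ⟨y, hy⟩ := h.stdFace_nonempty (hS'.unlabelled h.family)
    have h3 : σ y ∈ faceOf (wallVec Φ Δ) (wallConst Φ Δ G ε) (σ x') := by
      rw [h.mem_faceOf_apply_iff hσ, h.faceOf_eq_stdFace hx']
      exact ⟨hy.1, fun I hI => hy.2 I ⟨hI.1, Finset.empty_subset I⟩⟩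
    rw [← he, faceOf_extreme hzext, Set.mem_singleton_iff, h1, σ.injective.eq_iff] at h3
    rw [← h3]
    exact ⟨hy.1, fun I hI => hy.2 I ⟨hI.1.trans hSS', hI.2⟩⟩
  · refine Set.iUnion₂_subset fun g hg => ?_
    rintro _ ⟨z, hz, rfl⟩
    exact h.apply_mem_stdFace hg
      ⟨hz.1, fun I hI => hz.2 I ⟨hI.1, Finset.empty_subset I⟩⟩

/-- On H_V the full set has excess 0, so the half-spaces say that members of the family have
nonnegative excess; additivity extends this to every I. Conversely ∅ is a face set when there are no
labels, which yields H_V. -/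
theorem nestFace_eq_stdFace (hS : IsLabelledNested (indexFamily Δ G) S D) :
    nestFace Φ Δ G ε (simpleSpan Δ '' (S : Set (Finset (Fin n)))) = stdFace Φ Δ G ε S ∅ := by
  ext z
  simp only [nestFace, nestohedron, Set.mem_inter_iff, Set.mem_iInter, Set.forall_mem_image]
  constructor
  · rintro ⟨⟨h1, h2⟩, h3⟩
    have h4 := h.mem_wall_top.1 h1
    have hmem : ∀ A ∈ indexFamily Δ G, 0 ≤ excessAt Φ Δ G ε z A := by
      intro A hA
      by_cases hu : A = Finset.univ
      · rw [hu, h4]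
      · rw [← h4]
        exact (h.mem_halfSpace_iff hu).1 (h2 _ ⟨simpleSpan_mem_fund_iff.2 hA,
          fun e => hu (simpleSpan_eq_top.1 e)⟩)
    have hsum := (h.sepAdditive_excessAt z).sum_comps h.family
    refine ⟨h.mem_of_dominant (fun i => ?_) fun I => ?_, fun I hI => ?_⟩
    · have h5 := hmem {i} (h.family.singleton_mem i)
      have h6 := eps_pos h.root h.simple h.building h.suitable le_rfl
        (show 1 ≤ n from Fin.pos_iff_nonempty.2 ⟨i⟩)
      rw [excessAt, excess, epsSum, comps_of_mem (h.family.singleton_mem i),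
        Finset.sum_singleton, Finset.card_singleton, wsum, Finset.sum_singleton] at h5
      have h7 := coef_pos h.root h.simple (Finset.mem_singleton_self i)
      exact (pos_of_mul_pos_right (a := coef Φ Δ {i} i) (by linarith) h7.le).le
    · rw [h4, hsum I]
      exact Finset.sum_nonneg fun A hA => hmem A (mem_of_mem_comps hA)
    · rw [h4, hsum I]
      refine Finset.sum_eq_zero fun A hA => ?_
      by_cases hu : A = Finset.univ
      · rw [hu, h4]
      · rw [← h4]
        exact (h.mem_wall_iff hu).1 (h3 (hI.1 hA))
  · rintro ⟨h1, h2⟩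
    have h3 := h2 ∅ ⟨by simp [h.family.comps_empty], subset_rfl⟩
    rw [h.excessAt_empty] at h3
    refine ⟨⟨h.mem_wall_top.2 h3.symm, fun C hC => ?_⟩, fun A hA => ?_⟩
    · obtain ⟨A, hA, rfl⟩ := mem_fund_iff.1 hC.1
      exact (h.mem_halfSpace_iff fun e => hC.2 (simpleSpan_eq_top.2 e)).2 (h.excessAt_le h1 A)
    · by_cases hu : A = Finset.univ
      · rw [hu, simpleSpan_univ]
        exact h.mem_wall_top.2 h3.symm
      · refine (h.mem_wall_iff hu).2 (h2 A ⟨?_, Finset.empty_subset A⟩)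
        rw [comps_of_mem (hS.subset A hA)]
        exact Finset.singleton_subset_iff.2 hA

/-- The direction space is the kernel of a map with one coordinate for each unlabelled element of S.
That map is onto because the forms of a nested set take arbitrary values. -/
theorem finrank_direction (hS : IsLabelledNested (indexFamily Δ G) S D) :
    Module.finrank ℝ (affineSpan ℝ (stdFace Φ Δ G ε S D)).direction + S.card =
      n + (comps (indexFamily Δ G) D).card := by
  have := h.root.finite_coxeterGroup
  obtain ⟨x, hx⟩ := h.exists_isGeneric hS
  rw [← h.faceOf_eq_stdFace hx]
  set R := S \ comps (indexFamily Δ G) D with hR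
  let L : V →ₗ[ℝ] (R → ℝ) := LinearMap.pi fun B =>
    (innerSL ℝ (piVec Φ Δ (simpleSpan Δ B.1) - piVec Φ Δ (simpleSpan Δ (D ∩ B.1)))).toLinearMap
  have hL : ∀ v B, L v B = wsum (coef Φ Δ) (fun i => ⟪v, Δ i⟫_ℝ) B.1 -
      wsum (coef Φ Δ) (fun i => ⟪v, Δ i⟫_ℝ) (D ∩ B.1) := by
    intro v B
    rw [← inner_piVec_eq_wsum, ← inner_piVec_eq_wsum, ← inner_sub_right, real_inner_comm]
    rfl
  have hnormal : ∀ v I, ⟪v, normal Φ Δ I⟫_ℝ = wsum (coef Φ Δ) (fun i => ⟪v, Δ i⟫_ℝ) Finset.univ -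
      wsum (coef Φ Δ) (fun i => ⟪v, Δ i⟫_ℝ) I := by
    intro v I
    rw [← inner_piVec_eq_wsum, ← inner_piVec_eq_wsum, ← inner_sub_right, simpleSpan_univ, piVec_top]
    rfl
  have hker : (affineSpan ℝ (faceOf (wallVec Φ Δ) (wallConst Φ Δ G ε) x)).direction =
      LinearMap.ker L := by
    ext v
    have h1 := hS.eq_inter_iff_of_tight h.family
      (h.weight.sepAdditive_wsum fun i => ⟪v, Δ i⟫_ℝ)
    rw [mem_direction_faceOf hx.mem, LinearMap.mem_ker]
    have h2 : L v = 0 ↔ ∀ B ∈ R, wsum (coef Φ Δ) (fun i => ⟪v, Δ i⟫_ℝ) B =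
        wsum (coef Φ Δ) (fun i => ⟪v, Δ i⟫_ℝ) (D ∩ B) := by
      rw [funext_iff, Subtype.forall]
      simp only [hL, Pi.zero_apply, sub_eq_zero]
    rw [h2, ← h1]
    constructor
    · intro hv I hI
      by_cases hu : I = Finset.univ
      · rw [hu]
      · have h3 := hv ⟨⟨1, I⟩, hu⟩
          ((h.mem_tightAt_of_isGeneric_one hx).2 ⟨hI, Subgroup.one_mem _⟩)
        have h4 : ⟪v, normal Φ Δ I⟫_ℝ = 0 := h3
        rw [hnormal] at h4
        linarith
    · intro hv j hj
      obtain ⟨h3, h4⟩ := (h.mem_tightAt_of_isGeneric_one hx).1 hj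
      rw [wallVec, (h.apply_normal_iff j.1.1.2).2 h4, hnormal, hv _ h3, sub_self]
  have hsurj : LinearMap.range L = ⊤ := by
    rw [LinearMap.range_eq_top]
    intro b
    obtain ⟨cell, hc⟩ := hS.exists_isCell h.family
    obtain ⟨y, hy⟩ := hc.exists_wsum_eq hS h.family h.weight
      fun A => if hA : A ∈ R then b ⟨A, hA⟩ else 0
    obtain ⟨v, hv⟩ := exists_coords_eq (Δ := Δ) y
    have hv' : (fun i => ⟪v, Δ i⟫_ℝ) = y := funext hv
    refine ⟨v, funext fun B => ?_⟩
    have hBS := (Finset.mem_sdiff.1 B.2).1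
    have h0 : wsum (coef Φ Δ) y (D ∩ B.1) = 0 := by
      -- The components of D ∩ B are labels, where the prescribed value is 0.
      rw [(h.weight.sepAdditive_wsum y).sum_comps h.family]
      refine Finset.sum_eq_zero fun C hC => ?_
      have hCD := h.family.comps_inter_subset (hS.mem_comps_union h.family hBS)
        Finset.subset_union_left hC
      rw [(hy C (hS.comps_subset hCD)).2, dif_neg fun hCR => (Finset.mem_sdiff.1 hCR).2 hCD]
    rw [hL, hv', h0, sub_zero, (hy B.1 hBS).2, dif_pos B.2]
  have hrank := LinearMap.finrank_range_add_finrank_ker L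
  rw [hsurj, finrank_top, Module.finrank_fintype_fun_eq_card, Fintype.card_coe,
    Module.finrank_eq_card_basis Δ, Fintype.card_fin, ← hker] at hrank
  have hcard := Finset.card_sdiff_add_card_eq_card hS.comps_subset
  rw [← hR] at hcard
  omega

end IsAdmissible

end Faces

/-! ### Refinement of labelled nested sets and the elementary moves -/

section Moves

variable {V : Type*} [NormedAddCommGroup V] [InnerProductSpace ℝ V] [FiniteDimensional ℝ V]
  {Φ : Finset V} {n : ℕ} {Δ : Module.Basis (Fin n) ℝ V} {G : Set (Submodule ℝ V)} {ε : ℕ → ℝ}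
  {Λ Λ' Λ₁ : LabelledNestedSet Δ G}

namespace LabelledNestedSet

open scoped Classical in
/-- The index sets of the members of a labelled nested set. -/
def sets (Λ : LabelledNestedSet Δ G) : Finset (Finset (Fin n)) :=
  Finset.univ.filter fun I => simpleSpan Δ I ∈ Λ.carrier

open scoped Classical in
/-- The union of the index sets of the members with nontrivial label. -/
def label (Λ : LabelledNestedSet Δ G) : Finset (Fin n) :=
  (Finset.univ.filter fun I => simpleSpan Δ I ∈ Λ.labelled).biUnion id

theorem ext_of_eq (h1 : Λ.carrier = Λ'.carrier) (h2 : Λ.labelled = Λ'.labelled) : Λ = Λ' := by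
  cases Λ
  cases Λ'
  cases h1
  cases h2
  rfl

theorem mem_sets {I : Finset (Fin n)} : I ∈ Λ.sets ↔ simpleSpan Δ I ∈ Λ.carrier := by
  simp [sets]

theorem exists_simpleSpan_eq (Λ : LabelledNestedSet Δ G) {A : Submodule ℝ V}
    (hA : A ∈ Λ.carrier) : ∃ I ∈ Λ.sets, simpleSpan Δ I = A := by
  obtain ⟨I, -, rfl⟩ := mem_fund_iff.1 (Λ.isNested.1 hA)
  exact ⟨I, mem_sets.2 hA, rfl⟩

theorem image_sets (Λ : LabelledNestedSet Δ G) :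
    simpleSpan Δ '' (Λ.sets : Set (Finset (Fin n))) = Λ.carrier := by
  ext A
  constructor
  · rintro ⟨I, hI, rfl⟩
    exact mem_sets.1 hI
  · exact Λ.exists_simpleSpan_eq

theorem finite_carrier (Λ : LabelledNestedSet Δ G) : Λ.carrier.Finite := by
  rw [← Λ.image_sets]
  exact Λ.sets.finite_toSet.image _

/-- The labelled nested sets inside the carrier of a labelled nested set. -/
def restrict (Λ : LabelledNestedSet Δ G) (C L : Set (Submodule ℝ V)) (hC : C ⊆ Λ.carrier)
    (htop : ⊤ ∈ C) (hL : ∀ A ∈ L, Minimal (fun A => A ∈ C) A) : LabelledNestedSet Δ G where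
  carrier := C
  isNested := ⟨hC.trans Λ.isNested.1, fun T hT => Λ.isNested.2 T (hT.trans hC)⟩
  top_mem := htop
  labelled := L
  minimal_of_labelled := hL

/-- `Λ'` refines `Λ`: it has more members and smaller labels. -/
def Refines (Λ' Λ : LabelledNestedSet Δ G) : Prop :=
  Λ.carrier ⊆ Λ'.carrier ∧ ∀ A ∈ Λ'.labelled, ∃ B ∈ Λ.labelled, A ≤ B

theorem Refines.refl (Λ : LabelledNestedSet Δ G) : Λ.Refines Λ :=
  ⟨subset_rfl, fun A hA => ⟨A, hA, le_rfl⟩⟩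

theorem Refines.trans (h1 : Λ'.Refines Λ₁) (h2 : Λ₁.Refines Λ) : Λ'.Refines Λ := by
  refine ⟨h2.1.trans h1.1, fun A hA => ?_⟩
  obtain ⟨B, hB, hAB⟩ := h1.2 A hA
  obtain ⟨C, hC, hBC⟩ := h2.2 B hB
  exact ⟨C, hC, hAB.trans hBC⟩

theorem Refines.labelled_subset (h : Λ'.Refines Λ) (hc : Λ'.carrier ⊆ Λ.carrier) :
    Λ'.labelled ⊆ Λ.labelled := by
  intro A hA
  obtain ⟨B, hB, hAB⟩ := h.2 A hA
  have := (Λ.minimal_of_labelled B hB).eq_of_le (hc (Λ'.minimal_of_labelled A hA).prop) hAB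
  rwa [this]

theorem Refines.antisymm (h1 : Λ'.Refines Λ) (h2 : Λ.Refines Λ') : Λ = Λ' :=
  ext_of_eq (h1.1.antisymm h2.1)
    ((h2.labelled_subset h1.1).antisymm (h1.labelled_subset h2.1))

theorem _root_.Permutonesto.Move.refines (h : Move Λ Λ') :
    Λ'.Refines Λ ∧ ¬ Λ.Refines Λ' := by
  cases h with
  | addNonMinimal C new above hc hl =>
    exact ⟨⟨hc ▸ Set.subset_insert _ _, fun A hA => ⟨A, hl ▸ hA, le_rfl⟩⟩,
      fun h => new (h.1 (hc ▸ Set.mem_insert _ _))⟩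
  | addTrivial A new minimal below hc hl =>
    exact ⟨⟨hc ▸ Set.subset_insert _ _, fun A hA => ⟨A, hl ▸ hA, le_rfl⟩⟩,
      fun h => new (h.1 (hc ▸ Set.mem_insert _ _))⟩
  | addLabelled B T nonempty new minimal labelled below hc hl =>
    refine ⟨⟨hc ▸ Set.subset_union_left, fun A hA => ?_⟩, fun h => ?_⟩
    · rw [hl] at hA
      rcases hA with hA | hA
      · exact ⟨A, hA.1, le_rfl⟩
      · exact ⟨B, labelled, below A hA⟩
    · obtain ⟨A, hA⟩ := nonempty
      exact new A hA (h.1 (hc ▸ Set.mem_union_right _ hA))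
  | dropLabel A labelled hc hl =>
    refine ⟨⟨hc.ge, fun B hB => ⟨B, ?_, le_rfl⟩⟩, fun h => ?_⟩
    · rw [hl] at hB
      exact hB.1
    · have := h.labelled_subset hc.ge labelled
      rw [hl] at this
      exact this.2 rfl

theorem _root_.Permutonesto.refines_of_transGen_move (h : Relation.TransGen Move Λ Λ') :
    Λ'.Refines Λ ∧ ¬ Λ.Refines Λ' := by
  induction h with
  | single h => exact h.refines
  | tail _ h ih =>
    exact ⟨h.refines.1.trans ih.1, fun h' => h.refines.2 (ih.1.trans h')⟩

variable (h𝓑 : IsBuildingFamily (indexFamily Δ G))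
include h𝓑

theorem isLabelledNested_empty (Λ : LabelledNestedSet Δ G) :
    IsLabelledNested (indexFamily Δ G) Λ.sets ∅ := by
  refine ⟨fun A hA => ?_, fun T hT hnt hanti hmem => ?_, ?_, by simp [h𝓑.comps_empty],
    by simp [h𝓑.comps_empty]⟩
  · exact (Λ.isNested.1 (mem_sets.1 hA)).1
  · refine Λ.isNested.2 (simpleSpan Δ '' (T : Set (Finset (Fin n)))) ?_ ?_ ?_ ?_
    · rintro _ ⟨A, hA, rfl⟩
      exact mem_sets.1 (hT hA)
    · exact (show (T : Set (Finset (Fin n))).Nontrivial from hnt).image simpleSpan_injective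
    · rintro _ ⟨A, hA, rfl⟩ _ ⟨B, hB, rfl⟩ hne hle
      exact hanti hA hB (fun e => hne (e ▸ rfl)) (simpleSpan_le_simpleSpan.1 hle)
    · rw [← simpleSpan_biUnion]
      exact simpleSpan_mem_fund_iff.2 hmem
  · rw [mem_sets, simpleSpan_univ]
    exact Λ.top_mem

/-- A component of the union of the labelled sets is one of them by nestedness; conversely a
labelled set lies in such a component and equals it by minimality. So a single index set records all
the labels. -/
theorem mem_comps_label {I : Finset (Fin n)} :
    I ∈ comps (indexFamily Δ G) Λ.label ↔ simpleSpan Δ I ∈ Λ.labelled := by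
  classical
  have hsub : (Finset.univ.filter fun I => simpleSpan Δ I ∈ Λ.labelled) ⊆ Λ.sets := fun A hA =>
    mem_sets.2 (Λ.minimal_of_labelled _ (Finset.mem_filter.1 hA).2).prop
  have h1 : comps (indexFamily Δ G) Λ.label ⊆
      Finset.univ.filter fun I => simpleSpan Δ I ∈ Λ.labelled := by
    have := (Λ.isLabelledNested_empty h𝓑).comps_biUnion_subset h𝓑 hsub
    unfold label
    convert this
  refine ⟨fun hI => (Finset.mem_filter.1 (h1 hI)).2, fun hI => ?_⟩
  have hI' : I ∈ Finset.univ.filter fun I => simpleSpan Δ I ∈ Λ.labelled :=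
    Finset.mem_filter.2 ⟨Finset.mem_univ I, hI⟩
  have hIS := hsub hI'
  have hle : I ⊆ Λ.label := by
    unfold label
    exact fun i hi => Finset.mem_biUnion.2 ⟨I, by convert hI', hi⟩
  obtain ⟨C, hC, hIC⟩ := exists_subset_mem_comps
    ((Λ.isLabelledNested_empty h𝓑).subset I hIS) hle
  have h2 := (Λ.minimal_of_labelled _ (Finset.mem_filter.1 (h1 hC)).2).eq_of_le (mem_sets.1 hIS)
    (simpleSpan_le_simpleSpan.2 hIC)
  rwa [simpleSpan_injective h2]

theorem isLabelledNested (Λ : LabelledNestedSet Δ G) :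
    IsLabelledNested (indexFamily Δ G) Λ.sets Λ.label := by
  have h0 := Λ.isLabelledNested_empty h𝓑
  refine ⟨h0.subset, h0.nested, h0.univ_mem, fun A hA => ?_, fun A hA B hB hBA => ?_⟩
  · exact mem_sets.2 (Λ.minimal_of_labelled _ ((mem_comps_label h𝓑).1 hA)).prop
  · exact simpleSpan_injective ((Λ.minimal_of_labelled _ ((mem_comps_label h𝓑).1 hA)).eq_of_le
      (mem_sets.1 hB) (simpleSpan_le_simpleSpan.2 hBA))

theorem image_comps_label (Λ : LabelledNestedSet Δ G) :
    simpleSpan Δ '' (comps (indexFamily Δ G) Λ.label : Set (Finset (Fin n))) = Λ.labelled := by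
  ext A
  constructor
  · rintro ⟨I, hI, rfl⟩
    exact (mem_comps_label h𝓑).1 hI
  · intro hA
    obtain ⟨I, -, rfl⟩ := Λ.exists_simpleSpan_eq (Λ.minimal_of_labelled A hA).prop
    exact ⟨I, (mem_comps_label h𝓑).2 hA, rfl⟩

theorem sSup_labelled (Λ : LabelledNestedSet Δ G) : sSup Λ.labelled = simpleSpan Δ Λ.label := by
  rw [← Λ.image_comps_label h𝓑, ← simpleSpan_biUnion, h𝓑.biUnion_comps]

theorem eq_of_sets_eq_of_label_eq (h1 : Λ.sets = Λ'.sets) (h2 : Λ.label = Λ'.label) :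
    Λ = Λ' := by
  refine ext_of_eq ?_ ?_
  · rw [← Λ.image_sets, h1, Λ'.image_sets]
  · rw [← Λ.image_comps_label h𝓑, h2, Λ'.image_comps_label h𝓑]

theorem exists_of_isLabelledNested {S : Finset (Finset (Fin n))} {D : Finset (Fin n)}
    (hS : IsLabelledNested (indexFamily Δ G) S D) :
    ∃ Λ : LabelledNestedSet Δ G, Λ.sets = S ∧ Λ.label = D := by
  classical
  let Λ : LabelledNestedSet Δ G :=
    { carrier := simpleSpan Δ '' (S : Set (Finset (Fin n)))
      isNested := by
        refine ⟨?_, fun T hT hnt hanti hmem => ?_⟩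
        · rintro _ ⟨A, hA, rfl⟩
          exact simpleSpan_mem_fund_iff.2 (hS.subset A hA)
        · set T' : Finset (Finset (Fin n)) := S.filter fun A => simpleSpan Δ A ∈ T with hT'
          have himg : simpleSpan Δ '' (T' : Set (Finset (Fin n))) = T := by
            ext A
            constructor
            · rintro ⟨I, hI, rfl⟩
              exact (Finset.mem_filter.1 hI).2
            · intro hA
              obtain ⟨I, hI, rfl⟩ := hT hA
              exact ⟨I, Finset.mem_filter.2 ⟨hI, hA⟩, rfl⟩
          refine hS.nested T' (Finset.filter_subset _ _) ?_ (fun A hA B hB hAB hle => ?_) ?_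
          · exact Set.nontrivial_of_image (simpleSpan Δ) _ (himg ▸ hnt)
          · exact hanti (Finset.mem_filter.1 hA).2 (Finset.mem_filter.1 hB).2
              (fun e => hAB (simpleSpan_injective e)) (simpleSpan_le_simpleSpan.2 hle)
          · rw [← himg, ← simpleSpan_biUnion] at hmem
            exact simpleSpan_mem_fund_iff.1 hmem
      top_mem := ⟨Finset.univ, hS.univ_mem, simpleSpan_univ⟩
      labelled := simpleSpan Δ '' (comps (indexFamily Δ G) D : Set (Finset (Fin n)))
      minimal_of_labelled := by
        rintro _ ⟨A, hA, rfl⟩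
        refine ⟨⟨A, hS.comps_subset hA, rfl⟩, ?_⟩
        rintro _ ⟨B, hB, rfl⟩ hBA
        rw [hS.minimal A hA B hB (simpleSpan_le_simpleSpan.1 hBA)] }
  refine ⟨Λ, ?_, ?_⟩
  · ext I
    rw [mem_sets]
    exact simpleSpan_injective.mem_set_image
  · refine h𝓑.eq_of_comps_eq ?_
    ext I
    rw [mem_comps_label h𝓑]
    exact simpleSpan_injective.mem_set_image

theorem refines_iff : Λ'.Refines Λ ↔ Λ.sets ⊆ Λ'.sets ∧ Λ'.label ⊆ Λ.label := by
  refine and_congr ⟨fun h I hI => mem_sets.2 (h (mem_sets.1 hI)), fun h A hA => ?_⟩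
    ⟨fun h i hi => ?_, fun h A hA => ?_⟩
  · obtain ⟨I, hI, rfl⟩ := Λ.exists_simpleSpan_eq hA
    exact mem_sets.1 (h hI)
  · obtain ⟨I, hI, hiI⟩ := h𝓑.exists_mem_comps hi
    obtain ⟨B, hB, hIB⟩ := h _ ((mem_comps_label h𝓑).1 hI)
    rw [← Λ.image_comps_label h𝓑] at hB
    obtain ⟨J, hJ, rfl⟩ := hB
    exact subset_of_mem_comps hJ (simpleSpan_le_simpleSpan.1 hIB hiI)
  · rw [← Λ'.image_comps_label h𝓑] at hA
    obtain ⟨I, hI, rfl⟩ := hA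
    obtain ⟨J, hJ, hIJ⟩ := exists_subset_mem_comps (mem_of_mem_comps hI)
      ((subset_of_mem_comps hI).trans h)
    exact ⟨_, (mem_comps_label h𝓑).1 hJ, simpleSpan_le_simpleSpan.2 hIJ⟩

theorem le_or_le (Λ : LabelledNestedSet Δ G) {A B C : Submodule ℝ V} (hA : A ∈ Λ.carrier)
    (hB : B ∈ Λ.carrier) (hC : C ∈ Λ.carrier) (hCA : C ≤ A) (hCB : C ≤ B) : A ≤ B ∨ B ≤ A := by
  have h0 := Λ.isLabelledNested_empty h𝓑
  obtain ⟨I, hI, rfl⟩ := Λ.exists_simpleSpan_eq hA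
  obtain ⟨J, hJ, rfl⟩ := Λ.exists_simpleSpan_eq hB
  obtain ⟨K, hK, rfl⟩ := Λ.exists_simpleSpan_eq hC
  obtain ⟨i, hi⟩ := h𝓑.nonempty K (h0.subset K hK)
  simp only [simpleSpan_le_simpleSpan] at hCA hCB ⊢
  exact h0.subset_or_subset h𝓑 hI hJ ⟨i, Finset.mem_inter.2 ⟨hCA hi, hCB hi⟩⟩

/-- A missing element above an old one is added first. Otherwise some minimal element X of Λ' is
missing: if it lies below a labelled B, that label is split; if not, X is added with trivial label.
When no element is missing, a superfluous label is dropped. -/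
theorem Refines.exists_move (h : Λ'.Refines Λ) (hne : Λ ≠ Λ') :
    ∃ Λ₁, Move Λ Λ₁ ∧ Λ'.Refines Λ₁ := by
  by_cases hcase : ∃ X ∈ Λ'.carrier, X ∉ Λ.carrier
  · by_cases habove : ∃ X ∈ Λ'.carrier, X ∉ Λ.carrier ∧ ∃ D ∈ Λ.carrier, D ≤ X
    · obtain ⟨X, hX, hXΛ, D, hD, hDX⟩ := habove
      have hmin : ∀ A ∈ Λ.labelled, Minimal (fun A => A ∈ insert X Λ.carrier) A := by
        intro A hA
        have hA' := Λ.minimal_of_labelled A hA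
        refine ⟨Set.mem_insert_of_mem _ hA'.prop, fun Y hY hYA => ?_⟩
        rcases hY with rfl | hY
        · exact (hA'.2 hD (hDX.trans hYA)).trans hDX
        · exact hA'.2 hY hYA
      exact ⟨Λ'.restrict (insert X Λ.carrier) Λ.labelled (Set.insert_subset hX h.1)
        (Set.mem_insert_of_mem _ Λ.top_mem) hmin,
        Move.addNonMinimal _ _ X hXΛ ⟨D, hD, hDX⟩ rfl rfl, Set.insert_subset hX h.1, h.2⟩
    · push Not at habove
      obtain ⟨X, hXmin, hXΛ⟩ : ∃ X, Minimal (fun A => A ∈ Λ'.carrier) X ∧ X ∉ Λ.carrier := by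
        obtain ⟨X, hX, hXΛ⟩ := hcase
        obtain ⟨Y, hYX, hY⟩ := Λ'.finite_carrier.exists_le_minimal hX
        exact ⟨Y, hY, fun hYΛ => habove X hX hXΛ Y hYΛ hYX⟩
      by_cases hbelow : ∃ B ∈ Λ.labelled, X ≤ B
      · obtain ⟨B, hB, hXB⟩ := hbelow
        have hB' := Λ.minimal_of_labelled B hB
        -- All minimal elements of Λ' below B are added at once, with labels: B loses its label, and
        -- the labels of Λ' below B must still be dominated. Labels absent from Λ' are dropped by
        -- later moves.
        set T : Set (Submodule ℝ V) := {Y | Minimal (fun A => A ∈ Λ'.carrier) Y ∧ Y ≤ B} with hT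
        have hTc : Λ.carrier ∪ T ⊆ Λ'.carrier := Set.union_subset h.1 fun Y hY => hY.1.prop
        have hnew : ∀ A ∈ T, A ∉ Λ.carrier := by
          intro A hA hAΛ
          have h1 := hB'.eq_of_le hAΛ hA.2
          rw [← h1] at hXB
          exact hXΛ ((hA.1.eq_of_le hXmin.prop hXB) ▸ hAΛ)
        have hTmin : ∀ A ∈ T, Minimal (fun A => A ∈ Λ.carrier ∪ T) A := fun A hA =>
          ⟨Or.inr hA, fun Y hY hYA => hA.1.2 (hTc hY) hYA⟩
        have hmin : ∀ A ∈ Λ.labelled \ {B} ∪ T, Minimal (fun A => A ∈ Λ.carrier ∪ T) A := by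
          rintro A (⟨hA, hAB⟩ | hA)
          · have hA' := Λ.minimal_of_labelled A hA
            refine ⟨Or.inl hA'.prop, fun Y hY hYA => ?_⟩
            rcases hY with hY | hY
            · exact hA'.2 hY hYA
            · refine absurd ?_ hAB
              rcases Λ'.le_or_le h𝓑 (h.1 hA'.prop) (h.1 hB'.prop) hY.1.prop hYA hY.2 with h1 | h1
              · exact hB'.eq_of_le hA'.prop h1
              · exact (hA'.eq_of_le hB'.prop h1).symm
          · exact hTmin A hA
        refine ⟨Λ'.restrict (Λ.carrier ∪ T) (Λ.labelled \ {B} ∪ T) hTc (Or.inl Λ.top_mem) hmin,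
          Move.addLabelled _ _ B T ⟨X, hXmin, hXB⟩ hnew hTmin hB (fun A hA => hA.2) rfl rfl,
          hTc, fun A hA => ?_⟩
        obtain ⟨B', hB'L, hAB'⟩ := h.2 A hA
        by_cases hBB' : B' = B
        · exact ⟨A, Or.inr ⟨Λ'.minimal_of_labelled A hA, hBB' ▸ hAB'⟩, le_rfl⟩
        · exact ⟨B', Or.inl ⟨hB'L, hBB'⟩, hAB'⟩
      · push Not at hbelow
        have hXc : insert X Λ.carrier ⊆ Λ'.carrier := Set.insert_subset hXmin.prop h.1
        have hmin : ∀ A ∈ Λ.labelled, Minimal (fun A => A ∈ insert X Λ.carrier) A := by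
          intro A hA
          have hA' := Λ.minimal_of_labelled A hA
          refine ⟨Set.mem_insert_of_mem _ hA'.prop, fun Y hY hYA => ?_⟩
          rcases hY with rfl | hY
          · exact absurd hYA (hbelow A hA)
          · exact hA'.2 hY hYA
        refine ⟨Λ'.restrict (insert X Λ.carrier) Λ.labelled hXc
          (Set.mem_insert_of_mem _ Λ.top_mem) hmin,
          Move.addTrivial _ _ X hXΛ ⟨Set.mem_insert _ _, fun Y hY => hXmin.2 (hXc hY)⟩ ?_ rfl rfl,
          hXc, h.2⟩
        by_cases hex : ∃ B, Minimal (fun B => B ∈ Λ.carrier) B ∧ X ≤ B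
        · obtain ⟨B, hB, hXB⟩ := hex
          exact Or.inr ⟨B, hB, fun hBL => hbelow B hBL hXB, hXB⟩
        · push Not at hex
          exact Or.inl hex
  · push Not at hcase
    have hsub := h.labelled_subset hcase
    obtain ⟨A, hA, hAΛ'⟩ : ∃ A ∈ Λ.labelled, A ∉ Λ'.labelled := by
      by_contra hcon
      push Not at hcon
      exact hne (ext_of_eq (h.1.antisymm hcase) (Set.Subset.antisymm hcon hsub))
    exact ⟨Λ'.restrict Λ.carrier (Λ.labelled \ {A}) h.1 Λ.top_mem
      fun B hB => Λ.minimal_of_labelled B hB.1, Move.dropLabel _ _ A hA rfl rfl, h.1,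
      fun B hB => ⟨B, ⟨hsub hB, fun e => hAΛ' (e ▸ hB)⟩, le_rfl⟩⟩

theorem finite : Finite (LabelledNestedSet Δ G) :=
  Finite.of_injective (fun Λ => (Λ.sets, Λ.label)) fun _ _ h =>
    eq_of_sets_eq_of_label_eq h𝓑 (Prod.ext_iff.1 h).1 (Prod.ext_iff.1 h).2

/-- The moves generate the strict refinement order. -/
theorem transGen_move_iff :
    Relation.TransGen Move Λ Λ' ↔ Λ'.Refines Λ ∧ ¬ Λ.Refines Λ' := by
  refine ⟨refines_of_transGen_move, ?_⟩
  rintro ⟨h1, h2⟩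
  have := finite h𝓑
  have hne : Λ ≠ Λ' := fun e => h2 (e ▸ Refines.refl Λ)
  clear h2
  let r : LabelledNestedSet Δ G → LabelledNestedSet Δ G → Prop :=
    fun Λ' Λ => Λ'.Refines Λ ∧ ¬ Λ.Refines Λ'
  have htrans : IsTrans _ r := ⟨fun a b c hab hbc =>
    ⟨hab.1.trans hbc.1, fun h => hbc.2 (h.trans hab.1)⟩⟩
  have hirr : Std.Irrefl r := ⟨fun a h => h.2 h.1⟩
  have hwf : WellFounded r := Finite.wellFounded_of_trans_of_irrefl r
  induction Λ using hwf.induction with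
  | _ Λ ih =>
    obtain ⟨Λ₁, hm, hr⟩ := h1.exists_move h𝓑 hne
    by_cases he : Λ₁ = Λ'
    · exact Relation.TransGen.single (he ▸ hm)
    · exact Relation.TransGen.head hm (ih Λ₁ hm.refines hr he)

end LabelledNestedSet

end Moves

/-! ### Cosets, the face correspondence and the order -/

section FaceIndex

variable {V : Type*} [NormedAddCommGroup V] [InnerProductSpace ℝ V] [FiniteDimensional ℝ V]
  {Φ : Finset V} {n : ℕ} {Δ : Module.Basis (Fin n) ℝ V} {G : Set (Submodule ℝ V)} {ε : ℕ → ℝ}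
  {Λ Λ' : LabelledNestedSet Δ G} {σ σ' : V ≃ₗᵢ[ℝ] V}

namespace IsAdmissible

variable (h : IsAdmissible Φ Δ G ε)
include h

theorem labelGroup_eq (Λ : LabelledNestedSet Δ G) :
    labelGroup Φ Λ = parabolic Φ (simpleSpan Δ Λ.label) := by
  rw [parabolic_simpleSpan h.root h.simple h.building, labelGroup, ← Λ.image_comps_label h.family,
    iSup_image]
  rfl

/-- Distinct labels span orthogonal subspaces, and each group moves vectors along its own subspace
while fixing its orthogonal complement. -/
theorem commute_of_labelled {A B : Submodule ℝ V} (hA : A ∈ Λ.labelled) (hB : B ∈ Λ.labelled)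
    (hAB : A ≠ B) {g k : V ≃ₗᵢ[ℝ] V} (hg : g ∈ parabolic Φ A) (hk : k ∈ parabolic Φ B) :
    Commute g k := by
  rw [← Λ.image_comps_label h.family] at hA hB
  obtain ⟨I, hI, rfl⟩ := hA
  obtain ⟨J, hJ, rfl⟩ := hB
  have hdisj := h.family.disjoint_of_mem_comps hI hJ fun e => hAB (e ▸ rfl)
  have hsep : Separated (indexFamily Δ G) I J :=
    (Separated.of_mem_comps h.family hI).mono subset_rfl
      (Finset.subset_sdiff.2 ⟨subset_of_mem_comps hJ, hdisj.symm⟩)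
  have horth : ∀ v ∈ simpleSpan Δ I, ∀ u ∈ simpleSpan Δ J, ⟪v, u⟫_ℝ = 0 := by
    have h1 : simpleSpan Δ I ⟂ simpleSpan Δ J := by
      rw [simpleSpan, simpleSpan, Submodule.isOrtho_span]
      rintro _ ⟨i, hi, rfl⟩ _ ⟨j, hj, rfl⟩
      exact inner_eq_zero_of_separated h.root h.simple h.building hsep hi hj
    exact fun v hv u hu => Submodule.isOrtho_iff_inner_eq.1 h1 v hv u hu
  refine LinearIsometryEquiv.ext fun x => ?_
  have h1 := apply_eq_self_of_mem_parabolic hg fun v hv =>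
    horth v hv _ (apply_sub_self_mem_of_mem_parabolic hk x)
  have h2 := apply_eq_self_of_mem_parabolic hk fun u hu => by
    rw [real_inner_comm]
    exact horth _ (apply_sub_self_mem_of_mem_parabolic hg x) u hu
  rw [map_sub, sub_eq_iff_eq_add] at h1 h2
  show g (k x) = k (g x)
  rw [h1, h2]
  abel

/-- An element of one label group that is also generated by the others moves every vector along two
spans with disjoint sets of simple roots, hence not at all. -/
theorem iSupIndep_labels (Λ : LabelledNestedSet Δ G) :
    iSupIndep fun A : Λ.labelled => parabolic Φ (A : Submodule ℝ V) := by
  rintro ⟨A, hA⟩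
  have hA' := hA
  rw [← Λ.image_comps_label h.family] at hA'
  obtain ⟨I, hI, rfl⟩ := hA'
  have hle : ⨆ (B : Λ.labelled) (_ : B ≠ ⟨simpleSpan Δ I, hA⟩), parabolic Φ (B : Submodule ℝ V) ≤
      parabolic Φ (simpleSpan Δ (Λ.label \ I)) := by
    refine iSup₂_le fun ⟨B, hB⟩ hne => ?_
    rw [← Λ.image_comps_label h.family] at hB
    obtain ⟨J, hJ, rfl⟩ := hB
    refine parabolic_mono Φ (simpleSpan_le_simpleSpan.2 (Finset.subset_sdiff.2
      ⟨subset_of_mem_comps hJ, h.family.disjoint_of_mem_comps hJ hI fun e => hne ?_⟩))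
    simp only [e]
  refine Subgroup.disjoint_def.2 fun {g} hg hg' => LinearIsometryEquiv.ext fun x => ?_
  have h1 := mem_simpleSpan.1 (apply_sub_self_mem_of_mem_parabolic hg x)
  have h2 := mem_simpleSpan.1 (apply_sub_self_mem_of_mem_parabolic (hle hg') x)
  rw [← sub_eq_zero]
  refine Δ.ext_elem fun i => ?_
  rw [map_zero, Finsupp.zero_apply]
  by_cases hi : i ∈ I
  · exact h2 i fun hi' => (Finset.mem_sdiff.1 hi').2 hi
  · exact h1 i hi

theorem cosetFace_eq (σ : V ≃ₗᵢ[ℝ] V) (Λ : LabelledNestedSet Δ G) :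
    cosetFace Φ ε σ Λ = (fun x : V => σ x) '' stdFace Φ Δ G ε Λ.sets Λ.label := by
  rw [cosetFace, h.stdFace_eq_convexHull (Λ.isLabelledNested h.family), h.labelGroup_eq,
    ← h.nestFace_eq_stdFace (Λ.isLabelledNested h.family), Λ.image_sets]

theorem cosetFace_one (Λ : LabelledNestedSet Δ G) :
    cosetFace Φ ε 1 Λ = stdFace Φ Δ G ε Λ.sets Λ.label := by
  rw [h.cosetFace_eq]
  exact Set.image_id _

theorem cosetFace_eq_faceOf (hσ : σ ∈ coxeterGroup Φ) {x : V}
    (hx : IsGeneric Φ Δ G ε Λ.sets Λ.label x) :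
    cosetFace Φ ε σ Λ = faceOf (wallVec Φ Δ) (wallConst Φ Δ G ε) (σ x) := by
  rw [h.cosetFace_eq, h.faceOf_apply hσ, h.faceOf_eq_stdFace hx]

theorem mem_coset_iff {g : V ≃ₗᵢ[ℝ] V} :
    g ∈ coset Φ σ Λ ↔ σ⁻¹ * g ∈ parabolic Φ (simpleSpan Δ Λ.label) := by
  rw [coset, h.labelGroup_eq]
  constructor
  · rintro ⟨k, hk, rfl⟩
    simpa using hk
  · exact fun hg => ⟨_, hg, mul_inv_cancel_left σ g⟩

theorem coset_subset_iff :
    coset Φ σ' Λ' ⊆ coset Φ σ Λ ↔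
      Λ'.label ⊆ Λ.label ∧ σ⁻¹ * σ' ∈ parabolic Φ (simpleSpan Δ Λ.label) := by
  rw [← parabolic_simpleSpan_le_iff h.root h.simple]
  have hmem : ∀ k ∈ parabolic Φ (simpleSpan Δ Λ'.label), σ' * k ∈ coset Φ σ' Λ' := fun k hk => by
    rw [h.mem_coset_iff, inv_mul_cancel_left]
    exact hk
  constructor
  · intro hsub
    have h1 := h.mem_coset_iff.1 (hsub (hmem 1 (Subgroup.one_mem _)))
    rw [mul_one] at h1
    refine ⟨fun k hk => ?_, h1⟩
    have h2 := h.mem_coset_iff.1 (hsub (hmem k hk))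
    rwa [← mul_assoc, Subgroup.mul_mem_cancel_left _ h1] at h2
  · rintro ⟨h1, h2⟩ g hg
    have h3 := Subgroup.mul_mem _ h2 (h1 (h.mem_coset_iff.1 hg))
    rw [h.mem_coset_iff]
    rwa [mul_assoc, mul_inv_cancel_left] at h3

/-- Translation by σ⁻¹ reduces to the inclusion of faces of generic points; the condition D' ⊆ D is
shared by coset containment and refinement. -/
theorem cosetFace_subset_iff (hσ : σ ∈ coxeterGroup Φ) (hσ' : σ' ∈ coxeterGroup Φ) :
    cosetFace Φ ε σ' Λ' ⊆ cosetFace Φ ε σ Λ ↔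
      coset Φ σ' Λ' ⊆ coset Φ σ Λ ∧ Λ'.Refines Λ := by
  obtain ⟨x, hx⟩ := h.exists_isGeneric (Λ.isLabelledNested h.family)
  obtain ⟨x', hx'⟩ := h.exists_isGeneric (Λ'.isLabelledNested h.family)
  have hσσ' := Subgroup.mul_mem _ (Subgroup.inv_mem _ hσ) hσ'
  have hface : cosetFace Φ ε σ' Λ' = (fun z : V => σ z) ''
      faceOf (wallVec Φ Δ) (wallConst Φ Δ G ε) ((σ⁻¹ * σ') x') := by
    rw [h.cosetFace_eq_faceOf hσ' hx', ← h.faceOf_apply hσ]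
    exact congrArg _ (apply_inv_self' σ (σ' x')).symm
  rw [hface, h.cosetFace_eq_faceOf hσ hx, h.faceOf_apply hσ, Set.image_subset_image_iff σ.injective,
    h.faceOf_subset_iff_of_isGeneric (Λ.isLabelledNested h.family)
      (Λ'.isLabelledNested h.family) hx hx' hσσ', h.coset_subset_iff,
    LabelledNestedSet.refines_iff h.family]
  tauto

/-- The face that corresponds to a labelled nested set and a coset. -/
def face (p : FaceIndex Φ Δ G) : PolytopeFace (permutonestohedron Φ Δ G ε) :=
  ⟨cosetFace Φ ε p.isCoset.choose p.nestedSet, by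
    have := h.root.finite_coxeterGroup
    obtain ⟨x, hx⟩ := h.exists_isGeneric (p.nestedSet.isLabelledNested h.family)
    have hσ := p.isCoset.choose_spec.1
    have hxP := h.apply_mem hσ hx.mem
    rw [h.cosetFace_eq_faceOf hσ hx, h.permutonestohedron_eq]
    exact ⟨⟨_, self_mem_faceOf hxP⟩, isExposed_faceOf hxP⟩⟩

/-- The value does not depend on the chosen representative: equal cosets give faces that contain
each other. -/
theorem coe_face (p : FaceIndex Φ Δ G) (hσ : σ ∈ coxeterGroup Φ)
    (hp : p.cosetSet = coset Φ σ p.nestedSet) :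
    (h.face p : Set V) = cosetFace Φ ε σ p.nestedSet := by
  obtain ⟨h1, h2⟩ := p.isCoset.choose_spec
  have h3 := h2.symm.trans hp
  exact Set.Subset.antisymm
    ((h.cosetFace_subset_iff hσ h1).2 ⟨h3.subset, LabelledNestedSet.Refines.refl _⟩)
    ((h.cosetFace_subset_iff h1 hσ).2 ⟨h3.superset, LabelledNestedSet.Refines.refl _⟩)

theorem face_subset_iff (p' p : FaceIndex Φ Δ G) :
    (h.face p' : Set V) ⊆ h.face p ↔
      p'.cosetSet ⊆ p.cosetSet ∧ p'.nestedSet.Refines p.nestedSet := by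
  obtain ⟨σ, hσ, hp⟩ := p.isCoset
  obtain ⟨σ', hσ', hp'⟩ := p'.isCoset
  rw [h.coe_face p hσ hp, h.coe_face p' hσ' hp', h.cosetFace_subset_iff hσ hσ', hp, hp']

theorem face_injective : Function.Injective h.face := by
  intro p p' he
  obtain ⟨h1, h2⟩ := (h.face_subset_iff p p').1 (he ▸ subset_rfl)
  obtain ⟨h3, h4⟩ := (h.face_subset_iff p' p).1 (he ▸ subset_rfl)
  have h5 := h1.antisymm h3
  have h6 := h4.antisymm h2
  cases p
  cases p'
  cases h5
  cases h6
  rfl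

theorem face_surjective : Function.Surjective h.face := by
  have := h.root.finite_coxeterGroup
  rintro ⟨F, hne, hF⟩
  rw [h.permutonestohedron_eq] at hF
  obtain ⟨x, -, hx, rfl⟩ := exists_eq_faceOf hF hne
  obtain ⟨σ, hσ, S, D, x', hS, hx', he⟩ := h.exists_faceOf_eq hx
  obtain ⟨Λ, rfl, rfl⟩ := LabelledNestedSet.exists_of_isLabelledNested h.family hS
  refine ⟨⟨Λ, coset Φ σ Λ, σ, hσ, rfl⟩, Subtype.ext ?_⟩
  rw [h.coe_face _ hσ rfl, h.cosetFace_eq_faceOf hσ hx']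
  exact he.symm

theorem face_lt_iff (p' p : FaceIndex Φ Δ G) :
    h.face p' < h.face p ↔
      p'.cosetSet ⊆ p.cosetSet ∧ Relation.TransGen Move p.nestedSet p'.nestedSet := by
  have hle : ∀ q' q, h.face q' ≤ h.face q ↔
      q'.cosetSet ⊆ q.cosetSet ∧ q'.nestedSet.Refines q.nestedSet := h.face_subset_iff
  rw [lt_iff_le_not_ge, hle, hle, LabelledNestedSet.transGen_move_iff h.family]
  constructor
  · rintro ⟨⟨h1, h2⟩, h3⟩
    -- If the labelled nested sets refine each other they are equal, and a coset contained in a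
    -- coset of the same group is all of it; so a strict inclusion of faces forces a strict
    -- refinement.
    refine ⟨h1, h2, fun h4 => h3 ⟨?_, h4⟩⟩
    obtain ⟨σ, hσ, hp⟩ := p.isCoset
    obtain ⟨σ', hσ', hp'⟩ := p'.isCoset
    rw [hp, hp', h.coset_subset_iff] at h1 ⊢
    have h5 := h2.antisymm h4
    rw [h5] at h1 ⊢
    refine ⟨subset_rfl, ?_⟩
    simpa using Subgroup.inv_mem _ h1.2
  · rintro ⟨h1, h2, h3⟩
    exact ⟨⟨h1, h2⟩, fun h4 => h3 h4.2⟩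

theorem finrank_direction_face (p : FaceIndex Φ Δ G) :
    Module.finrank ℝ (affineSpan ℝ (h.face p : Set V)).direction + p.nestedSet.carrier.ncard =
      n + p.nestedSet.labelled.ncard := by
  obtain ⟨σ, hσ, hp⟩ := p.isCoset
  have hdir : (affineSpan ℝ (h.face p : Set V)).direction =
      (affineSpan ℝ (stdFace Φ Δ G ε p.nestedSet.sets p.nestedSet.label)).direction.map
        (σ.toLinearEquiv : V →ₗ[ℝ] V) := by
    rw [h.coe_face p hσ hp, h.cosetFace_eq, direction_affineSpan, direction_affineSpan]
    exact (AffineMap.map_vectorSpan (σ.toLinearEquiv : V →ₗ[ℝ] V).toAffineMap).symm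
  rw [hdir, LinearEquiv.finrank_map_eq, ← p.nestedSet.image_sets,
    ← p.nestedSet.image_comps_label h.family, Set.ncard_image_of_injective _ simpleSpan_injective,
    Set.ncard_image_of_injective _ simpleSpan_injective, Set.ncard_coe_finset,
    Set.ncard_coe_finset]
  exact h.finrank_direction (p.nestedSet.isLabelledNested h.family)

theorem cosetFace_one_eq_inter (htop : ⊤ ∉ Λ.labelled) :
    cosetFace Φ ε 1 Λ = permutonestohedron Φ Δ G ε ∩ wall Φ Δ G ε (sSup Λ.labelled) ∩
      ⋂ B ∈ Λ.carrier \ insert ⊤ Λ.labelled, wall Φ Δ G ε (B ⊔ sSup Λ.labelled) := by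
  have hΛ := Λ.isLabelledNested h.family
  have hD : Λ.label ≠ Finset.univ := by
    intro e
    refine htop ?_
    rw [← simpleSpan_univ (Δ := Δ), ← LabelledNestedSet.mem_comps_label h.family, e,
      comps_of_mem h.univ_mem]
    exact Finset.mem_singleton_self _
  have hmem : ∀ B, B ∈ Λ.sets \ insert Finset.univ (comps (indexFamily Δ G) Λ.label) ↔
      simpleSpan Δ B ∈ Λ.carrier \ insert ⊤ Λ.labelled := by
    intro B
    rw [Finset.mem_sdiff, Set.mem_sdiff, Finset.mem_insert, Set.mem_insert_iff, simpleSpan_eq_top,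
      LabelledNestedSet.mem_sets, LabelledNestedSet.mem_comps_label h.family]
  rw [h.cosetFace_one, h.permutonestohedron_eq, Λ.sSup_labelled h.family]
  ext z
  rw [Set.inter_assoc]
  refine and_congr_right fun _ => ?_
  rw [hΛ.tight_iff_generators h.family (h.sepAdditive_excessAt z), Set.mem_inter_iff,
    h.mem_wall_iff hD, Set.mem_iInter₂]
  refine and_congr_right fun _ => ?_
  have hwall : ∀ B ∈ Λ.sets \ insert Finset.univ (comps (indexFamily Δ G) Λ.label),
      z ∈ wall Φ Δ G ε (simpleSpan Δ B ⊔ simpleSpan Δ Λ.label) ↔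
        excessAt Φ Δ G ε z (B ∪ Λ.label) = excessAt Φ Δ G ε z Finset.univ := by
    intro B hB
    rw [← simpleSpan_union, h.mem_wall_iff]
    intro e
    -- B is a component of D ∪ B, so B + D can be the whole space only if B is.
    have h1 := hΛ.mem_comps_union h.family (Finset.mem_sdiff.1 hB).1
    rw [Finset.union_comm, e, comps_of_mem h.univ_mem, Finset.mem_singleton] at h1
    exact (Finset.mem_sdiff.1 hB).2 (h1 ▸ Finset.mem_insert_self _ _)
  constructor
  · intro hz B hB
    obtain ⟨I, -, rfl⟩ := Λ.exists_simpleSpan_eq hB.1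
    have hI := (hmem I).2 hB
    exact (hwall I hI).2 (hz I hI)
  · exact fun hz B hB => (hwall B hB).1 (hz _ ((hmem B).1 hB))

theorem cosetFace_one_eq_self (htop : ⊤ ∈ Λ.labelled) :
    cosetFace Φ ε 1 Λ = permutonestohedron Φ Δ G ε := by
  rw [h.cosetFace_one, h.permutonestohedron_eq]
  refine Set.Subset.antisymm (fun z hz => hz.1) fun z hz => ⟨hz, fun I hI => ?_⟩
  rw [← simpleSpan_univ (Δ := Δ), ← LabelledNestedSet.mem_comps_label h.family] at htop
  rw [Finset.univ_subset_iff.1 ((subset_of_mem_comps htop).trans hI.2)]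

end IsAdmissible

end FaceIndex

end Permutonesto

end

/-! ### The main theorem -/

theorem mainTheorem3 {V : Type*} [NormedAddCommGroup V] [InnerProductSpace ℝ V]
    [FiniteDimensional ℝ V] {n : ℕ}
    (Φ : Finset V) (hΦ : Permutonesto.IsRootSystem Φ)
    (Δ : Module.Basis (Fin n) ℝ V) (hΔ : Permutonesto.IsSimpleSystem Φ Δ)
    (G : Set (Submodule ℝ V)) (hG : Permutonesto.IsBuildingSet Φ G)
    (hGtop : ⊤ ∈ G)
    (hGinv : ∀ w ∈ Permutonesto.coxeterGroup Φ, ∀ A ∈ G,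
      A.map (w.toLinearEquiv : V →ₗ[ℝ] V) ∈ G)
    (ε : ℕ → ℝ) (hε : Permutonesto.IsSuitable Φ Δ G ε) :
    -- the group `H` of a labelled nested set is the internal direct product of the labels
    (∀ S : Permutonesto.LabelledNestedSet Δ G,
      (∀ A ∈ S.labelled, ∀ B ∈ S.labelled, A ≠ B →
        ∀ g ∈ Permutonesto.parabolic Φ A, ∀ h ∈ Permutonesto.parabolic Φ B, Commute g h) ∧
      iSupIndep (fun A : S.labelled => Permutonesto.parabolic Φ (A : Submodule ℝ V))) ∧
    -- the bijection, the dimension formula and the order relation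
    (∃ e : Permutonesto.FaceIndex Φ Δ G ≃
        Permutonesto.PolytopeFace (Permutonesto.permutonestohedron Φ Δ G ε),
      (∀ p, ∀ σ ∈ Permutonesto.coxeterGroup Φ, p.cosetSet = Permutonesto.coset Φ σ p.nestedSet →
        (e p : Set V) = Permutonesto.cosetFace Φ ε σ p.nestedSet) ∧
      (∀ p, Module.finrank ℝ (affineSpan ℝ (e p : Set V)).direction + p.nestedSet.carrier.ncard =
        n + p.nestedSet.labelled.ncard) ∧
      (∀ p' p, e p' < e p ↔ p'.cosetSet ⊆ p.cosetSet ∧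
        Relation.TransGen Permutonesto.Move p.nestedSet p'.nestedSet)) ∧
    -- the defining hyperplanes that cut out the face of `(H, S)`
    (∀ S : Permutonesto.LabelledNestedSet Δ G, S.labelled.Nonempty → ⊤ ∉ S.labelled →
      Permutonesto.cosetFace Φ ε 1 S =
        Permutonesto.permutonestohedron Φ Δ G ε ∩
          Permutonesto.wall Φ Δ G ε (sSup S.labelled) ∩
          ⋂ B ∈ S.carrier \ insert ⊤ S.labelled,
            Permutonesto.wall Φ Δ G ε (B ⊔ sSup S.labelled)) ∧
    (∀ S : Permutonesto.LabelledNestedSet Δ G, ⊤ ∈ S.labelled →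
      Permutonesto.cosetFace Φ ε 1 S = Permutonesto.permutonestohedron Φ Δ G ε) := by
  have h : Permutonesto.IsAdmissible Φ Δ G ε := ⟨hΦ, hΔ, hG, hGtop, hε⟩
  refine ⟨fun S => ⟨fun A hA B hB hAB g hg k hk => h.commute_of_labelled hA hB hAB hg hk,
    h.iSupIndep_labels S⟩, ⟨Equiv.ofBijective h.face ⟨h.face_injective, h.face_surjective⟩,
    fun p σ hσ hp => h.coe_face p hσ hp, h.finrank_direction_face, h.face_lt_iff⟩,
    fun S _ htop => h.cosetFace_one_eq_inter htop, fun S htop => h.cosetFace_one_eq_self htop⟩
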